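/- For a countable discrete group $G$ let $C^*_rG$ be its reduced $C^*$-algebra (the norm closure of the image of $\mathbb{C}G$ acting by left translations on $\ell^2(G)$), and let $\mathrm{tr}_G\colon K_0(C^*_rG)\to\mathbb{R}$ be the homomorphism induced by the canonical trace, i.e. $[p]\mapsto\sum_i\langle\delta_1,p_{ii}\delta_1\rangle$ for a projection $p\in M_n(C^*_rG)$. Let $H$ be a countable group. Say that a group $G$ is subdued by $H$ if $G$ acts without inversion of edges on a tree and there is a homomorphism $\alpha\colon G\to H$ whose restriction to the stabilizer $G_v$ of every vertex $v$ of the tree is injective. (1) If $G$ is a countable group that is subdued by $H$, then $$\mathrm{tr}_G\bigl(K_0(C^*_rG)\bigr)\subset\mathrm{tr}_H\bigl(K_0(C^*_rH)\bigr).$$ (2) In particular, this applies to every amalgamated free product $G=H*_UH$ of two copies of $H$ along a subgroup $U\le H$: such a $G$ is subdued by $H$, and hence $\mathrm{tr}_G(K_0(C^*_rG))\subset\mathrm{tr}_H(K_0(C^*_rH))$. (3) In particular, this also applies to every HNN-extension $G$ of $H$ along an isomorphism $\varphi\colon A\to B$ between subgroups of $H$ which is given by conjugation with an element $g\in H$,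 i.e. $\varphi(a)=gag^{-1}$ for all $a\in A$: such a $G$ is subdued by $H$, and hence $\mathrm{tr}_G(K_0(C^*_rG))\subset\mathrm{tr}_H(K_0(C^*_rH))$. -/

import Mathlib

open scoped Matrix

universe u v w

noncomputable section

/-! ### The operator K-group `K₀` of a unital star ring

`K₀` is the Grothendieck group of the monoid of Murray-von Neumann classes of projections in
matrices of arbitrary finite size, with addition induced by the block sum. -/

/-- Murray-von Neumann equivalence of matrices `p ∈ M_m(A)`, `q ∈ M_n(A)`: there is a rectangular
matrix `v` with `v* v = p` and `v v* = q`. -/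
def MvNEquiv {A : Type u} [Ring A] [StarRing A] {m n : Type} [Fintype m] [Fintype n]
    (p : Matrix m m A) (q : Matrix n n A) : Prop :=
  ∃ v : Matrix n m A, vᴴ * v = p ∧ v * vᴴ = q

namespace MvNEquiv

variable {A : Type u} [Ring A] [StarRing A] {m n k l : Type} [Fintype m] [Fintype n] [Fintype k]
  [Fintype l]

theorem refl {p : Matrix m m A} (hp : IsStarProjection p) : MvNEquiv p p := by
  have h1 : p * p = p := hp.isIdempotentElem
  have h2 : pᴴ = p := hp.isSelfAdjoint
  exact ⟨p, by rw [h2, h1], by rw [h2, h1]⟩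

theorem symm {p : Matrix m m A} {q : Matrix n n A} (h : MvNEquiv p q) : MvNEquiv q p := by
  obtain ⟨v, h1, h2⟩ := h
  exact ⟨vᴴ, by simpa using h2, by simpa using h1⟩

theorem trans {p : Matrix m m A} {q : Matrix n n A} {r : Matrix k k A} (hp : IsStarProjection p)
    (hr : IsStarProjection r) (h : MvNEquiv p q) (h' : MvNEquiv q r) : MvNEquiv p r := by
  obtain ⟨v, h1, h2⟩ := h
  obtain ⟨x, h3, h4⟩ := h'
  have hp1 : p * p = p := hp.isIdempotentElem
  have hr1 : r * r = r := hr.isIdempotentElem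
  refine ⟨x * v, ?_, ?_⟩
  · calc (x * v)ᴴ * (x * v) = vᴴ * (xᴴ * x) * v := by
          simp only [Matrix.conjTranspose_mul, Matrix.mul_assoc]
      _ = (vᴴ * v) * (vᴴ * v) := by rw [h3, ← h2]; simp only [Matrix.mul_assoc]
      _ = p := by rw [h1, hp1]
  · calc (x * v) * (x * v)ᴴ = x * (v * vᴴ) * xᴴ := by
          simp only [Matrix.conjTranspose_mul, Matrix.mul_assoc]
      _ = (x * xᴴ) * (x * xᴴ) := by rw [h2, ← h3]; simp only [Matrix.mul_assoc]
      _ = r := by rw [h4, hr1]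

theorem of_reindex {p : Matrix m m A} (hp : IsStarProjection p) (e : m ≃ n) :
    MvNEquiv p (Matrix.reindex e e p) := by
  have h1 : p * p = p := hp.isIdempotentElem
  have h2 : pᴴ = p := hp.isSelfAdjoint
  refine ⟨p.submatrix e.symm id, ?_, ?_⟩
  · rw [Matrix.conjTranspose_submatrix, h2, Matrix.submatrix_mul_equiv, h1, Matrix.submatrix_id_id]
  · rw [Matrix.conjTranspose_submatrix, h2, ← Matrix.submatrix_mul _ _ _ _ _ Function.bijective_id,
      h1, Matrix.reindex_apply]

theorem blockSum {p : Matrix m m A} {q : Matrix n n A} {p' : Matrix k k A} {q' : Matrix l l A}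
    (h : MvNEquiv p q) (h' : MvNEquiv p' q') :
    MvNEquiv (Matrix.fromBlocks p 0 0 p') (Matrix.fromBlocks q 0 0 q') := by
  obtain ⟨v, h1, h2⟩ := h
  obtain ⟨x, h3, h4⟩ := h'
  refine ⟨Matrix.fromBlocks v 0 0 x, ?_, ?_⟩
  · simp [Matrix.fromBlocks_conjTranspose, Matrix.fromBlocks_multiply, h1, h3]
  · simp [Matrix.fromBlocks_conjTranspose, Matrix.fromBlocks_multiply, h2, h4]

end MvNEquiv

theorem IsStarProjection.blockSum {A : Type u} [Ring A] [StarRing A] {m n : Type} [Fintype m]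
    [Fintype n] {p : Matrix m m A} {q : Matrix n n A} (hp : IsStarProjection p)
    (hq : IsStarProjection q) : IsStarProjection (Matrix.fromBlocks p 0 0 q) := by
  have h1 : p * p = p := hp.isIdempotentElem
  have h2 : pᴴ = p := hp.isSelfAdjoint
  have h3 : q * q = q := hq.isIdempotentElem
  have h4 : qᴴ = q := hq.isSelfAdjoint
  refine ⟨?_, ?_⟩
  · simp [IsIdempotentElem, Matrix.fromBlocks_multiply, h1, h3]
  · simp [IsSelfAdjoint, Matrix.star_eq_conjTranspose, Matrix.fromBlocks_conjTranspose, h2, h4]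

theorem IsStarProjection.matrixReindex {A : Type u} [Ring A] [StarRing A] {m n : Type} [Fintype m]
    [Fintype n] {p : Matrix m m A} (hp : IsStarProjection p) (e : m ≃ n) :
    IsStarProjection (Matrix.reindex e e p) := by
  have h1 : p * p = p := hp.isIdempotentElem
  have h2 : pᴴ = p := hp.isSelfAdjoint
  refine ⟨?_, ?_⟩
  · rw [IsIdempotentElem, Matrix.reindex_apply, Matrix.submatrix_mul_equiv, h1]
  · rw [IsSelfAdjoint, Matrix.star_eq_conjTranspose, Matrix.conjTranspose_reindex, h2]

/-- A projection (self-adjoint idempotent) in `M_n(A)` for some `n`. -/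
structure MatrixProjection (A : Type u) [Ring A] [StarRing A] where
  size : ℕ
  mat : Matrix (Fin size) (Fin size) A
  isProj : IsStarProjection mat

namespace MatrixProjection

variable {A : Type u} [Ring A] [StarRing A]

/-- The block diagonal sum `diag(p, q)`. -/
def sum (p q : MatrixProjection A) : MatrixProjection A where
  size := p.size + q.size
  mat := Matrix.reindex finSumFinEquiv finSumFinEquiv (Matrix.fromBlocks p.mat 0 0 q.mat)
  isProj := (p.isProj.blockSum q.isProj).matrixReindex _

/-- The empty (`0 × 0`) projection. -/
def zero : MatrixProjection A where
  size := 0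
  mat := 0
  isProj := IsStarProjection.zero _

/-- Murray-von Neumann equivalence as a setoid. -/
instance setoid (A : Type u) [Ring A] [StarRing A] : Setoid (MatrixProjection A) where
  r p q := MvNEquiv p.mat q.mat
  iseqv :=
    { refl := fun p => MvNEquiv.refl p.isProj
      symm := fun h => h.symm
      trans := fun {p _ r} h h' => MvNEquiv.trans p.isProj r.isProj h h' }

theorem equiv_def {p q : MatrixProjection A} : p ≈ q ↔ MvNEquiv p.mat q.mat := Iff.rfl

theorem equiv_sum (p q : MatrixProjection A) :
    MvNEquiv (Matrix.fromBlocks p.mat 0 0 q.mat) (p.sum q).mat :=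
  MvNEquiv.of_reindex (p.isProj.blockSum q.isProj) _

theorem sum_congr {p p' q q' : MatrixProjection A} (h : p ≈ p') (h' : q ≈ q') :
    p.sum q ≈ p'.sum q' :=
  MvNEquiv.trans (p.sum q).isProj (p'.sum q').isProj (equiv_sum p q).symm
    (MvNEquiv.trans (p.isProj.blockSum q.isProj) (p'.sum q').isProj
      (MvNEquiv.blockSum h h') (equiv_sum p' q'))

theorem sum_comm (p q : MatrixProjection A) : p.sum q ≈ q.sum p := by
  refine MvNEquiv.trans (p.sum q).isProj (q.sum p).isProj (equiv_sum p q).symm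
    (MvNEquiv.trans (p.isProj.blockSum q.isProj) (q.sum p).isProj ?_ (equiv_sum q p))
  convert MvNEquiv.of_reindex (p.isProj.blockSum q.isProj) (Equiv.sumComm _ _) using 1
  ext (i | i) (j | j) <;> rfl

theorem zero_sum (p : MatrixProjection A) : (zero : MatrixProjection A).sum p ≈ p := by
  refine MvNEquiv.trans (zero.sum p).isProj p.isProj (equiv_sum zero p).symm ?_
  have : IsEmpty (Fin (zero : MatrixProjection A).size) := inferInstanceAs (IsEmpty (Fin 0))
  convert MvNEquiv.of_reindex ((zero : MatrixProjection A).isProj.blockSum p.isProj)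
    (Equiv.emptySum (Fin (zero : MatrixProjection A).size) (Fin p.size)) using 1
  ext i j
  rfl

theorem sum_assoc (p q r : MatrixProjection A) : (p.sum q).sum r ≈ p.sum (q.sum r) := by
  have hpq := p.isProj.blockSum q.isProj
  have hqr := q.isProj.blockSum r.isProj
  have h1 : MvNEquiv ((p.sum q).sum r).mat
      (Matrix.fromBlocks (Matrix.fromBlocks p.mat 0 0 q.mat) 0 0 r.mat) :=
    MvNEquiv.trans ((p.sum q).sum r).isProj (hpq.blockSum r.isProj)
      (equiv_sum (p.sum q) r).symm
      (MvNEquiv.blockSum (equiv_sum p q).symm (MvNEquiv.refl r.isProj))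
  have h2 : MvNEquiv (Matrix.fromBlocks p.mat 0 0 (Matrix.fromBlocks q.mat 0 0 r.mat))
      (p.sum (q.sum r)).mat :=
    MvNEquiv.trans (p.isProj.blockSum hqr) (p.sum (q.sum r)).isProj
      (MvNEquiv.blockSum (MvNEquiv.refl p.isProj) (equiv_sum q r)) (equiv_sum p (q.sum r))
  refine MvNEquiv.trans ((p.sum q).sum r).isProj (p.sum (q.sum r)).isProj h1
    (MvNEquiv.trans (hpq.blockSum r.isProj) (p.sum (q.sum r)).isProj ?_ h2)
  convert MvNEquiv.of_reindex (hpq.blockSum r.isProj) (Equiv.sumAssoc _ _ _) using 1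
  ext (i | i | i) (j | j | j) <;> rfl

end MatrixProjection

/-- The set `V(A)` of Murray-von Neumann classes of matrix projections. -/
def ProjectionClasses (A : Type u) [Ring A] [StarRing A] : Type u :=
  Quotient (MatrixProjection.setoid A)

instance (A : Type u) [Ring A] [StarRing A] : Zero (ProjectionClasses A) where
  zero := Quotient.mk _ MatrixProjection.zero

instance (A : Type u) [Ring A] [StarRing A] : Add (ProjectionClasses A) where
  add := Quotient.map₂ MatrixProjection.sum fun _ _ h _ _ h' => MatrixProjection.sum_congr h h'

instance (A : Type u) [Ring A] [StarRing A] : AddCommMonoid (ProjectionClasses A) where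
  add_assoc := by
    rintro ⟨p⟩ ⟨q⟩ ⟨r⟩
    exact Quotient.sound (MatrixProjection.sum_assoc p q r)
  add_comm := by
    rintro ⟨p⟩ ⟨q⟩
    exact Quotient.sound (MatrixProjection.sum_comm p q)
  zero_add := by
    rintro ⟨p⟩
    exact Quotient.sound (MatrixProjection.zero_sum p)
  add_zero := by
    rintro ⟨p⟩
    exact Quotient.sound (Setoid.trans (MatrixProjection.sum_comm p _)
      (MatrixProjection.zero_sum p))
  nsmul := nsmulRec

/-- The group `K₀(A)` of a unital C*-algebra `A`: the Grothendieck group of `V(A)`. -/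
abbrev OperatorKZero (A : Type u) [Ring A] [StarRing A] : Type u :=
  Algebra.GrothendieckAddGroup (ProjectionClasses A)

/-- The class `[p] ∈ K₀(A)` of a projection `p ∈ M_n(A)`. -/
def OperatorKZero.mk {A : Type u} [Ring A] [StarRing A] (p : MatrixProjection A) :
    OperatorKZero A :=
  Algebra.GrothendieckAddGroup.of (Quotient.mk (MatrixProjection.setoid A) p)

section Trace

variable {A : Type u} [Ring A] [StarRing A] {B : Type v} [AddCommGroup B]

/-- The extension `∑ i, τ (p i i)` of a trace `τ` to matrices is invariant under Murray-von
Neumann equivalence. -/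
theorem MvNEquiv.sum_trace_eq {m n : Type} [Fintype m] [Fintype n] (τ : A →+ B)
    (hτ : ∀ a b, τ (a * b) = τ (b * a)) {p : Matrix m m A} {q : Matrix n n A}
    (h : MvNEquiv p q) : ∑ i, τ (p i i) = ∑ i, τ (q i i) := by
  obtain ⟨v, rfl, rfl⟩ := h
  simp only [Matrix.mul_apply, map_sum]
  rw [Finset.sum_comm]
  exact Finset.sum_congr rfl fun i _ => Finset.sum_congr rfl fun j _ => hτ _ _

/-- The additive map on `V(A)` induced by a trace `τ`, `[p] ↦ ∑ i, τ (p i i)`. -/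
def ProjectionClasses.traceHom (τ : A →+ B) (hτ : ∀ a b, τ (a * b) = τ (b * a)) :
    ProjectionClasses A →+ B where
  toFun := Quotient.lift (fun p : MatrixProjection A => ∑ i, τ (p.mat i i))
    fun _ _ h => MvNEquiv.sum_trace_eq τ hτ h
  map_zero' := Finset.sum_empty
  map_add' := by
    rintro ⟨p⟩ ⟨q⟩
    refine (MvNEquiv.sum_trace_eq τ hτ (MatrixProjection.equiv_sum p q)).symm.trans ?_
    simp only [Fintype.sum_sum_type, Matrix.fromBlocks_apply₁₁, Matrix.fromBlocks_apply₂₂]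

/-- The homomorphism `K₀(A) → B` induced by a trace `τ : A → B`. -/
def OperatorKZero.traceHom (τ : A →+ B) (hτ : ∀ a b, τ (a * b) = τ (b * a)) :
    OperatorKZero A →+ B :=
  Algebra.GrothendieckAddGroup.lift (ProjectionClasses.traceHom τ hτ)

theorem OperatorKZero.traceHom_mk (τ : A →+ B) (hτ : ∀ a b, τ (a * b) = τ (b * a))
    (p : MatrixProjection A) :
    OperatorKZero.traceHom τ hτ (OperatorKZero.mk p) = ∑ i, τ (p.mat i i) :=
  DFunLike.congr_fun
    (Algebra.GrothendieckAddGroup.lift.symm_apply_apply (ProjectionClasses.traceHom τ hτ))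
    (Quotient.mk (MatrixProjection.setoid A) p)

end Trace

/-! ### The reduced group C*-algebra and its canonical trace -/

/-- The Hilbert space `ℓ²(X)`. -/
abbrev EllTwo (X : Type u) : Type u := lp (fun _ : X => ℂ) 2

/-- The basis vector `δ_x` of `ℓ²(X)`. -/
def EllTwo.delta {X : Type u} (x : X) : EllTwo X :=
  letI := Classical.decEq X
  lp.single 2 x (1 : ℂ)

theorem EllTwo.delta_apply {X : Type u} [DecidableEq X] (x y : X) :
    (EllTwo.delta x : EllTwo X) y = if y = x then 1 else 0 := by
  simp only [EllTwo.delta, lp.single_apply, Pi.single_apply]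
  congr

theorem EllTwo.inner_delta_left {X : Type u} (x : X) (f : EllTwo X) :
    inner ℂ (EllTwo.delta x) f = f x := by
  classical
  simp [EllTwo.delta, lp.inner_single_left]

/-- The unitary of `ℓ²(X)` induced by a permutation `e` of `X`; it maps `δ_x` to `δ_{e x}`. -/
def EllTwo.permute {X : Type u} (e : Equiv.Perm X) : EllTwo X ≃ₗᵢ[ℂ] EllTwo X where
  toFun f := ⟨fun x => f (e.symm x), by
    have h := (memℓp_gen_iff (by norm_num : 0 < (2 : ENNReal).toReal)).1 (lp.memℓp f)
    exact (memℓp_gen_iff (by norm_num)).2 (e.symm.summable_iff.2 h)⟩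
  invFun f := ⟨fun x => f (e x), by
    have h := (memℓp_gen_iff (by norm_num : 0 < (2 : ENNReal).toReal)).1 (lp.memℓp f)
    exact (memℓp_gen_iff (by norm_num)).2 (e.summable_iff.2 h)⟩
  map_add' f g := rfl
  map_smul' c f := rfl
  left_inv f := by ext x; simp
  right_inv f := by ext x; simp
  norm_map' f := by
    rw [lp.norm_eq_tsum_rpow (by norm_num), lp.norm_eq_tsum_rpow (by norm_num)]
    congr 1
    exact e.symm.tsum_eq (fun x => ‖f x‖ ^ (2 : ENNReal).toReal)

theorem EllTwo.permute_apply {X : Type u} (e : Equiv.Perm X) (f : EllTwo X) (x : X) :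
    EllTwo.permute e f x = f (e.symm x) := rfl

theorem EllTwo.permute_delta {X : Type u} (e : Equiv.Perm X) (x : X) :
    EllTwo.permute e (EllTwo.delta x) = EllTwo.delta (e x) := by
  classical
  ext y
  rw [EllTwo.permute_apply, EllTwo.delta_apply, EllTwo.delta_apply]
  simp only [Equiv.symm_apply_eq]

variable (G : Type u) [Group G]

/-- The left regular representation: `λ_g` is the bounded operator of `ℓ²(G)` with
`λ_g δ_x = δ_{gx}`. -/
def leftRegular (g : G) : EllTwo G →L[ℂ] EllTwo G :=
  (EllTwo.permute (Equiv.mulLeft g)).toContinuousLinearEquiv.toContinuousLinearMap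

/-- The operator of right translation on `ℓ²(G)`, `δ_x ↦ δ_{xg}`. -/
def rightTranslation (g : G) : EllTwo G →L[ℂ] EllTwo G :=
  (EllTwo.permute (Equiv.mulRight g)).toContinuousLinearEquiv.toContinuousLinearMap

/-- The reduced group C*-algebra `C*_r G`: the norm closure in the bounded operators of `ℓ²(G)` of
the star subalgebra generated by the left regular representation. -/
def ReducedCStar : StarSubalgebra ℂ (EllTwo G →L[ℂ] EllTwo G) :=
  (StarAlgebra.adjoin ℂ (Set.range (leftRegular G))).topologicalClosure

/-- The vector state `a ↦ ⟨δ_1, a δ_1⟩`, restricted to `C*_r G`. It extends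
`∑ λ_g g ↦ λ_1` from the group ring. -/
def canonicalTrace : ReducedCStar G →ₗ[ℂ] ℂ where
  toFun a := inner ℂ (EllTwo.delta 1) ((a : EllTwo G →L[ℂ] EllTwo G) (EllTwo.delta 1))
  map_add' a b := by simp
  map_smul' c a := by simp

variable {G}

theorem leftRegular_delta (g x : G) : leftRegular G g (EllTwo.delta x) = EllTwo.delta (g * x) :=
  EllTwo.permute_delta _ _

theorem rightTranslation_delta (g x : G) :
    rightTranslation G g (EllTwo.delta x) = EllTwo.delta (x * g) :=
  EllTwo.permute_delta _ _

theorem leftRegular_mem (g : G) : leftRegular G g ∈ ReducedCStar G :=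
  StarSubalgebra.le_topologicalClosure _ (StarAlgebra.subset_adjoin ℂ _ ⟨g, rfl⟩)

/-- On group elements the canonical trace is the coefficient of the neutral element. -/
theorem canonicalTrace_leftRegular [DecidableEq G] (g : G) :
    canonicalTrace G ⟨leftRegular G g, leftRegular_mem g⟩ = if g = 1 then 1 else 0 := by
  change inner ℂ (EllTwo.delta 1) (leftRegular G g (EllTwo.delta 1)) = _
  rw [leftRegular_delta, EllTwo.inner_delta_left, EllTwo.delta_apply]
  simp [eq_comm]

theorem inner_permute_left {X : Type u} (e : Equiv.Perm X) (f h : EllTwo X) :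
    inner ℂ (EllTwo.permute e f) h = inner ℂ f (EllTwo.permute e⁻¹ h) := by
  rw [← LinearIsometryEquiv.inner_map_map (EllTwo.permute e) f]
  congr 1
  ext x
  simp only [EllTwo.permute_apply]
  exact congrArg h (e.apply_symm_apply x).symm

theorem star_permute {X : Type u} (e : Equiv.Perm X) :
    star ((EllTwo.permute e).toContinuousLinearEquiv.toContinuousLinearMap) =
      (EllTwo.permute e⁻¹).toContinuousLinearEquiv.toContinuousLinearMap := by
  rw [ContinuousLinearMap.star_eq_adjoint, eq_comm, ContinuousLinearMap.eq_adjoint_iff]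
  intro f h
  simpa using inner_permute_left e⁻¹ f h

theorem star_leftRegular (g : G) : star (leftRegular G g) = leftRegular G g⁻¹ := by
  rw [leftRegular, star_permute, Equiv.Perm.inv_def, Equiv.mulLeft_symm]
  rfl

theorem star_rightTranslation (g : G) :
    star (rightTranslation G g) = rightTranslation G g⁻¹ := by
  rw [rightTranslation, star_permute, Equiv.Perm.inv_def, Equiv.mulRight_symm]
  rfl

theorem leftRegular_comm_right (g h : G) :
    leftRegular G g * rightTranslation G h = rightTranslation G h * leftRegular G g := by
  ext f x
  change f (g⁻¹ * x * h⁻¹) = f (g⁻¹ * (x * h⁻¹))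
  rw [mul_assoc]

/-- Elements of `C*_r G` commute with right translations. -/
theorem ReducedCStar.comm_right {a : EllTwo G →L[ℂ] EllTwo G} (ha : a ∈ ReducedCStar G) (h : G) :
    a * rightTranslation G h = rightTranslation G h * a := by
  have hle : ReducedCStar G ≤
      StarSubalgebra.centralizer ℂ (Set.range (rightTranslation G)) := by
    refine StarSubalgebra.topologicalClosure_minimal ?_ ?_
    · refine StarAlgebra.adjoin_le ?_
      rintro _ ⟨g, rfl⟩
      rw [SetLike.mem_coe, StarSubalgebra.mem_centralizer_iff]
      rintro _ ⟨k, rfl⟩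
      rw [star_rightTranslation]
      exact ⟨(leftRegular_comm_right g k).symm, (leftRegular_comm_right g k⁻¹).symm⟩
    · exact Set.isClosed_centralizer _
  have := (StarSubalgebra.mem_centralizer_iff ℂ).1 (hle ha) _ ⟨h, rfl⟩
  exact this.1.symm

theorem ReducedCStar.trace_leftRegular_mul {b : EllTwo G →L[ℂ] EllTwo G}
    (hb : b ∈ ReducedCStar G) (g : G) :
    inner ℂ (EllTwo.delta 1) (leftRegular G g (b (EllTwo.delta 1))) =
      inner ℂ (EllTwo.delta 1) (b (leftRegular G g (EllTwo.delta 1))) := by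
  have h1 : leftRegular G g (EllTwo.delta 1) = rightTranslation G g (EllTwo.delta 1) := by
    rw [leftRegular_delta, rightTranslation_delta, mul_one, one_mul]
  have h2 : b (rightTranslation G g (EllTwo.delta 1)) =
      rightTranslation G g (b (EllTwo.delta 1)) :=
    DFunLike.congr_fun (ReducedCStar.comm_right hb g) (EllTwo.delta 1)
  rw [h1, h2, EllTwo.inner_delta_left, EllTwo.inner_delta_left]
  change b (EllTwo.delta 1) (g⁻¹ * 1) = b (EllTwo.delta 1) (1 * g⁻¹)
  rw [mul_one, one_mul]

theorem canonicalTrace_mul_comm (a b : ReducedCStar G) :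
    canonicalTrace G (a * b) = canonicalTrace G (b * a) := by
  -- the operators `a` for which the identity holds against all `b`
  let P : (EllTwo G →L[ℂ] EllTwo G) → Prop := fun a => ∀ b ∈ ReducedCStar G,
    inner ℂ (EllTwo.delta 1) (a (b (EllTwo.delta 1))) =
      inner ℂ (EllTwo.delta 1) (b (a (EllTwo.delta 1)))
  have hadj : ∀ a ∈ StarAlgebra.adjoin ℂ (Set.range (leftRegular G)), P a := by
    intro a ha
    induction ha using StarAlgebra.adjoin_induction with
    | mem x hx =>
      obtain ⟨g, rfl⟩ := hx
      exact fun b hb => ReducedCStar.trace_leftRegular_mul hb g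
    | algebraMap r =>
      intro b _
      simp [Algebra.algebraMap_eq_smul_one]
    | add x y _ _ hx hy =>
      intro b hb
      simp [hx b hb, hy b hb]
    | mul x y hx' hy' hx hy =>
      intro b hb
      have hx'' := StarSubalgebra.le_topologicalClosure _ hx'
      have hy'' := StarSubalgebra.le_topologicalClosure _ hy'
      have e1 := hx (y * b) (mul_mem hy'' hb)
      have e2 := hy (b * x) (mul_mem hb hx'')
      exact e1.trans e2
    | star x hx' hx =>
      intro b hb
      have e := congrArg (starRingEnd ℂ) (hx (star b) (star_mem hb))
      rw [inner_conj_symm, inner_conj_symm] at e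
      simp only [ContinuousLinearMap.star_eq_adjoint] at e ⊢
      calc inner ℂ (EllTwo.delta 1) (ContinuousLinearMap.adjoint x (b (EllTwo.delta 1)))
          = inner ℂ (x (EllTwo.delta 1)) (b (EllTwo.delta 1)) :=
            ContinuousLinearMap.adjoint_inner_right _ _ _
        _ = inner ℂ (ContinuousLinearMap.adjoint b (x (EllTwo.delta 1))) (EllTwo.delta 1) :=
            (ContinuousLinearMap.adjoint_inner_left _ _ _).symm
        _ = inner ℂ (x (ContinuousLinearMap.adjoint b (EllTwo.delta 1))) (EllTwo.delta 1) :=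
            e.symm
        _ = inner ℂ (ContinuousLinearMap.adjoint b (EllTwo.delta 1))
              (ContinuousLinearMap.adjoint x (EllTwo.delta 1)) :=
            (ContinuousLinearMap.adjoint_inner_right _ _ _).symm
        _ = inner ℂ (EllTwo.delta 1) (b (ContinuousLinearMap.adjoint x (EllTwo.delta 1))) :=
            ContinuousLinearMap.adjoint_inner_left _ _ _
  have hcl : IsClosed {a | P a} := by
    simp only [P, Set.ofPred_forall]
    refine isClosed_iInter fun b => isClosed_iInter fun _ => isClosed_eq ?_ ?_ <;> fun_prop
  have hsub : (StarAlgebra.adjoin ℂ (Set.range (leftRegular G)) :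
      Set (EllTwo G →L[ℂ] EllTwo G)) ⊆ {a | P a} := hadj
  have ha : P a := closure_minimal hsub hcl a.2
  exact ha b b.2

/-- The canonical trace takes real values on self-adjoint elements. -/
theorem canonicalTrace_star (a : ReducedCStar G) :
    canonicalTrace G (star a) = star (canonicalTrace G a) := by
  change inner ℂ (EllTwo.delta 1) ((star (a : EllTwo G →L[ℂ] EllTwo G)) (EllTwo.delta 1)) =
    starRingEnd ℂ (inner ℂ (EllTwo.delta 1) ((a : EllTwo G →L[ℂ] EllTwo G) (EllTwo.delta 1)))
  rw [inner_conj_symm, ContinuousLinearMap.star_eq_adjoint,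
    ContinuousLinearMap.adjoint_inner_right]

variable (G)

/-- The complex-valued version of `tr_G : K₀(C*_r G) → ℝ`. -/
def traceKZeroComplex : OperatorKZero (ReducedCStar G) →+ ℂ :=
  OperatorKZero.traceHom (canonicalTrace G).toAddMonoidHom canonicalTrace_mul_comm

/-- The homomorphism `tr_G : K₀(C*_r G) → ℝ`, `[p] ↦ ∑ i, tr_G (p i i)`. -/
def traceKZero : OperatorKZero (ReducedCStar G) →+ ℝ :=
  Complex.reAddGroupHom.comp (traceKZeroComplex G)

/-- Nothing is lost by taking real parts: the complex-valued trace on `K₀` is real. -/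
theorem traceKZero_coe (x : OperatorKZero (ReducedCStar G)) :
    ((traceKZero G x : ℝ) : ℂ) = traceKZeroComplex G x := by
  have h : (Complex.ofRealHom.toAddMonoidHom.comp (traceKZero G)) = traceKZeroComplex G := by
    apply Algebra.GrothendieckAddGroup.lift.symm.injective
    refine AddMonoidHom.ext ?_
    rintro ⟨p⟩
    have hmk : traceKZeroComplex G (OperatorKZero.mk p) =
        ∑ i, canonicalTrace G (p.mat i i) := OperatorKZero.traceHom_mk _ _ p
    change ((traceKZeroComplex G (OperatorKZero.mk p)).re : ℂ) =
      traceKZeroComplex G (OperatorKZero.mk p)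
    rw [← Complex.conj_eq_iff_re, hmk, map_sum]
    refine Finset.sum_congr rfl fun i _ => ?_
    have hp : star (p.mat i i) = p.mat i i := congrFun₂ p.isProj.isSelfAdjoint.star_eq i i
    change starRingEnd ℂ (canonicalTrace G (p.mat i i)) = canonicalTrace G (p.mat i i)
    conv_rhs => rw [← hp, canonicalTrace_star]
    rfl
  exact DFunLike.congr_fun h x

variable {G}

/-! ### Groups acting on trees -/

/-- A group `G` acts, by graph automorphisms and without inverting edges, on a tree `T` with vertex
set `V`. -/
structure ActsOnTree (G : Type u) [Group G] {V : Type w} [MulAction G V] (T : SimpleGraph V) :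
    Prop where
  isTree : T.IsTree
  smul_adj : ∀ (g : G) (x y : V), T.Adj x y → T.Adj (g • x) (g • y)
  no_inversion : ∀ (g : G) (x y : V), T.Adj x y → ¬ (g • x = y ∧ g • y = x)

/-- `G` is subdued by `H` through its action on the tree `T`: there is a homomorphism `G → H` which
is injective on the stabilizer of each vertex. -/
def IsSubduedOn (G : Type u) [Group G] (H : Type v) [Group H] {V : Type w} [MulAction G V]
    (T : SimpleGraph V) : Prop :=
  ActsOnTree G T ∧ ∃ α : G →* H, ∀ x : V, Set.InjOn α (MulAction.stabilizer G x : Set G)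

/-- `G` is subdued by `H` through its action on some tree. -/
def IsSubdued (G : Type u) [Group G] (H : Type v) [Group H] : Prop :=
  ∃ (V : Type w) (_ : MulAction G V) (T : SimpleGraph V), IsSubduedOn G H T

/-- The amalgamated product `H *_U H` of two copies of `H` along a subgroup `U`. -/
abbrev DoubleAmalgam {H : Type u} [Group H] (U : Subgroup H) : Type u :=
  Monoid.PushoutI (fun _ : Bool => U.subtype)

end

/-!
For an action of `G` on a tree and a homomorphism `α : G → H` that is injective on the vertex
stabilizers, the tree defines a Fredholm module over `C*_r G` with coefficients in `C*_r H`, and its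
index map `K₀(C*_r G) → K₀(C*_r H)` turns out to preserve traces.

The group `G` acts on `V × H`, for the vertex set `V`, by `g (v, h) = (g v, α(g) h)`. This action is
free by the assumption on `α`, so `ℓ²(V × H)` is a multiple of the regular representation and
carries a representation `ρ` of `C*_r G` (`exists_rep_of_free`). The same holds for the edges, since
no edge is inverted. Once a root `r` is chosen, an edge is the same as a vertex `v ≠ r`, namely the
endpoint of the edge that is farther from `r`. This identification gives a second representation
`ρ'` on `ℓ²(V × H)`, which vanishes on the layer `{r} × H`. A group element moves the root along a
finite path, and hence it respects the identification up to finitely many edges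
(`ActsOnTree.exists_edges`). So `ρ(g) - ρ'(g)` vanishes on all but finitely many layers, while
`ρ(a) - ρ'(a)` has, at the layers `v ≠ r` and `r`, the diagonal coefficients `0` and `tr_G(a)`
(`IsSubduedOn.exists_isFredholmPair`).

Let `p` be a projection over `C*_r G`. Replacing it by a limit of Newton iterates that start in
matrices over the group ring (`exists_newton_limit`), one may assume that `P - P' = ρ(p) - ρ'(p)` is
not only compact over `C*_r H` but also of trace class for the semifinite trace on the commutant of
the right translations by `H` (`EllTwo.isTraceClass_of_tendsto_newtonStep`); its trace is `tr_G(p)`.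
It remains to see that the trace of `P - P'` is a value of `tr_H`. After doubling the Hilbert space
there is a symmetry in the multipliers of the compact operators that conjugates `P'` plus a
complement to a diagonal projection `e`, and it conjugates `P` plus the same complement to a
projection `R` with `R - e` compact and of trace class, of the same trace. Cutting `R - e` off to
finitely many layers, one finds a projection `s` in a matrix algebra over `C*_r H` and a part `b`
of `e` such that `R` is close to `e - b + s`. Close projections have difference of trace zero
(`EllTwo.tsum_diag_sub_eq_zero`), so the trace of `R - e` is `tr_H [s] - tr_H [b]`
(`EllTwo.exists_traceKZeroComplex_eq_of_pair`).

An HNN extension of `H` acts on its Bass-Serre tree, with the cosets of `H` as vertices. Labelling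
`γ H` with the list of the normal form of `γ⁻¹` shows that there are no cycles, because along an
edge the list changes by one entry at the front (`SimpleGraph.isAcyclic_of_label`). If the extension
is along a conjugation, then mapping the stable letter to the conjugating element gives `α`. A
double amalgam `H *_U H` is a subgroup of the HNN extension of `H` along the identity of `U`, with
the factors `H` and `t H t⁻¹` (`DoubleAmalgam.toHNNExtension_injective`), and being subdued passes
to subgroups.
-/

noncomputable section

/-! ### Operators between `ℓ²`-spaces -/

namespace EllTwo

variable {X : Type u} {Y : Type v}

theorem memℓp_of_summable {f : X → ℂ} (hf : Summable fun x => ‖f x‖ ^ 2) :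
    Memℓp f 2 := by
  refine (memℓp_gen_iff (by norm_num)).2 ?_
  simpa using hf

theorem hasSum_norm_sq (f : EllTwo X) : HasSum (fun x => ‖f x‖ ^ 2) (‖f‖ ^ 2) := by
  have h := lp.hasSum_norm (p := 2) (by norm_num) f
  simpa using h

/-- Bounded operators on `ℓ²(X)` that agree on the basis vectors are equal. -/
theorem clm_ext {E : Type*} [NormedAddCommGroup E] [InnerProductSpace ℂ E] [CompleteSpace E]
    {S T : EllTwo X →L[ℂ] E} (h : ∀ x, S (delta x) = T (delta x)) : S = T := by
  ext f
  refine ext_inner_right ℂ fun y => ?_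
  rw [← ContinuousLinearMap.adjoint_inner_right, ← ContinuousLinearMap.adjoint_inner_right]
  congr 1
  ext x
  rw [← inner_delta_left, ← inner_delta_left, ContinuousLinearMap.adjoint_inner_right,
    ContinuousLinearMap.adjoint_inner_right, h]

theorem norm_delta (x : X) : ‖(delta x : EllTwo X)‖ = 1 := by
  classical
  simp [delta]

/-- Restriction of functions along an embedding, as an operator `ℓ²(Y) → ℓ²(X)`. -/
def restrict (f : X ↪ Y) : EllTwo Y →L[ℂ] EllTwo X :=
  LinearMap.mkContinuous
    { toFun := fun ξ => ⟨fun x => ξ (f x),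
        memℓp_of_summable ((hasSum_norm_sq ξ).summable.comp_injective f.injective)⟩
      map_add' := fun _ _ => rfl
      map_smul' := fun _ _ => rfl } 1 <| by
    intro ξ
    rw [one_mul]
    refine le_of_sq_le_sq ?_ (norm_nonneg _)
    rw [← (hasSum_norm_sq ξ).tsum_eq, ← (hasSum_norm_sq _).tsum_eq]
    exact tsum_comp_le_tsum_of_inj (hasSum_norm_sq ξ).summable (fun _ => by positivity)
      f.injective

theorem restrict_apply (f : X ↪ Y) (ξ : EllTwo Y) (x : X) : restrict f ξ x = ξ (f x) := rfl

/-- The isometry `ℓ²(X) → ℓ²(Y)`, `δ_x ↦ δ_{f x}`, induced by an embedding `f`. -/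
def incl (f : X ↪ Y) : EllTwo X →L[ℂ] EllTwo Y := ContinuousLinearMap.adjoint (restrict f)

theorem incl_delta (f : X ↪ Y) (x : X) : incl f (delta x) = delta (f x) := by
  refine ext_inner_right ℂ fun ξ => ?_
  rw [incl, ContinuousLinearMap.adjoint_inner_left, inner_delta_left, inner_delta_left,
    restrict_apply]

theorem adjoint_incl (f : X ↪ Y) : ContinuousLinearMap.adjoint (incl f) = restrict f :=
  ContinuousLinearMap.adjoint_adjoint _

theorem restrict_delta (f : X ↪ Y) (x : X) : restrict f (delta (f x)) = delta x := by
  classical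
  ext y
  simp [restrict_apply, delta_apply]

theorem restrict_delta_of_notMem (f : X ↪ Y) {y : Y} (hy : ∀ x, f x ≠ y) :
    restrict f (delta y) = 0 := by
  classical
  ext x
  simp [restrict_apply, delta_apply, hy x]

theorem restrict_comp_incl (f : X ↪ Y) : restrict f ∘L incl f = .id ℂ _ :=
  clm_ext fun x => by simp [incl_delta, restrict_delta]

/-- The slice of a function on `O × X` at `o : O`. -/
def slice {O : Type w} (o : O) : EllTwo (O × X) →L[ℂ] EllTwo X :=
  restrict (Function.Embedding.sectR o X)

theorem hasSum_norm_sq_slice {O : Type w} (ξ : EllTwo (O × X)) :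
    HasSum (fun o => ‖slice o ξ‖ ^ 2) (‖ξ‖ ^ 2) :=
  (hasSum_norm_sq ξ).prod_fiberwise fun o => hasSum_norm_sq (slice o ξ)

theorem norm_sq_apply_slice_le {O : Type w} (T : EllTwo X →L[ℂ] EllTwo X) (ξ : EllTwo (O × X))
    (o : O) : ‖T (slice o ξ)‖ ^ 2 ≤ ‖T‖ ^ 2 * ‖slice o ξ‖ ^ 2 := by
  rw [← mul_pow]
  exact pow_le_pow_left₀ (norm_nonneg _) (T.le_opNorm _) 2

theorem summable_norm_sq_apply_slice {O : Type w} (T : EllTwo X →L[ℂ] EllTwo X)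
    (ξ : EllTwo (O × X)) : Summable fun o => ‖T (slice o ξ)‖ ^ 2 :=
  Summable.of_nonneg_of_le (fun _ => by positivity) (norm_sq_apply_slice_le T ξ)
    ((hasSum_norm_sq_slice ξ).summable.mul_left _)

/-- The linear map underlying `EllTwo.amplify`. -/
def amplifyLinear (O : Type w) (T : EllTwo X →L[ℂ] EllTwo X) :
    EllTwo (O × X) →ₗ[ℂ] EllTwo (O × X) where
  toFun ξ := ⟨fun p => T (slice p.1 ξ) p.2, memℓp_of_summable <| by
    refine (summable_prod_of_nonneg fun _ => by positivity).2
      ⟨fun o => (hasSum_norm_sq (T (slice o ξ))).summable, ?_⟩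
    simpa only [(hasSum_norm_sq _).tsum_eq] using summable_norm_sq_apply_slice T ξ⟩
  map_add' ξ η := by
    ext p
    change T (slice p.1 (ξ + η)) p.2 = T (slice p.1 ξ) p.2 + T (slice p.1 η) p.2
    rw [map_add, map_add]; rfl
  map_smul' c ξ := by
    ext p
    change T (slice p.1 (c • ξ)) p.2 = c • T (slice p.1 ξ) p.2
    rw [map_smul, map_smul]; rfl

theorem norm_amplifyLinear_le (O : Type w) (T : EllTwo X →L[ℂ] EllTwo X) (ξ : EllTwo (O × X)) :
    ‖amplifyLinear O T ξ‖ ≤ ‖T‖ * ‖ξ‖ := by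
  refine le_of_sq_le_sq ?_ (by positivity)
  have h : HasSum (fun o => ‖T (slice o ξ)‖ ^ 2) (‖amplifyLinear O T ξ‖ ^ 2) :=
    hasSum_norm_sq_slice (amplifyLinear O T ξ)
  rw [mul_pow]
  exact hasSum_le (norm_sq_apply_slice_le T ξ) h ((hasSum_norm_sq_slice ξ).mul_left _)

/-- The operator `1 ⊗ T` on `ℓ²(O × X)`. -/
def amplify (O : Type w) (T : EllTwo X →L[ℂ] EllTwo X) :
    EllTwo (O × X) →L[ℂ] EllTwo (O × X) :=
  (amplifyLinear O T).mkContinuous ‖T‖ (norm_amplifyLinear_le O T)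

theorem amplify_apply (O : Type w) (T : EllTwo X →L[ℂ] EllTwo X) (ξ : EllTwo (O × X))
    (p : O × X) : amplify O T ξ p = T (slice p.1 ξ) p.2 := rfl

theorem slice_amplify (O : Type w) (T : EllTwo X →L[ℂ] EllTwo X) (ξ : EllTwo (O × X)) (o : O) :
    slice o (amplify O T ξ) = T (slice o ξ) := rfl

theorem inner_eq_tsum_slice {O : Type w} (ξ η : EllTwo (O × X)) :
    inner ℂ ξ η = ∑' o, inner ℂ (slice o ξ) (slice o η) :=
  ((lp.hasSum_inner (𝕜 := ℂ) ξ η).prod_fiberwise fun o =>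
    lp.hasSum_inner (𝕜 := ℂ) (slice o ξ) (slice o η)).tsum_eq.symm

/-- Amplification as a homomorphism of star algebras. -/
def amplifyHom (O : Type w) :
    (EllTwo X →L[ℂ] EllTwo X) →⋆ₙₐ[ℂ] (EllTwo (O × X) →L[ℂ] EllTwo (O × X)) where
  toFun := amplify O
  map_smul' c T := by ext ξ p; simp [amplify_apply]
  map_zero' := by ext ξ p; simp [amplify_apply]
  map_add' S T := by ext ξ p; simp [amplify_apply]
  map_mul' S T := by
    ext ξ p
    simp [amplify_apply, slice_amplify]
  map_star' T := by
    rw [ContinuousLinearMap.star_eq_adjoint, ContinuousLinearMap.star_eq_adjoint,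
      ContinuousLinearMap.eq_adjoint_iff]
    intro ξ η
    rw [inner_eq_tsum_slice, inner_eq_tsum_slice]
    simp only [slice_amplify, ContinuousLinearMap.adjoint_inner_left]

/-- Conjugation `T ↦ V T V*` by the isometry `V` induced by an embedding. -/
def inclHom (f : X ↪ Y) :
    (EllTwo X →L[ℂ] EllTwo X) →⋆ₙₐ[ℂ] (EllTwo Y →L[ℂ] EllTwo Y) where
  toFun T := incl f ∘L T ∘L restrict f
  map_smul' c T := by ext; simp
  map_zero' := by ext; simp
  map_add' S T := by ext; simp
  map_mul' S T := by
    ext ξ : 1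
    have h (η) : restrict f (incl f η) = η := DFunLike.congr_fun (restrict_comp_incl f) η
    simp [h]
  map_star' T := by
    simp only [ContinuousLinearMap.star_eq_adjoint, ContinuousLinearMap.adjoint_comp,
      incl, ContinuousLinearMap.adjoint_adjoint, ContinuousLinearMap.comp_assoc]

theorem inclHom_apply (f : X ↪ Y) (T : EllTwo X →L[ℂ] EllTwo X) :
    inclHom f T = incl f ∘L T ∘L restrict f := rfl

theorem inclHom_delta (f : X ↪ Y) (T : EllTwo X →L[ℂ] EllTwo X) (x : X) :
    inclHom f T (delta (f x)) = incl f (T (delta x)) := by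
  simp [inclHom_apply, restrict_delta]

theorem inclHom_delta_of_notMem (f : X ↪ Y) (T : EllTwo X →L[ℂ] EllTwo X) {y : Y}
    (hy : ∀ x, f x ≠ y) : inclHom f T (delta y) = 0 := by
  simp [inclHom_apply, restrict_delta_of_notMem f hy]

end EllTwo

/-! ### Representations of `C*_r G` defined by free actions -/

/-- The span of the left translations is dense in the reduced C*-algebra. -/
theorem ReducedCStar.mem_closure_span {G : Type u} [Group G] {a : EllTwo G →L[ℂ] EllTwo G}
    (ha : a ∈ ReducedCStar G) :
    a ∈ closure (Submodule.span ℂ (Set.range (leftRegular G)) :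
      Set (EllTwo G →L[ℂ] EllTwo G)) := by
  have hmul (g k : G) : leftRegular G g * leftRegular G k = leftRegular G (g * k) :=
    EllTwo.clm_ext fun x => by simp [leftRegular_delta, mul_assoc]
  have hone : leftRegular G 1 = 1 := EllTwo.clm_ext fun x => by simp [leftRegular_delta]
  refine closure_mono ?_ ha
  intro x hx
  rw [SetLike.mem_coe] at *
  induction hx using StarAlgebra.adjoin_induction with
  | mem x hx => exact Submodule.subset_span hx
  | algebraMap r =>
    rw [Algebra.algebraMap_eq_smul_one, ← hone]
    exact Submodule.smul_mem _ _ (Submodule.subset_span ⟨1, rfl⟩)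
  | add x y _ _ hx hy => exact add_mem hx hy
  | mul x y _ _ hx hy =>
    have := Submodule.mul_mem_mul hx hy
    rw [Submodule.span_mul_span] at this
    refine Submodule.span_mono ?_ this
    rintro _ ⟨_, ⟨g, rfl⟩, _, ⟨k, rfl⟩, rfl⟩
    exact ⟨g * k, (hmul g k).symm⟩
  | star x hx' hx =>
    clear hx'
    induction hx using Submodule.span_induction with
    | mem x hx =>
      obtain ⟨g, rfl⟩ := hx
      exact Submodule.subset_span ⟨g⁻¹, (star_leftRegular g).symm⟩
    | zero => simp
    | add x y _ _ hx hy => rw [star_add]; exact add_mem hx hy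
    | smul c x _ hx => rw [star_smul]; exact Submodule.smul_mem _ _ hx

theorem ReducedCStar.span_le {G : Type u} [Group G] :
    Submodule.span ℂ (Set.range (leftRegular G)) ≤ (ReducedCStar G).toSubalgebra.toSubmodule := by
  rw [Submodule.span_le]
  rintro _ ⟨g, rfl⟩
  exact leftRegular_mem g

/-- A closed linear subspace of operators that contains the left translations contains the whole
reduced C*-algebra; `L` is a continuous linear map, to allow for pullbacks. -/
theorem ReducedCStar.induction {G : Type u} [Group G] {F : Type*} [NormedAddCommGroup F]
    [NormedSpace ℂ F] (L : (EllTwo G →L[ℂ] EllTwo G) →L[ℂ] F) {S : Submodule ℂ F}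
    (hS : IsClosed (S : Set F)) (h : ∀ g, L (leftRegular G g) ∈ S)
    {a : EllTwo G →L[ℂ] EllTwo G} (ha : a ∈ ReducedCStar G) : L a ∈ S := by
  have hspan : Submodule.span ℂ (Set.range (leftRegular G)) ≤ S.comap L.toLinearMap := by
    rw [Submodule.span_le]
    rintro _ ⟨g, rfl⟩
    exact h g
  exact closure_minimal hspan (hS.preimage L.continuous) (ReducedCStar.mem_closure_span ha)

/-- A free action of `G` on `Z` splits `Z` into copies of `G`. -/
theorem exists_equiv_prod_of_free {G : Type u} [Group G] {Z : Type v} (act : G →* Equiv.Perm Z)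
    (hfree : ∀ g z, act g z = z → g = 1) :
    ∃ (O : Type v) (e : O × G ≃ Z), ∀ o g x, e (o, g * x) = act g (e (o, x)) := by
  let s : Setoid Z :=
    { r := fun z z' => ∃ g, act g z = z'
      iseqv :=
        { refl := fun z => ⟨1, by simp⟩
          symm := by rintro z _ ⟨g, rfl⟩; exact ⟨g⁻¹, by simp⟩
          trans := by rintro z _ _ ⟨g, rfl⟩ ⟨k, rfl⟩; exact ⟨k * g, by simp⟩ } }
  have hinj : Function.Injective fun p : Quotient s × G => act p.2 p.1.out := by
    rintro ⟨o, g⟩ ⟨o', g'⟩ h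
    simp only at h
    have ho : o = o' := by
      rw [← o.out_eq, ← o'.out_eq]
      refine Quotient.sound ⟨g'⁻¹ * g, ?_⟩
      rw [map_mul, Equiv.Perm.mul_apply, h, ← Equiv.Perm.mul_apply, ← map_mul]
      simp
    subst ho
    have := hfree (g'⁻¹ * g) o.out (by
      rw [map_mul, Equiv.Perm.mul_apply, h, ← Equiv.Perm.mul_apply, ← map_mul]
      simp)
    rw [inv_mul_eq_one] at this
    rw [this]
  have hsurj : Function.Surjective fun p : Quotient s × G => act p.2 p.1.out := by
    intro z
    obtain ⟨g, hg⟩ : ∃ g, act g (Quotient.mk s z).out = z := Quotient.mk_out z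
    exact ⟨(_, g), hg⟩
  exact ⟨Quotient s, Equiv.ofBijective _ ⟨hinj, hsurj⟩, fun o g x => by
    change act (g * x) o.out = act g (act x o.out)
    rw [map_mul, Equiv.Perm.mul_apply]⟩

/-- A free action of `G` on `Z` extends from the group ring to a star homomorphism of the bounded
operators: `ℓ²(Z)` is a multiple of the left regular representation. -/
theorem exists_rep_of_free {G : Type u} [Group G] {Z : Type v} (act : G →* Equiv.Perm Z)
    (hfree : ∀ g z, act g z = z → g = 1) :
    ∃ ρ : (EllTwo G →L[ℂ] EllTwo G) →⋆ₙₐ[ℂ] (EllTwo Z →L[ℂ] EllTwo Z),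
      ∀ g z, ρ (leftRegular G g) (EllTwo.delta z) = EllTwo.delta (act g z) := by
  obtain ⟨O, e, he⟩ := exists_equiv_prod_of_free act hfree
  refine ⟨(EllTwo.inclHom e.toEmbedding).comp (EllTwo.amplifyHom O), fun g z => ?_⟩
  obtain ⟨⟨o, x⟩, rfl⟩ := e.surjective z
  have h : EllTwo.amplify O (leftRegular G g) (EllTwo.delta (o, x)) =
      EllTwo.delta (o, g * x) := by
    classical
    ext ⟨o', y⟩
    rw [EllTwo.amplify_apply]
    by_cases ho : o' = o
    · subst ho
      have := EllTwo.restrict_delta (Function.Embedding.sectR o' G) x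
      simp only [Function.Embedding.sectR_apply] at this
      simp [EllTwo.slice, this, leftRegular_delta, EllTwo.delta_apply]
    · rw [EllTwo.slice, EllTwo.restrict_delta_of_notMem]
      · simp [EllTwo.delta_apply, ho]
      · intro y; simp [ho]
  have h2 := EllTwo.inclHom_delta e.toEmbedding (EllTwo.amplify O (leftRegular G g)) (o, x)
  rw [h, EllTwo.incl_delta] at h2
  simp only [Equiv.coe_toEmbedding, he] at h2
  exact h2

/-! ### Equivariant operators on `ℓ²(X × H)` -/

namespace EllTwo

variable {X : Type u} {H : Type v}

/-- The isometry of `ℓ²(H)` onto the copy `ℓ²({x} × H)` inside `ℓ²(X × H)`; its adjoint is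
`EllTwo.slice x`. -/
def layer (x : X) : EllTwo H →L[ℂ] EllTwo (X × H) := incl (Function.Embedding.sectR x H)

theorem layer_delta (x : X) (h : H) : layer x (delta h) = (delta (x, h) : EllTwo (X × H)) :=
  incl_delta _ _

theorem slice_delta_self (x : X) (h : H) : slice x (delta (x, h) : EllTwo (X × H)) = delta h :=
  restrict_delta (Function.Embedding.sectR x H) h

theorem slice_delta_of_ne {x y : X} (hxy : x ≠ y) (h : H) :
    slice x (delta (y, h) : EllTwo (X × H)) = 0 :=
  restrict_delta_of_notMem _ fun _ hk => hxy (congrArg Prod.fst hk)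

theorem slice_comp_layer_self (x : X) :
    (slice x : EllTwo (X × H) →L[ℂ] EllTwo H) ∘L layer x = .id ℂ _ :=
  restrict_comp_incl _

theorem slice_comp_layer_of_ne {x y : X} (hxy : x ≠ y) :
    (slice x : EllTwo (X × H) →L[ℂ] EllTwo H) ∘L layer y = 0 :=
  clm_ext fun h => by simp [layer_delta, slice_delta_of_ne hxy]

theorem adjoint_layer (x : X) :
    ContinuousLinearMap.adjoint (layer x : EllTwo H →L[ℂ] EllTwo (X × H)) = slice x :=
  adjoint_incl _

theorem adjoint_slice (x : X) :
    ContinuousLinearMap.adjoint (slice x : EllTwo (X × H) →L[ℂ] EllTwo H) = layer x := rfl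

/-- The matrix unit with entry `b` at position `(x, y)`. -/
def matUnit (x y : X) (b : EllTwo H →L[ℂ] EllTwo H) : EllTwo (X × H) →L[ℂ] EllTwo (X × H) :=
  layer x ∘L b ∘L slice y

theorem star_matUnit (x y : X) (b : EllTwo H →L[ℂ] EllTwo H) :
    star (matUnit x y b) = matUnit y x (star b) := by
  simp only [ContinuousLinearMap.star_eq_adjoint, matUnit, ContinuousLinearMap.adjoint_comp,
    adjoint_layer, adjoint_slice, ContinuousLinearMap.comp_assoc]

theorem matUnit_mul_self (x y z : X) (b c : EllTwo H →L[ℂ] EllTwo H) :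
    matUnit x y b * matUnit y z c = matUnit x z (b * c) := by
  ext1 ξ
  have h (η) : (slice y : EllTwo (X × H) →L[ℂ] EllTwo H) (layer y η) = η :=
    DFunLike.congr_fun (slice_comp_layer_self y) η
  simp [matUnit, h]

theorem matUnit_mul_of_ne (x z : X) {y y' : X} (hy : y ≠ y') (b c : EllTwo H →L[ℂ] EllTwo H) :
    matUnit x y b * matUnit y' z c = 0 := by
  ext1 ξ
  have h (η) : (slice y : EllTwo (X × H) →L[ℂ] EllTwo H) (layer y' η) = 0 :=
    DFunLike.congr_fun (slice_comp_layer_of_ne hy) η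
  simp [matUnit, h]

/-- The projection of `ℓ²(X × H)` onto `ℓ²({x} × H)`. -/
def layerProj (x : X) : EllTwo (X × H) →L[ℂ] EllTwo (X × H) := matUnit x x 1

theorem layerProj_apply (x : X) (ξ : EllTwo (X × H)) : layerProj x ξ = layer x (slice x ξ) := rfl

theorem layerProj_delta_self (x : X) (h : H) :
    layerProj x (delta (x, h)) = (delta (x, h) : EllTwo (X × H)) := by
  rw [layerProj_apply, slice_delta_self, layer_delta]

theorem layerProj_delta_of_ne {x y : X} (hxy : x ≠ y) (h : H) :
    layerProj x (delta (y, h) : EllTwo (X × H)) = 0 := by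
  rw [layerProj_apply, slice_delta_of_ne hxy, map_zero]

theorem star_layerProj (x : X) :
    star (layerProj x : EllTwo (X × H) →L[ℂ] EllTwo (X × H)) = layerProj x := by
  rw [layerProj, star_matUnit, star_one]

variable [Group H]

/-- Right translation by `h` in the second variable of `ℓ²(X × H)`. -/
def shift (X : Type u) (h : H) : EllTwo (X × H) →L[ℂ] EllTwo (X × H) :=
  (permute ((Equiv.refl X).prodCongr
    (Equiv.mulRight h))).toContinuousLinearEquiv.toContinuousLinearMap

theorem shift_delta (h : H) (x : X) (k : H) :
    shift X h (delta (x, k)) = delta (x, k * h) := permute_delta _ _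

theorem star_shift (h : H) : star (shift X h) = shift X h⁻¹ := by
  rw [shift, star_permute]
  have : ((Equiv.refl X).prodCongr (Equiv.mulRight h))⁻¹ =
      (Equiv.refl X).prodCongr (Equiv.mulRight h⁻¹) := by
    rw [inv_eq_iff_mul_eq_one]
    ext ⟨x, k⟩ <;> simp
  rw [this, shift]

variable (X H) in
/-- The algebra of operators on `ℓ²(X × H)` that commute with right translations by `H`. -/
def equivariant : StarSubalgebra ℂ (EllTwo (X × H) →L[ℂ] EllTwo (X × H)) :=
  StarSubalgebra.centralizer ℂ (Set.range (shift X))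

theorem mem_equivariant {T : EllTwo (X × H) →L[ℂ] EllTwo (X × H)} :
    T ∈ equivariant X H ↔ ∀ h, T * shift X h = shift X h * T := by
  rw [equivariant, StarSubalgebra.mem_centralizer_iff]
  simp only [Set.forall_mem_range, star_shift]
  exact ⟨fun h k => (h k).1.symm, fun h k => ⟨(h k).symm, (h k⁻¹).symm⟩⟩

theorem mem_equivariant_of_delta {T : EllTwo (X × H) →L[ℂ] EllTwo (X × H)}
    (hT : ∀ x k h, T (delta (x, k * h)) = shift X h (T (delta (x, k)))) :
    T ∈ equivariant X H :=
  mem_equivariant.2 fun h => clm_ext fun ⟨x, k⟩ => by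
    simp [shift_delta, hT]

theorem apply_delta_of_equivariant {T : EllTwo (X × H) →L[ℂ] EllTwo (X × H)}
    (hT : T ∈ equivariant X H) (x : X) (h : H) :
    T (delta (x, h)) = shift X h (T (delta (x, 1))) := by
  have := DFunLike.congr_fun (mem_equivariant.1 hT h) (delta (x, 1))
  simpa [shift_delta] using this

theorem isClosed_equivariant :
    IsClosed (equivariant X H : Set (EllTwo (X × H) →L[ℂ] EllTwo (X × H))) :=
  Set.isClosed_centralizer _

/-- Units of the algebra of all operators that are equivariant have equivariant inverse. -/
theorem inv_mem_equivariant {z : (EllTwo (X × H) →L[ℂ] EllTwo (X × H))ˣ}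
    (hz : (z : EllTwo (X × H) →L[ℂ] EllTwo (X × H)) ∈ equivariant X H) :
    ((z⁻¹ : (EllTwo (X × H) →L[ℂ] EllTwo (X × H))ˣ) : EllTwo (X × H) →L[ℂ] EllTwo (X × H)) ∈
      equivariant X H := by
  rw [mem_equivariant] at *
  intro h
  rw [Units.inv_mul_eq_iff_eq_mul, ← mul_assoc, hz, mul_assoc, Units.mul_inv, mul_one]

theorem matUnit_mem_equivariant (x y : X) {b : EllTwo H →L[ℂ] EllTwo H}
    (hb : b ∈ ReducedCStar H) : matUnit x y b ∈ equivariant X H := by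
  have hl (k : H) (ξ : EllTwo H) :
      layer x (rightTranslation H k ξ) = shift X k (layer x ξ) := by
    have : layer x ∘L rightTranslation H k = shift X k ∘L layer x :=
      clm_ext fun h => by simp [rightTranslation_delta, layer_delta, shift_delta]
    exact DFunLike.congr_fun this ξ
  refine mem_equivariant_of_delta fun z k h => ?_
  by_cases hz : y = z
  · subst hz
    have := DFunLike.congr_fun (ReducedCStar.comm_right hb h) (delta k)
    have h2 : b (delta (k * h)) = rightTranslation H h (b (delta k)) := by
      rw [← rightTranslation_delta]; exact this
    simp [matUnit, slice_delta_self, ← hl, h2]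
  · simp [matUnit, slice_delta_of_ne hz]

theorem layerProj_mem_equivariant (x : X) : layerProj x ∈ equivariant X H :=
  matUnit_mem_equivariant x x (one_mem _)

/-! ### The semifinite trace on equivariant operators -/

/-- The diagonal coefficient `⟨δ_{(x, 1)}, T δ_{(x, 1)}⟩`. The sum of these over `x` is the
semifinite trace of an equivariant operator. -/
def diag (x : X) : (EllTwo (X × H) →L[ℂ] EllTwo (X × H)) →ₗ[ℂ] ℂ where
  toFun T := inner ℂ (delta (x, 1)) (T (delta (x, 1)))
  map_add' S T := by simp
  map_smul' c T := by simp

theorem diag_apply (x : X) (T : EllTwo (X × H) →L[ℂ] EllTwo (X × H)) :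
    diag x T = inner ℂ (delta (x, 1)) (T (delta (x, 1))) := rfl

theorem continuous_diag (x : X) :
    Continuous (diag x : (EllTwo (X × H) →L[ℂ] EllTwo (X × H)) → ℂ) := by
  simp only [diag, LinearMap.coe_mk, AddHom.coe_mk]
  fun_prop

/-- The trace property: `B Π_y C` and `Π_y C B Π_y` have the same trace, where `Π_y` is the
projection onto `ℓ²({y} × H)`. By equivariance the matrix coefficients of the two sides
are the coefficients of one inner product in `ℓ²(X × H)`. -/
theorem hasSum_diag_mul_layerProj_mul {B C : EllTwo (X × H) →L[ℂ] EllTwo (X × H)}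
    (hB : B ∈ equivariant X H) (hC : C ∈ equivariant X H) (y : X) :
    HasSum (fun x => diag x (B * layerProj y * C)) (diag y (C * B)) := by
  have hC' : ContinuousLinearMap.adjoint C ∈ equivariant X H := by
    rw [← ContinuousLinearMap.star_eq_adjoint]; exact star_mem hC
  -- coefficients of `S δ_{(y,h)}` in terms of `S δ_{(y,1)}`
  have key {S : EllTwo (X × H) →L[ℂ] EllTwo (X × H)} (hS : S ∈ equivariant X H) (x : X) (h : H) :
      S (delta (y, h)) (x, 1) = S (delta (y, 1)) (x, h⁻¹) := by
    rw [apply_delta_of_equivariant hS y h]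
    change S (delta (y, 1)) (x, 1 * h⁻¹) = _
    rw [one_mul]
  have key2 {S S' : EllTwo (X × H) →L[ℂ] EllTwo (X × H)}
      (hSS : ContinuousLinearMap.adjoint S = S') (hS' : S' ∈ equivariant X H) (x : X) (h : H) :
      S (delta (x, 1)) (y, h) = starRingEnd ℂ (S' (delta (y, 1)) (x, h⁻¹)) := by
    rw [← key hS', ← inner_delta_left, ← ContinuousLinearMap.adjoint_inner_left, hSS,
      ← inner_delta_left, inner_conj_symm]
  have h1 (x : X) : HasSum (fun h : H => inner ℂ ((ContinuousLinearMap.adjoint C) (delta (y, 1))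
      (x, h)) (B (delta (y, 1)) (x, h))) (diag x (B * layerProj y * C)) := by
    have h2 : diag x (B * layerProj y * C) =
        inner ℂ (slice y (ContinuousLinearMap.adjoint B (delta (x, 1))))
          (slice y (C (delta (x, 1)))) := by
      rw [diag_apply, ← ContinuousLinearMap.adjoint_inner_right (slice y), adjoint_slice,
        ContinuousLinearMap.adjoint_inner_left]
      rfl
    have h3 := lp.hasSum_inner (𝕜 := ℂ)
      (slice y (ContinuousLinearMap.adjoint B (delta (x, 1)))) (slice y (C (delta (x, 1))))
    rw [← h2] at h3
    rw [← (Equiv.inv H).hasSum_iff]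
    refine h3.congr_fun fun h => ?_
    have k1 := key2 (ContinuousLinearMap.adjoint_adjoint B) hB x h
    have k2 := key2 rfl hC' x h
    change inner ℂ (ContinuousLinearMap.adjoint C (delta (y, 1)) (x, h⁻¹))
      (B (delta (y, 1)) (x, h⁻¹)) = inner ℂ
        (ContinuousLinearMap.adjoint B (delta (x, 1)) (y, h)) (C (delta (x, 1)) (y, h))
    rw [k1, k2]
    simp [mul_comm]
  have h4 := lp.hasSum_inner (𝕜 := ℂ) (ContinuousLinearMap.adjoint C (delta (y, 1)))
    (B (delta (y, 1)))
  rw [ContinuousLinearMap.adjoint_inner_left] at h4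
  exact h4.prod_fiberwise h1

theorem sum_norm_sq_slice_le {C : EllTwo (X × H) →L[ℂ] EllTwo (X × H)}
    (hC : C ∈ equivariant X H) (y : X) (F : Finset X) :
    ∑ x ∈ F, ‖slice y (C (delta (x, 1)))‖ ^ 2 ≤ ‖C‖ ^ 2 := by
  have h := hasSum_diag_mul_layerProj_mul (star_mem hC) hC y
  have h1 (x : X) : diag x (star C * layerProj y * C) =
      ((‖slice y (C (delta (x, 1)))‖ ^ 2 : ℝ) : ℂ) := by
    rw [diag_apply, ContinuousLinearMap.star_eq_adjoint]
    change inner ℂ _ (ContinuousLinearMap.adjoint C (layer y (slice y (C (delta (x, 1)))))) = _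
    rw [ContinuousLinearMap.adjoint_inner_right, ← adjoint_slice,
      ContinuousLinearMap.adjoint_inner_right, inner_self_eq_norm_sq_to_K]
    norm_cast
  have h2 : diag y (C * star C) = ((‖star C (delta (y, 1))‖ ^ 2 : ℝ) : ℂ) := by
    rw [diag_apply]
    change inner ℂ _ (C (star C (delta (y, 1)))) = _
    rw [← ContinuousLinearMap.adjoint_inner_left,
      ContinuousLinearMap.star_eq_adjoint, inner_self_eq_norm_sq_to_K]
    norm_cast
  simp only [h1, h2, Complex.hasSum_ofReal] at h
  refine (sum_le_hasSum F (fun _ _ => by positivity) h).trans ?_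
  refine pow_le_pow_left₀ (norm_nonneg _) ?_ 2
  refine ((star C).le_opNorm _).trans ?_
  rw [norm_delta, mul_one]
  exact (norm_star C).le

/-- `IsTraceBound T c`: the trace norm of `T` is at most `c`. Both factors `B` and `C` are part of
the definition so that the bound is visibly compatible with products from either side. -/
def IsTraceBound (T : EllTwo (X × H) →L[ℂ] EllTwo (X × H)) (c : ℝ) : Prop :=
  ∀ B ∈ equivariant X H, ∀ C ∈ equivariant X H, ∀ F : Finset X,
    ∑ x ∈ F, ‖diag x (B * T * C)‖ ≤ c * (‖B‖ * ‖C‖)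

/-- Equivariant operators of trace class: their trace norm is finite, and the trace property holds.
The trace property is a field because it is carried through sums, products and limits together
with the bound, starting from the operators `B Π_y C`. -/
structure IsTraceClass (T : EllTwo (X × H) →L[ℂ] EllTwo (X × H)) : Prop where
  mem : T ∈ equivariant X H
  bound : ∃ c, IsTraceBound T c
  cyclic : ∀ B ∈ equivariant X H, ∀ C ∈ equivariant X H,
    ∑' x, diag x (B * T * C) = ∑' x, diag x (T * C * B)

namespace IsTraceBound

variable {S T : EllTwo (X × H) →L[ℂ] EllTwo (X × H)} {c d : ℝ}

theorem add (hS : IsTraceBound S c) (hT : IsTraceBound T d) : IsTraceBound (S + T) (c + d) := by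
  intro B hB C hC F
  rw [add_mul]
  refine le_trans ?_ (add_le_add (hS B hB C hC F) (hT B hB C hC F))
  rw [← Finset.sum_add_distrib]
  refine Finset.sum_le_sum fun x _ => ?_
  rw [mul_add, add_mul, map_add]
  exact norm_add_le _ _

theorem smul (hT : IsTraceBound T c) (r : ℂ) : IsTraceBound (r • T) (‖r‖ * c) := by
  intro B hB C hC F
  simp only [mul_smul_comm, smul_mul_assoc, map_smul, norm_smul]
  rw [← Finset.mul_sum, mul_assoc ‖r‖]
  exact mul_le_mul_of_nonneg_left (hT B hB C hC F) (norm_nonneg r)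

theorem neg (hT : IsTraceBound T c) : IsTraceBound (-T) c := by
  have := hT.smul (-1)
  rwa [norm_neg, norm_one, one_mul, neg_one_smul] at this

theorem zero : IsTraceBound (0 : EllTwo (X × H) →L[ℂ] EllTwo (X × H)) 0 := by
  intro B _ C _ F
  simp

theorem mono (hT : IsTraceBound T c) (hcd : c ≤ d) : IsTraceBound T d := fun B hB C hC F =>
  (hT B hB C hC F).trans (mul_le_mul_of_nonneg_right hcd (by positivity))

theorem mul_mul (hT : IsTraceBound T c) (hc : 0 ≤ c)
    {B C : EllTwo (X × H) →L[ℂ] EllTwo (X × H)}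
    (hB : B ∈ equivariant X H) (hC : C ∈ equivariant X H) :
    IsTraceBound (B * T * C) (c * (‖B‖ * ‖C‖)) := by
  intro B' hB' C' hC' F
  have := hT (B' * B) (mul_mem hB' hB) (C * C') (mul_mem hC hC') F
  simp only [← mul_assoc] at this ⊢
  refine this.trans ?_
  have h1 := norm_mul_le B' B
  have h2 := norm_mul_le C C'
  calc c * ‖B' * B‖ * ‖C * C'‖ ≤ c * (‖B'‖ * ‖B‖) * (‖C‖ * ‖C'‖) := by gcongr
    _ = _ := by ring

/-- Trace norm bounds pass to limits in the operator norm. -/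
theorem of_tendsto {T' : ℕ → EllTwo (X × H) →L[ℂ] EllTwo (X × H)}
    (hT : Filter.Tendsto T' Filter.atTop (nhds T)) (h : ∀ᶠ k in Filter.atTop, IsTraceBound (T' k) c) :
    IsTraceBound T c := by
  intro B hB C hC F
  have hcont : Filter.Tendsto (fun k => ∑ x ∈ F, ‖diag x (B * T' k * C)‖) Filter.atTop
      (nhds (∑ x ∈ F, ‖diag x (B * T * C)‖)) := by
    refine tendsto_finsetSum _ fun x _ => ?_
    exact (((continuous_diag x).tendsto _).comp ((hT.const_mul B).mul_const C)).norm
  exact le_of_tendsto hcont (h.mono fun k hk => hk B hB C hC F)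

theorem summable (hT : IsTraceBound T c) {B C : EllTwo (X × H) →L[ℂ] EllTwo (X × H)}
    (hB : B ∈ equivariant X H) (hC : C ∈ equivariant X H) :
    Summable fun x => diag x (B * T * C) :=
  Summable.of_norm (summable_of_sum_le (fun _ => norm_nonneg _) (hT B hB C hC))

theorem norm_tsum_le (hT : IsTraceBound T c) {B C : EllTwo (X × H) →L[ℂ] EllTwo (X × H)}
    (hB : B ∈ equivariant X H) (hC : C ∈ equivariant X H) :
    ‖∑' x, diag x (B * T * C)‖ ≤ c * (‖B‖ * ‖C‖) := by
  have h := summable_of_sum_le (fun _ => norm_nonneg _) (hT B hB C hC)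
  exact (norm_tsum_le_tsum_norm h).trans (h.tsum_le_of_sum_le (hT B hB C hC))

theorem mul_layerProj_mul {B C : EllTwo (X × H) →L[ℂ] EllTwo (X × H)}
    (hB : B ∈ equivariant X H) (hC : C ∈ equivariant X H) (y : X) :
    IsTraceBound (B * layerProj y * C) (‖B‖ * ‖C‖) := by
  intro B' hB' C' hC' F
  set S := star (B' * B) with hS
  set T := C * C' with hT
  have hSm : S ∈ equivariant X H := star_mem (mul_mem hB' hB)
  have hTm : T ∈ equivariant X H := mul_mem hC hC'
  have h1 (x : X) : ‖diag x (B' * (B * layerProj y * C) * C')‖ ≤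
      ‖slice y (S (delta (x, 1)))‖ * ‖slice y (T (delta (x, 1)))‖ := by
    have : diag x (B' * (B * layerProj y * C) * C') =
        inner ℂ (slice y (S (delta (x, 1)))) (slice y (T (delta (x, 1)))) := by
      rw [← ContinuousLinearMap.adjoint_inner_right (slice y), adjoint_slice, hS,
        ContinuousLinearMap.star_eq_adjoint, ContinuousLinearMap.adjoint_inner_left]
      rfl
    rw [this]
    exact norm_inner_le_norm _ _
  have h2 : (∑ x ∈ F, ‖slice y (S (delta (x, 1)))‖ * ‖slice y (T (delta (x, 1)))‖) ≤
      ‖S‖ * ‖T‖ := by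
    refine (Real.sum_mul_le_sqrt_mul_sqrt F _ _).trans ?_
    gcongr
    · exact Real.sqrt_le_iff.2 ⟨norm_nonneg _, sum_norm_sq_slice_le hSm y F⟩
    · exact Real.sqrt_le_iff.2 ⟨norm_nonneg _, sum_norm_sq_slice_le hTm y F⟩
  refine (Finset.sum_le_sum fun x _ => h1 x).trans (h2.trans ?_)
  rw [show ‖S‖ = ‖B' * B‖ from norm_star (B' * B)]
  calc ‖B' * B‖ * ‖T‖ ≤ (‖B'‖ * ‖B‖) * (‖C‖ * ‖C'‖) := by
        gcongr
        · exact norm_mul_le _ _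
        · exact norm_mul_le _ _
    _ = _ := by ring

end IsTraceBound

namespace IsTraceClass

variable {S T : EllTwo (X × H) →L[ℂ] EllTwo (X × H)} {c d : ℝ}

theorem exists_nonneg_bound (hT : IsTraceClass T) : ∃ c, 0 ≤ c ∧ IsTraceBound T c := by
  obtain ⟨c, hc⟩ := hT.bound
  exact ⟨max c 0, le_max_right _ _, hc.mono (le_max_left _ _)⟩

theorem summable (hT : IsTraceClass T) : Summable fun x => diag x T := by
  obtain ⟨c, hc⟩ := hT.bound
  simpa using hc.summable (one_mem _) (one_mem _)

theorem zero : IsTraceClass (0 : EllTwo (X × H) →L[ℂ] EllTwo (X × H)) where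
  mem := zero_mem _
  bound := ⟨0, IsTraceBound.zero⟩
  cyclic B _ C _ := by simp

theorem add (hS : IsTraceClass S) (hT : IsTraceClass T) : IsTraceClass (S + T) where
  mem := add_mem hS.mem hT.mem
  bound := by
    obtain ⟨c, hc⟩ := hS.bound
    obtain ⟨d, hd⟩ := hT.bound
    exact ⟨_, hc.add hd⟩
  cyclic B hB C hC := by
    obtain ⟨c, hc⟩ := hS.bound
    obtain ⟨d, hd⟩ := hT.bound
    have e1 := (hc.summable hB hC).tsum_add (hd.summable hB hC)
    have e2 := (hc.summable (one_mem _) (mul_mem hC hB)).tsum_add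
      (hd.summable (one_mem _) (mul_mem hC hB))
    simp only [one_mul, ← mul_assoc] at e2
    simp only [mul_add, add_mul, map_add]
    rw [e1, e2, hS.cyclic B hB C hC, hT.cyclic B hB C hC]

theorem smul (hT : IsTraceClass T) (r : ℂ) : IsTraceClass (r • T) where
  mem := SMulMemClass.smul_mem r hT.mem
  bound := by
    obtain ⟨c, hc⟩ := hT.bound
    exact ⟨_, hc.smul r⟩
  cyclic B hB C hC := by
    simp only [mul_smul_comm, smul_mul_assoc, map_smul, smul_eq_mul, tsum_mul_left,
      hT.cyclic B hB C hC]

theorem neg (hT : IsTraceClass T) : IsTraceClass (-T) := by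
  simpa using hT.smul (-1)

theorem sub (hS : IsTraceClass S) (hT : IsTraceClass T) : IsTraceClass (S - T) := by
  simpa [sub_eq_add_neg] using hS.add hT.neg

theorem tsum_sub (hS : IsTraceClass S) (hT : IsTraceClass T) :
    ∑' x, diag x (S - T) = ∑' x, diag x S - ∑' x, diag x T := by
  simp only [map_sub]
  exact hS.summable.tsum_sub hT.summable

theorem sum {κ : Type*} (s : Finset κ) {f : κ → EllTwo (X × H) →L[ℂ] EllTwo (X × H)}
    (hf : ∀ i ∈ s, IsTraceClass (f i)) : IsTraceClass (∑ i ∈ s, f i) :=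
  Finset.sum_induction _ _ (fun _ _ => add) zero hf

theorem mul_left (hT : IsTraceClass T) (hS : S ∈ equivariant X H) : IsTraceClass (S * T) where
  mem := mul_mem hS hT.mem
  bound := by
    obtain ⟨c, hc0, hc⟩ := hT.exists_nonneg_bound
    have := hc.mul_mul hc0 hS (one_mem _)
    rw [mul_one] at this
    exact ⟨_, this⟩
  cyclic B hB C hC := by
    have e1 := hT.cyclic _ (mul_mem hB hS) C hC
    have e2 := hT.cyclic S hS (C * B) (mul_mem hC hB)
    simp only [← mul_assoc] at e1 e2 ⊢
    rw [e1, e2]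

theorem mul_right (hT : IsTraceClass T) (hS : S ∈ equivariant X H) : IsTraceClass (T * S) where
  mem := mul_mem hT.mem hS
  bound := by
    obtain ⟨c, hc0, hc⟩ := hT.exists_nonneg_bound
    have := hc.mul_mul hc0 (one_mem _) hS
    rw [one_mul] at this
    exact ⟨_, this⟩
  cyclic B hB C hC := by
    have e1 := hT.cyclic B hB _ (mul_mem hS hC)
    simp only [← mul_assoc] at e1 ⊢
    exact e1

theorem mul_layerProj_mul {B C : EllTwo (X × H) →L[ℂ] EllTwo (X × H)}
    (hB : B ∈ equivariant X H) (hC : C ∈ equivariant X H) (y : X) :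
    IsTraceClass (B * layerProj y * C) where
  mem := mul_mem (mul_mem hB (layerProj_mem_equivariant y)) hC
  bound := ⟨_, IsTraceBound.mul_layerProj_mul hB hC y⟩
  cyclic B' hB' C' hC' := by
    have e1 := (hasSum_diag_mul_layerProj_mul (mul_mem hB' hB) (mul_mem hC hC') y).tsum_eq
    have e2 := (hasSum_diag_mul_layerProj_mul hB (mul_mem hC (mul_mem hC' hB')) y).tsum_eq
    simp only [← mul_assoc] at e1 e2 ⊢
    rw [e1, e2]

theorem of_mul_sum_layerProj (hT : T ∈ equivariant X H) {F : Finset X}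
    (h : T * ∑ x ∈ F, layerProj x = T) : IsTraceClass T := by
  rw [← h, Finset.mul_sum]
  refine sum _ fun x _ => ?_
  simpa using mul_layerProj_mul hT (one_mem _) x

/-- The trace class operators are closed under limits in trace norm. -/
theorem of_tendsto {T' : ℕ → EllTwo (X × H) →L[ℂ] EllTwo (X × H)} {ε : ℕ → ℝ}
    (hT : Filter.Tendsto T' Filter.atTop (nhds T)) (hT' : ∀ k, IsTraceClass (T' k))
    (hε : Filter.Tendsto ε Filter.atTop (nhds 0))
    (h : ∀ k j, k ≤ j → IsTraceBound (T' j - T' k) (ε k)) : IsTraceClass T := by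
  have hb (k : ℕ) : IsTraceBound (T - T' k) (ε k) :=
    IsTraceBound.of_tendsto (hT.sub_const _)
      ((Filter.eventually_ge_atTop k).mono fun j hj => h k j hj)
  refine ⟨?_, ?_, fun B hB C hC => ?_⟩
  · exact isClosed_equivariant.mem_of_tendsto hT (Filter.Eventually.of_forall fun k => (hT' k).mem)
  · obtain ⟨c, hc⟩ := (hT' 0).bound
    have := (hb 0).add hc
    rw [sub_add_cancel] at this
    exact ⟨_, this⟩
  · have hlim {B C : EllTwo (X × H) →L[ℂ] EllTwo (X × H)} (hB : B ∈ equivariant X H)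
        (hC : C ∈ equivariant X H) : Filter.Tendsto (fun k => ∑' x, diag x (B * T' k * C))
          Filter.atTop (nhds (∑' x, diag x (B * T * C))) := by
      rw [tendsto_iff_norm_sub_tendsto_zero]
      refine squeeze_zero (fun _ => norm_nonneg _) (fun k => ?_)
        (by simpa using hε.mul_const (‖B‖ * ‖C‖))
      obtain ⟨c, hc⟩ := (hT' k).bound
      have e : ∑' x, diag x (B * (T - T' k) * C) =
          ∑' x, diag x (B * T * C) - ∑' x, diag x (B * T' k * C) := by
        have hs := ((hb k).summable hB hC)
        have hs2 := hc.summable hB hC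
        have hs3 : Summable fun x => diag x (B * T * C) := by
          have := hs.add hs2
          simp only [← map_add, ← add_mul, ← mul_add, sub_add_cancel] at this
          exact this
        rw [← hs3.tsum_sub hs2]
        simp only [mul_sub, sub_mul, map_sub]
      rw [norm_sub_rev, ← e]
      exact (hb k).norm_tsum_le hB hC
    refine tendsto_nhds_unique (hlim hB hC) ?_
    have := hlim (one_mem _) (mul_mem hC hB)
    simp only [one_mul, ← mul_assoc] at this
    refine this.congr fun k => ((hT' k).cyclic B hB C hC).symm

end IsTraceClass

/-- The trace vanishes on a trace class difference of two nearby equivariant projections: they are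
conjugate by `1 + x` for a trace class operator `x`. (The projections themselves need not have
finite trace.) -/
theorem tsum_diag_sub_eq_zero {S R : EllTwo (X × H) →L[ℂ] EllTwo (X × H)}
    (hS : S ∈ equivariant X H) (hR : R ∈ equivariant X H) (hS' : IsStarProjection S)
    (hR' : IsStarProjection R) (hSR : IsTraceClass (S - R)) (hlt : ‖S - R‖ < 1 / 2) :
    ∑' x, diag x (S - R) = 0 := by
  have hSS : S * S = S := hS'.isIdempotentElem
  have hRR : R * R = R := hR'.isIdempotentElem
  set x := S * (R - S) + (S - R) * R with hx
  have hxT : IsTraceClass x := by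
    refine (IsTraceClass.mul_left ?_ hS).add (hSR.mul_right hR)
    rw [← neg_sub]
    exact hSR.neg
  have hnorm : ‖x‖ < 1 := by
    refine (norm_add_le _ _).trans_lt ?_
    have h1 := norm_mul_le S (R - S)
    have h2 := norm_mul_le (S - R) R
    have h3 : ‖S‖ ≤ 1 := IsStarProjection.norm_le S hS'
    have h4 : ‖R‖ ≤ 1 := IsStarProjection.norm_le R hR'
    rw [norm_sub_rev R S] at h1
    have h5 := norm_nonneg (S - R)
    nlinarith
  obtain ⟨z, hz⟩ : ∃ z : (EllTwo (X × H) →L[ℂ] EllTwo (X × H))ˣ,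
      (z : EllTwo (X × H) →L[ℂ] EllTwo (X × H)) = 1 + x :=
    ⟨Units.oneSub (-x) (by rwa [norm_neg]), by simp⟩
  set y : EllTwo (X × H) →L[ℂ] EllTwo (X × H) :=
    ((z⁻¹ : (EllTwo (X × H) →L[ℂ] EllTwo (X × H))ˣ) : EllTwo (X × H) →L[ℂ] EllTwo (X × H)) with hy
  have hym : y ∈ equivariant X H :=
    inv_mem_equivariant (by rw [hz]; exact add_mem (one_mem _) hxT.mem)
  have hzy : (1 + x) * y = 1 := by rw [← hz]; exact Units.mul_inv z
  have hyz : y * (1 + x) = 1 := by rw [← hz]; exact Units.inv_mul z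
  have hcomm : y * x = x * y := by
    have h1 : x * y = 1 - y := by rw [← hzy]; noncomm_ring
    have h2 : y * x = 1 - y := by rw [← hyz]; noncomm_ring
    rw [h1, h2]
  have hconj : S * (1 + x) = (1 + x) * R := by
    simp only [hx, mul_add, mul_sub, add_mul, sub_mul, ← mul_assoc, hSS, mul_one, one_mul]
    simp only [mul_assoc, hRR]
    abel
  have hdiff : S - R = x * (R * y) - R * x * y := by
    have : S - R = (S * (1 + x) - R * (1 + x)) * y := by
      rw [← sub_mul, mul_assoc, hzy, mul_one]
    rw [this, hconj]
    noncomm_ring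
  have e1 := hxT.cyclic y hym R hR
  have e2 := hxT.cyclic R hR y hym
  obtain ⟨c, hc⟩ := hxT.bound
  have s1 : Summable fun i => diag i (x * (R * y)) := by
    simpa using hc.summable (one_mem _) (mul_mem hR hym)
  have s2 := hc.summable hR hym
  rw [hdiff]
  simp only [map_sub]
  rw [s1.tsum_sub s2, e2, ← mul_assoc, ← e1, hcomm, sub_self]

end EllTwo

/-! ### Idempotents by Newton iteration -/

/-- The relation `N a ≤ r` for some submultiplicative seminorm `N`. -/
structure IsRingBound {R : Type*} [Ring R] (Bd : R → ℝ → Prop) : Prop where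
  zero : Bd 0 0
  add : ∀ {a b r s}, Bd a r → Bd b s → Bd (a + b) (r + s)
  neg : ∀ {a r}, Bd a r → Bd (-a) r
  mul : ∀ {a b r s}, Bd a r → Bd b s → Bd (a * b) (r * s)
  mono : ∀ {a r s}, Bd a r → r ≤ s → Bd a s

/-- The polynomial `3a² - 2a³`, whose iterates turn almost idempotent elements into idempotents. -/
def newtonStep {R : Type*} [Ring R] (a : R) : R :=
  a + ((a * a - a) - ((a * a - a) * a + (a * a - a) * a))

theorem newtonStep_mul_self_sub {R : Type*} [Ring R] (a : R) :
    newtonStep a * newtonStep a - newtonStep a =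
      ((a * a - a) + (a * a - a) + ((a * a - a) + (a * a - a))) * ((a * a - a) * (a * a - a)) -
        ((a * a - a) + ((a * a - a) + (a * a - a))) * (a * a - a) := by
  simp only [newtonStep]
  noncomm_ring

namespace IsRingBound

variable {R : Type*} [Ring R] {Bd : R → ℝ → Prop}

theorem sub (h : IsRingBound Bd) {a b : R} {r s : ℝ} (ha : Bd a r) (hb : Bd b s) :
    Bd (a - b) (r + s) := by
  rw [sub_eq_add_neg]
  exact h.add ha (h.neg hb)

theorem newtonStep_sub (h : IsRingBound Bd) {a : R} {r : ℝ} (ha : Bd a 3)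
    (hx : Bd (a * a - a) r) : Bd (newtonStep a - a) (7 * r) := by
  rw [newtonStep, add_sub_cancel_left]
  exact h.mono (h.sub hx (h.add (h.mul hx ha) (h.mul hx ha))) (by linarith)

theorem newtonStep_mul_self_sub (h : IsRingBound Bd) {a : R} {r : ℝ} (hr : 0 ≤ r)
    (hr' : r ≤ 1 / 32) (hx : Bd (a * a - a) r) :
    Bd (newtonStep a * newtonStep a - newtonStep a) (r / 2) := by
  rw [_root_.newtonStep_mul_self_sub]
  refine h.mono (h.sub (h.mul (h.add (h.add hx hx) (h.add hx hx)) (h.mul hx hx))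
    (h.mul (h.add hx (h.add hx hx)) hx)) ?_
  nlinarith [mul_nonneg hr hr]

theorem newtonStep_iterate (h : IsRingBound Bd) {a : R} {r : ℝ} (hr : 0 ≤ r) (hr' : r ≤ 1 / 32)
    (ha : Bd a 2) (hx : Bd (a * a - a) r) (k : ℕ) :
    Bd (newtonStep^[k] a) (3 - 1 / 2 ^ k) ∧
      Bd (newtonStep^[k] a * newtonStep^[k] a - newtonStep^[k] a) (r / 2 ^ k) := by
  induction k with
  | zero => exact ⟨h.mono ha (by norm_num), h.mono hx (by norm_num)⟩
  | succ k ih =>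
    obtain ⟨h1, h2⟩ := ih
    have hpos : (0 : ℝ) < 1 / 2 ^ k := by positivity
    have hle : r / 2 ^ k ≤ 1 / 32 * (1 / 2 ^ k) := by
      rw [div_eq_mul_one_div]
      exact mul_le_mul_of_nonneg_right hr' hpos.le
    have hle1 : (1 : ℝ) / 2 ^ k ≤ 1 := by
      rw [div_le_one (by positivity)]
      exact one_le_pow₀ (by norm_num)
    rw [Function.iterate_succ_apply']
    have e1 : (1 : ℝ) / 2 ^ (k + 1) = (1 / 2 ^ k) / 2 := by rw [pow_succ]; field_simp
    constructor
    · have := h.add h1 (h.newtonStep_sub (h.mono h1 (by linarith)) h2)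
      rw [add_sub_cancel] at this
      refine h.mono this ?_
      rw [e1]
      linarith
    · refine h.mono (h.newtonStep_mul_self_sub (by positivity) (by linarith) h2) ?_
      rw [pow_succ, div_div]

theorem newtonStep_iterate_sub (h : IsRingBound Bd) {a : R} {r : ℝ} (hr : 0 ≤ r)
    (hr' : r ≤ 1 / 32) (ha : Bd a 2) (hx : Bd (a * a - a) r) {k j : ℕ} (hkj : k ≤ j) :
    Bd (newtonStep^[j] a - newtonStep^[k] a) (14 * r / 2 ^ k) := by
  suffices ∀ m, Bd (newtonStep^[k + m] a - newtonStep^[k] a)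
      (14 * r / 2 ^ k - 14 * r / 2 ^ (k + m)) by
    obtain ⟨m, rfl⟩ := Nat.exists_eq_add_of_le hkj
    exact h.mono (this m) (by simp only [tsub_le_iff_right, le_add_iff_nonneg_right]; positivity)
  intro m
  induction m with
  | zero => simpa using h.zero
  | succ m ih =>
    obtain ⟨h1, h2⟩ := h.newtonStep_iterate hr hr' ha hx (k + m)
    have hpos : (0 : ℝ) < 1 / 2 ^ (k + m) := by positivity
    have := h.add (h.newtonStep_sub (h.mono h1 (by linarith)) h2) ih
    rw [sub_add_sub_cancel, ← Function.iterate_succ_apply' newtonStep] at this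
    refine h.mono this (le_of_eq ?_)
    rw [← add_assoc k m 1, pow_succ]
    field_simp
    ring

end IsRingBound

theorem isRingBound_norm (A : Type*) [NormedRing A] : IsRingBound fun (a : A) r => ‖a‖ ≤ r where
  zero := by simp
  add ha hb := norm_add_le_of_le ha hb
  neg ha := by rwa [norm_neg]
  mul ha hb := norm_mul_le_of_le ha hb
  mono := le_trans

/-- Newton iteration started at an almost idempotent element converges to an idempotent nearby. -/
theorem exists_tendsto_newtonStep {A : Type*} [NormedRing A] [CompleteSpace A] {a : A} {r : ℝ}
    (hr : 0 ≤ r) (hr' : r ≤ 1 / 32) (ha : ‖a‖ ≤ 2) (hx : ‖a * a - a‖ ≤ r) :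
    ∃ p, Filter.Tendsto (fun k => newtonStep^[k] a) Filter.atTop (nhds p) ∧ p * p = p ∧
      ‖p - a‖ ≤ 14 * r := by
  have h := isRingBound_norm A
  have hlim (c : ℝ) : Filter.Tendsto (fun k : ℕ => c / 2 ^ k) Filter.atTop (nhds 0) :=
    tendsto_const_nhds.div_atTop (tendsto_pow_atTop_atTop_of_one_lt (by norm_num))
  have hc : CauchySeq fun k => newtonStep^[k] a := by
    refine cauchySeq_of_le_tendsto_0' _ (fun k j hkj => ?_) (hlim (14 * r))
    rw [dist_comm, dist_eq_norm]
    exact h.newtonStep_iterate_sub hr hr' ha hx hkj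
  obtain ⟨p, hp⟩ := cauchySeq_tendsto_of_complete hc
  refine ⟨p, hp, ?_, ?_⟩
  · rw [← sub_eq_zero, ← norm_le_zero_iff]
    exact le_of_tendsto_of_tendsto' ((hp.mul hp).sub hp).norm (hlim r)
      fun k => (h.newtonStep_iterate hr hr' ha hx k).2
  · refine le_of_tendsto (hp.sub_const a).norm (Filter.Eventually.of_forall fun k => ?_)
    simpa using h.newtonStep_iterate_sub hr hr' ha hx (Nat.zero_le k)

theorem star_newtonStep_iterate {R : Type*} [Ring R] [StarRing R] {a : R} (ha : star a = a)
    (k : ℕ) : star (newtonStep^[k] a) = newtonStep^[k] a := by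
  induction k with
  | zero => exact ha
  | succ k ih =>
    rw [Function.iterate_succ_apply']
    simp only [newtonStep, star_add, star_sub, star_mul, ih]
    noncomm_ring

/-- A self-adjoint almost idempotent element is close to a projection. -/
theorem exists_isStarProjection_near {A : Type*} [NormedRing A] [CompleteSpace A] [StarRing A]
    [ContinuousStar A] {a : A} {r : ℝ} (hr : 0 ≤ r) (hr' : r ≤ 1 / 32) (ha : ‖a‖ ≤ 2)
    (hx : ‖a * a - a‖ ≤ r) (hstar : star a = a) :
    ∃ p, Filter.Tendsto (fun k => newtonStep^[k] a) Filter.atTop (nhds p) ∧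
      IsStarProjection p ∧ ‖p - a‖ ≤ 14 * r := by
  obtain ⟨p, hp, hpp, hpa⟩ := exists_tendsto_newtonStep hr hr' ha hx
  refine ⟨p, hp, ⟨hpp, ?_⟩, hpa⟩
  refine tendsto_nhds_unique ((continuous_star.tendsto p).comp hp) ?_
  refine hp.congr fun k => (star_newtonStep_iterate hstar k).symm

theorem norm_mul_self_sub_le {A : Type*} [NormedRing A] {p a : A} {ε : ℝ} (hp : p * p = p)
    (hp1 : ‖p‖ ≤ 1) (hε : ε ≤ 1) (h : ‖a - p‖ ≤ ε) : ‖a‖ ≤ 2 ∧ ‖a * a - a‖ ≤ 4 * ε := by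
  have ha : ‖a‖ ≤ ε + 1 := by
    have := norm_add_le (a - p) p
    rw [sub_add_cancel] at this
    linarith
  refine ⟨by linarith, ?_⟩
  have e : a * a - a = (a - p) * a + p * (a - p) - (a - p) := by
    simp only [sub_mul, mul_sub, hp]
    abel
  rw [e]
  have h1 := norm_mul_le_of_le h ha
  have h2 := norm_mul_le_of_le hp1 h
  have h3 : 0 ≤ ε := (norm_nonneg _).trans h
  refine (norm_sub_le _ _).trans ?_
  have := norm_add_le ((a - p) * a) (p * (a - p))
  nlinarith

/-- Nearby idempotents have the same value under every trace. -/
theorem trace_eq_of_near {A B : Type*} [NormedRing A] [CompleteSpace A] [AddCommGroup B]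
    (τ : A →+ B) (hτ : ∀ a b, τ (a * b) = τ (b * a)) {p q : A} (hp : p * p = p) (hq : q * q = q)
    (hp1 : ‖p‖ ≤ 1) (hq1 : ‖q‖ ≤ 1) (h : ‖p - q‖ < 1 / 2) : τ p = τ q := by
  set x := p * (q - p) + (p - q) * q with hx
  have hnorm : ‖x‖ < 1 := by
    refine (norm_add_le _ _).trans_lt ?_
    have h1 := norm_mul_le p (q - p)
    have h2 := norm_mul_le (p - q) q
    rw [norm_sub_rev q p] at h1
    have h5 := norm_nonneg (p - q)
    nlinarith
  obtain ⟨z, hz⟩ : ∃ z : Aˣ, (z : A) = 1 + x :=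
    ⟨Units.oneSub (-x) (by rwa [norm_neg]), by simp⟩
  have hconj : p * z = z * q := by
    rw [hz]
    simp only [hx, mul_add, mul_sub, add_mul, sub_mul, ← mul_assoc, hp, mul_one, one_mul]
    simp only [mul_assoc, hq]
    abel
  have : p = z * (q * (z⁻¹ : Aˣ)) := by
    rw [← mul_assoc, ← hconj, mul_assoc, Units.mul_inv, mul_one]
  rw [this, hτ, mul_assoc, Units.inv_mul, mul_one]

namespace EllTwo

variable {X : Type u} {H : Type v} [Group H]

/-- For two representations `ρ`, `ρ'`, the elements on which they differ by a trace class operator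
are stable under limits of Newton iteration: these converge in the norm `‖a‖ + κ ‖ρ a - ρ' a‖₁`
as well, and the factor `κ` makes the second summand small at the start. -/
theorem isTraceClass_of_tendsto_newtonStep {A : Type*} [CStarAlgebra A]
    (ρ ρ' : A →⋆ₙₐ[ℂ] (EllTwo (X × H) →L[ℂ] EllTwo (X × H)))
    (hρ : ∀ a, ρ a ∈ equivariant X H) (hρ' : ∀ a, ρ' a ∈ equivariant X H)
    {a p : A} (ha : IsTraceClass (ρ a - ρ' a)) (ha2 : ‖a‖ ≤ 3 / 2) (hx : ‖a * a - a‖ ≤ 1 / 64)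
    (hp : Filter.Tendsto (fun k => newtonStep^[k] a) Filter.atTop (nhds p)) :
    IsTraceClass (ρ p - ρ' p) := by
  have hmul (b c : A) : ρ (b * c) - ρ' (b * c) = (ρ b - ρ' b) * ρ c + ρ' b * (ρ c - ρ' c) := by
    rw [map_mul, map_mul]
    noncomm_ring
  have hadd (b c : A) : ρ (b + c) - ρ' (b + c) = (ρ b - ρ' b) + (ρ c - ρ' c) := by
    rw [map_add, map_add]
    abel
  have hsub (b c : A) : ρ (b - c) - ρ' (b - c) = (ρ b - ρ' b) - (ρ c - ρ' c) := by
    rw [map_sub, map_sub]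
    abel
  have tmul {b c : A} (hb : IsTraceClass (ρ b - ρ' b)) (hc : IsTraceClass (ρ c - ρ' c)) :
      IsTraceClass (ρ (b * c) - ρ' (b * c)) := by
    rw [hmul]
    exact (hb.mul_right (hρ c)).add (hc.mul_left (hρ' b))
  have tadd {b c : A} (hb : IsTraceClass (ρ b - ρ' b)) (hc : IsTraceClass (ρ c - ρ' c)) :
      IsTraceClass (ρ (b + c) - ρ' (b + c)) := by
    rw [hadd]
    exact hb.add hc
  have tsub {b c : A} (hb : IsTraceClass (ρ b - ρ' b)) (hc : IsTraceClass (ρ c - ρ' c)) :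
      IsTraceClass (ρ (b - c) - ρ' (b - c)) := by
    rw [hsub]
    exact hb.sub hc
  have titer (k : ℕ) : IsTraceClass (ρ (newtonStep^[k] a) - ρ' (newtonStep^[k] a)) := by
    induction k with
    | zero => exact ha
    | succ k ih =>
      rw [Function.iterate_succ_apply']
      have h1 := tsub (tmul ih ih) ih
      exact tadd ih (tsub h1 (tadd (tmul h1 ih) (tmul h1 ih)))
  obtain ⟨c, hc0, hc⟩ := ha.exists_nonneg_bound
  obtain ⟨d, hd0, hd⟩ := (tsub (tmul ha ha) ha).exists_nonneg_bound
  set κ : ℝ := 1 / (64 * (c + d + 1)) with hκ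
  have hκ0 : 0 < κ := by positivity
  have hκc : κ * c ≤ 1 / 64 := by
    rw [hκ, div_mul_eq_mul_div, one_mul, div_le_div_iff₀ (by positivity) (by norm_num)]
    linarith
  have hκd : κ * d ≤ 1 / 64 := by
    rw [hκ, div_mul_eq_mul_div, one_mul, div_le_div_iff₀ (by positivity) (by norm_num)]
    linarith
  let Bd : A → ℝ → Prop := fun b r => ∃ s t, 0 ≤ t ∧ ‖b‖ ≤ s ∧
    IsTraceBound (ρ b - ρ' b) t ∧ s + κ * t ≤ r
  have hBd : IsRingBound Bd :=
    { zero := ⟨0, 0, le_rfl, by simp, by simpa using IsTraceBound.zero, by simp⟩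
      add := by
        rintro b c r r' ⟨s, t, h0, h1, h2, h3⟩ ⟨s', t', h0', h1', h2', h3'⟩
        refine ⟨s + s', t + t', by positivity, norm_add_le_of_le h1 h1', ?_, by linarith⟩
        rw [hadd]
        exact h2.add h2'
      neg := by
        rintro b r ⟨s, t, h0, h1, h2, h3⟩
        refine ⟨s, t, h0, by rwa [norm_neg], ?_, h3⟩
        rw [map_neg, map_neg, ← neg_sub', neg_sub]
        convert h2.neg using 1
        abel
      mul := by
        rintro b c r r' ⟨s, t, h0, h1, h2, h3⟩ ⟨s', t', h0', h1', h2', h3'⟩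
        have hs := (norm_nonneg _).trans h1
        have hs' := (norm_nonneg _).trans h1'
        refine ⟨s * s', t * s' + s * t', by positivity, norm_mul_le_of_le h1 h1', ?_, ?_⟩
        · rw [hmul]
          have k1 := h2.mul_mul h0 (one_mem _) (hρ c)
          have k2 := h2'.mul_mul h0' (hρ' b) (one_mem _)
          rw [one_mul] at k1
          rw [mul_one] at k2
          have n1 : ‖(1 : EllTwo (X × H) →L[ℂ] EllTwo (X × H))‖ ≤ 1 :=
            ContinuousLinearMap.norm_id_le
          have n2 : ‖ρ c‖ ≤ s' := (NonUnitalStarAlgHom.norm_apply_le ρ c).trans h1'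
          have n3 : ‖ρ' b‖ ≤ s := (NonUnitalStarAlgHom.norm_apply_le ρ' b).trans h1
          refine (k1.mono ?_).add (k2.mono ?_)
          · calc _ ≤ t * (1 * s') := by gcongr
              _ = _ := by ring
          · calc _ ≤ t' * (s * 1) := by gcongr
              _ = _ := by ring
        · calc s * s' + κ * (t * s' + s * t') ≤ (s + κ * t) * (s' + κ * t') := by
                nlinarith [mul_nonneg (mul_nonneg hκ0.le h0) (mul_nonneg hκ0.le h0')]
            _ ≤ r * r' := by
                have : 0 ≤ s' + κ * t' := by positivity
                have : 0 ≤ r := le_trans (by positivity) h3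
                gcongr
      mono := by
        rintro b r r' ⟨s, t, h0, h1, h2, h3⟩ hr
        exact ⟨s, t, h0, h1, h2, h3.trans hr⟩ }
  have b1 : Bd a 2 := ⟨3 / 2, c, hc0, ha2, hc, by linarith⟩
  have b2 : Bd (a * a - a) (1 / 32) := ⟨1 / 64, d, hd0, hx, hd, by linarith⟩
  have hcont (σ : A →⋆ₙₐ[ℂ] (EllTwo (X × H) →L[ℂ] EllTwo (X × H))) : Continuous σ :=
    AddMonoidHomClass.continuous_of_bound σ 1 fun b => by
      simpa using NonUnitalStarAlgHom.norm_apply_le σ b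
  refine IsTraceClass.of_tendsto (T' := fun k => ρ (newtonStep^[k] a) - ρ' (newtonStep^[k] a))
    (ε := fun k => 14 * (1 / 32) / κ / 2 ^ k)
    ((((hcont ρ).tendsto p).comp hp).sub (((hcont ρ').tendsto p).comp hp)) titer
    (tendsto_const_nhds.div_atTop (tendsto_pow_atTop_atTop_of_one_lt (by norm_num))) ?_
  intro k j hkj
  obtain ⟨s, t, h0, h1, h2, h3⟩ := hBd.newtonStep_iterate_sub (by norm_num) le_rfl b1 b2 hkj
  rw [← hsub]
  refine h2.mono ?_
  rw [div_right_comm, le_div_iff₀ hκ0]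
  linarith [(norm_nonneg _).trans h1]

end EllTwo

/-! ### Matrices over an algebra of operators -/

namespace EllTwo

section blockHom

variable {Y : Type u} {Z : Type v} {m : Type w} (f : m → Y ↪ Z)

theorem restrict_comp_incl_of_ne (hf : ∀ i j x y, f i x = f j y → i = j) {i j : m} (hij : i ≠ j) :
    restrict (f i) ∘L incl (f j) = 0 :=
  clm_ext fun x => by
    simp only [ContinuousLinearMap.comp_apply, incl_delta, zero_apply]
    exact restrict_delta_of_notMem _ fun y hy => hij (hf i j y x hy)

variable [Fintype m]

/-- The representation of `M_m(A)` on `ℓ²(Z)` by block operators, for embeddings `f i : Y ↪ Z`,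
`i ∈ m`, with disjoint images and a representation `ψ` of `A` on `ℓ²(Y)`. -/
def blockHom (hf : ∀ i j x y, f i x = f j y → i = j) {A : Type*} [NonUnitalRing A] [StarRing A]
    [Module ℂ A] (ψ : A →⋆ₙₐ[ℂ] (EllTwo Y →L[ℂ] EllTwo Y)) :
    CStarMatrix m m A →⋆ₙₐ[ℂ] (EllTwo Z →L[ℂ] EllTwo Z) where
  toFun a := ∑ i, ∑ j, incl (f i) ∘L ψ (a i j) ∘L restrict (f j)
  map_smul' c a := by
    simp only [CStarMatrix.smul_apply, map_smul, Finset.smul_sum, MonoidHom.id_apply,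
      ContinuousLinearMap.smul_comp, ContinuousLinearMap.comp_smul]
  map_zero' := by simp
  map_add' a b := by
    simp only [CStarMatrix.add_apply, map_add, ContinuousLinearMap.add_comp,
      ContinuousLinearMap.comp_add, Finset.sum_add_distrib]
  map_mul' a b := by
    classical
    have h (i j k l : m) (S T : EllTwo Y →L[ℂ] EllTwo Y) :
        (incl (f i) ∘L S ∘L restrict (f j)) * (incl (f k) ∘L T ∘L restrict (f l)) =
          if j = k then incl (f i) ∘L (S * T) ∘L restrict (f l) else 0 := by
      ext1 ξ
      split_ifs with hjk
      · subst hjk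
        have h1 (η) : restrict (f j) (incl (f j) η) = η :=
          DFunLike.congr_fun (restrict_comp_incl (f j)) η
        simp [h1]
      · have h1 (η) : restrict (f j) (incl (f k) η) = 0 :=
          DFunLike.congr_fun (restrict_comp_incl_of_ne f hf hjk) η
        simp [h1]
    have h2 (i j : m) : (∑ k, ∑ l, if j = k then
        incl (f i) ∘L (ψ (a i j) * ψ (b k l)) ∘L restrict (f l) else 0) =
          ∑ l, incl (f i) ∘L (ψ (a i j) * ψ (b j l)) ∘L restrict (f l) := by
      rw [Finset.sum_eq_single j (fun k _ hk => by simp [hk.symm]) (by simp)]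
      simp
    simp only [Finset.sum_mul]
    simp only [Finset.mul_sum, h, h2]
    refine Finset.sum_congr rfl fun i _ => ?_
    rw [Finset.sum_comm]
    refine Finset.sum_congr rfl fun l _ => ?_
    rw [CStarMatrix.mul_apply, map_sum]
    ext1 ξ
    simp
  map_star' a := by
    rw [star_sum, Finset.sum_comm]
    refine Finset.sum_congr rfl fun j _ => ?_
    rw [star_sum]
    refine Finset.sum_congr rfl fun i _ => ?_
    rw [CStarMatrix.star_apply, map_star]
    simp only [ContinuousLinearMap.star_eq_adjoint, ContinuousLinearMap.adjoint_comp, incl,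
      ContinuousLinearMap.adjoint_adjoint, ContinuousLinearMap.comp_assoc]

variable (hf : ∀ i j x y, f i x = f j y → i = j) {A : Type*} [NonUnitalRing A] [StarRing A]
    [Module ℂ A] (ψ : A →⋆ₙₐ[ℂ] (EllTwo Y →L[ℂ] EllTwo Y))

theorem blockHom_apply (a : CStarMatrix m m A) :
    blockHom f hf ψ a = ∑ i, ∑ j, incl (f i) ∘L ψ (a i j) ∘L restrict (f j) := rfl

theorem restrict_blockHom_incl (a : CStarMatrix m m A) (i j : m) :
    restrict (f i) ∘L blockHom f hf ψ a ∘L incl (f j) = ψ (a i j) := by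
  classical
  ext1 ξ
  have h1 (i k η) : restrict (f i) (incl (f k) η) = if i = k then η else 0 := by
    split_ifs with h
    · subst h; exact DFunLike.congr_fun (restrict_comp_incl (f i)) η
    · exact DFunLike.congr_fun (restrict_comp_incl_of_ne f hf h) η
  simp only [blockHom_apply, ContinuousLinearMap.comp_apply, sum_apply,
    map_sum, h1, apply_ite, map_zero, Finset.sum_ite_eq, Finset.sum_ite_eq', Finset.mem_univ,
    if_true]

theorem blockHom_injective (hψ : Function.Injective ψ) :
    Function.Injective (blockHom f hf ψ) := by
  intro a b hab
  refine CStarMatrix.ext fun i j => hψ ?_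
  rw [← restrict_blockHom_incl f hf ψ a, hab, restrict_blockHom_incl]

end blockHom

/-! ### Compact operators over `C*_r H` -/

variable {X : Type u} {H : Type v} [Group H]

variable (X H) in
/-- Matrices over `C*_r H` with finitely many entries, as operators on `ℓ²(X × H)`. -/
def finiteMatrices : Submodule ℂ (EllTwo (X × H) →L[ℂ] EllTwo (X × H)) :=
  Submodule.span ℂ {T | ∃ x y, ∃ b ∈ ReducedCStar H, T = matUnit x y b}

variable (X H) in
/-- The compact operators of the Hilbert `C*_r H`-module with basis `X`, as operators on
`ℓ²(X × H)`. -/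
def compactOps : Submodule ℂ (EllTwo (X × H) →L[ℂ] EllTwo (X × H)) :=
  (finiteMatrices X H).topologicalClosure

theorem matUnit_mem_finiteMatrices (x y : X) {b : EllTwo H →L[ℂ] EllTwo H}
    (hb : b ∈ ReducedCStar H) : matUnit x y b ∈ finiteMatrices X H :=
  Submodule.subset_span ⟨x, y, b, hb, rfl⟩

theorem star_mem_finiteMatrices {T : EllTwo (X × H) →L[ℂ] EllTwo (X × H)}
    (hT : T ∈ finiteMatrices X H) : star T ∈ finiteMatrices X H := by
  induction hT using Submodule.span_induction with
  | mem T hT =>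
    obtain ⟨x, y, b, hb, rfl⟩ := hT
    rw [star_matUnit]
    exact matUnit_mem_finiteMatrices y x (star_mem hb)
  | zero => simp
  | add S T _ _ hS hT => rw [star_add]; exact add_mem hS hT
  | smul c T _ hT => rw [star_smul]; exact Submodule.smul_mem _ _ hT

theorem isClosed_compactOps :
    IsClosed (compactOps X H : Set (EllTwo (X × H) →L[ℂ] EllTwo (X × H))) :=
  Submodule.isClosed_topologicalClosure _

theorem finiteMatrices_le_compactOps : finiteMatrices X H ≤ compactOps X H :=
  Submodule.le_topologicalClosure _

/-- A property of operators that holds on a closed subspace holds on all compact operators if it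
holds for the matrix units. -/
theorem compactOps_le {S : Submodule ℂ (EllTwo (X × H) →L[ℂ] EllTwo (X × H))}
    (hS : IsClosed (S : Set (EllTwo (X × H) →L[ℂ] EllTwo (X × H))))
    (h : ∀ x y, ∀ b ∈ ReducedCStar H, matUnit x y b ∈ S) : compactOps X H ≤ S := by
  refine Submodule.topologicalClosure_minimal _ (Submodule.span_le.2 ?_) hS
  rintro _ ⟨x, y, b, hb, rfl⟩
  exact h x y b hb

variable (X H) in
/-- The operators that multiply the compact operators into themselves from both sides. -/
def multipliers : Submodule ℂ (EllTwo (X × H) →L[ℂ] EllTwo (X × H)) where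
  carrier := {T | ∀ K ∈ compactOps X H, T * K ∈ compactOps X H ∧ K * T ∈ compactOps X H}
  add_mem' hS hT K hK := by
    rw [add_mul, mul_add]
    exact ⟨add_mem (hS K hK).1 (hT K hK).1, add_mem (hS K hK).2 (hT K hK).2⟩
  zero_mem' K hK := by simp
  smul_mem' c T hT K hK := by
    rw [smul_mul_assoc, mul_smul_comm]
    exact ⟨Submodule.smul_mem _ _ (hT K hK).1, Submodule.smul_mem _ _ (hT K hK).2⟩

theorem isClosed_multipliers :
    IsClosed (multipliers X H : Set (EllTwo (X × H) →L[ℂ] EllTwo (X × H))) := by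
  have : (multipliers X H : Set (EllTwo (X × H) →L[ℂ] EllTwo (X × H))) =
      ⋂ K ∈ compactOps X H, {T | T * K ∈ compactOps X H} ∩ {T | K * T ∈ compactOps X H} := by
    ext T
    simp [multipliers]
  rw [this]
  refine isClosed_biInter fun K _ => ?_
  exact (isClosed_compactOps.preimage (continuous_mul_const K)).inter
    (isClosed_compactOps.preimage (continuous_const_mul K))

theorem mul_mem_multipliers {S T : EllTwo (X × H) →L[ℂ] EllTwo (X × H)}
    (hS : S ∈ multipliers X H) (hT : T ∈ multipliers X H) : S * T ∈ multipliers X H := by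
  intro K hK
  rw [mul_assoc, ← mul_assoc K]
  exact ⟨(hS _ (hT K hK).1).1, (hT _ (hS K hK).2).2⟩

theorem one_mem_multipliers : (1 : EllTwo (X × H) →L[ℂ] EllTwo (X × H)) ∈ multipliers X H := by
  intro K hK
  simpa using hK

/-- An operator is a multiplier if its columns and the columns of its adjoint have finitely
many entries, all from `C*_r H`. -/
theorem mem_multipliers {T : EllTwo (X × H) →L[ℂ] EllTwo (X × H)}
    (h : ∀ x, T * layerProj x ∈ finiteMatrices X H)
    (h' : ∀ x, star T * layerProj x ∈ finiteMatrices X H) : T ∈ multipliers X H := by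
  have key {T : EllTwo (X × H) →L[ℂ] EllTwo (X × H)}
      (h : ∀ x, T * layerProj x ∈ finiteMatrices X H) {x y : X} {b : EllTwo H →L[ℂ] EllTwo H}
      (hb : b ∈ ReducedCStar H) : T * matUnit x y b ∈ finiteMatrices X H := by
    have e : T * matUnit x y b = T * layerProj x * matUnit x y b := by
      rw [mul_assoc, layerProj, matUnit_mul_self, one_mul]
    rw [e]
    have hx := h x
    generalize T * layerProj x = S at hx
    induction hx using Submodule.span_induction with
    | mem S hS =>
      obtain ⟨x', y', c, hc, rfl⟩ := hS
      by_cases hy : y' = x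
      · subst hy
        rw [matUnit_mul_self]
        exact matUnit_mem_finiteMatrices _ _ (mul_mem hc hb)
      · rw [matUnit_mul_of_ne _ _ hy]
        exact zero_mem _
    | zero => simp
    | add S S' _ _ hS hS' => rw [add_mul]; exact add_mem hS hS'
    | smul c S _ hS => rw [smul_mul_assoc]; exact Submodule.smul_mem _ _ hS
  intro K hK
  constructor
  · have hle : compactOps X H ≤ (compactOps X H).comap (LinearMap.mulLeft ℂ T) := by
      refine compactOps_le ?_ fun x y b hb => ?_
      · exact isClosed_compactOps.preimage (continuous_const_mul T)
      · rw [Submodule.mem_comap, LinearMap.mulLeft_apply]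
        exact finiteMatrices_le_compactOps (key h hb)
    have hmem := hle hK
    rwa [Submodule.mem_comap, LinearMap.mulLeft_apply] at hmem
  · have hle : compactOps X H ≤ (compactOps X H).comap (LinearMap.mulRight ℂ T) := by
      refine compactOps_le ?_ fun x y b hb => ?_
      · exact isClosed_compactOps.preimage (continuous_mul_const T)
      · rw [Submodule.mem_comap, LinearMap.mulRight_apply]
        have := star_mem_finiteMatrices (key h' (x := y) (y := x) (star_mem hb))
        rw [star_mul, star_star, star_matUnit, star_star] at this
        exact finiteMatrices_le_compactOps this
    have hmem := hle hK
    rwa [Submodule.mem_comap, LinearMap.mulRight_apply] at hmem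

end EllTwo

/-! ### The class of a pair of projections with compact difference -/

/-- Let `p` be an idempotent below `e`, and let the symmetry `σ` exchange `e` and `1 - e`. With
`q = p + σ p σ`, the element `w = q + σ (1 - q)` is a symmetry that conjugates
`p + (1 - e) - σ p σ` to `e`. -/
theorem swap_conjugation {R : Type*} [Ring R] {e σ p : R} (hσ : σ * σ = 1)
    (hσe : σ * e = σ - e * σ) (hp : p * p = p) (hep : e * p = p) (hpe : p * e = p) :
    (p + σ * p * σ + σ * (1 - (p + σ * p * σ))) * (p + σ * p * σ + σ * (1 - (p + σ * p * σ))) = 1 ∧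
    (p + σ * p * σ + σ * (1 - (p + σ * p * σ))) * (p + (1 - e) - σ * p * σ) *
      (p + σ * p * σ + σ * (1 - (p + σ * p * σ))) = e := by
  have r2 (x : R) : σ * (σ * x) = x := by rw [← mul_assoc, hσ, one_mul]
  have r3 (x : R) : σ * (e * x) = σ * x - e * (σ * x) := by
    rw [← mul_assoc, hσe, sub_mul, mul_assoc]
  have r4 (x : R) : p * (p * x) = p * x := by rw [← mul_assoc, hp]
  have r5 (x : R) : e * (p * x) = p * x := by rw [← mul_assoc, hep]
  have r6 (x : R) : p * (e * x) = p * x := by rw [← mul_assoc, hpe]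
  have s1 : e * (σ * p) = 0 := by
    have := r3 p
    rw [hep] at this
    exact sub_eq_self.1 this.symm
  have s1' (x : R) : e * (σ * (p * x)) = 0 := by
    rw [← mul_assoc σ, ← mul_assoc, s1, zero_mul]
  have s2 : p * (σ * p) = 0 := by rw [← hpe, mul_assoc, hpe, s1, mul_zero]
  have s2' (x : R) : p * (σ * (p * x)) = 0 := by
    rw [← mul_assoc σ, ← mul_assoc, s2, zero_mul]
  constructor
  · simp only [mul_add, add_mul, mul_sub, sub_mul, mul_one, mul_assoc, hσ, hp, r2, r4,
      s2, s2', mul_zero]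
    abel
  · simp only [mul_add, add_mul, mul_sub, sub_mul, mul_one, mul_assoc, hσ, hp, r2, r4,
      s2, s2', mul_zero, hσe, hep, hpe, r5, r6, s1, s1']
    abel

instance ReducedCStar.isClosed_coe (G : Type u) [Group G] :
    IsClosed (ReducedCStar G : Set (EllTwo G →L[ℂ] EllTwo G)) :=
  StarSubalgebra.isClosed_topologicalClosure _

namespace EllTwo

variable {X : Type u} {H : Type v} [Group H]

section corner

variable {k : ℕ} (c : Fin k ↪ X)

variable (H) in
/-- Matrices over `C*_r H` as operators on `ℓ²(X × H)`, for an enumeration `c` of a finite subset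
of `X`. -/
def cornerHom : CStarMatrix (Fin k) (Fin k) (ReducedCStar H) →⋆ₙₐ[ℂ]
    (EllTwo (X × H) →L[ℂ] EllTwo (X × H)) :=
  blockHom (fun i => Function.Embedding.sectR (c i) H)
    (fun _ _ _ _ h => c.injective (congrArg Prod.fst h))
    (ReducedCStar H).subtype.toNonUnitalStarAlgHom

theorem cornerHom_apply (a : CStarMatrix (Fin k) (Fin k) (ReducedCStar H)) :
    cornerHom H c a = ∑ i, ∑ j, matUnit (c i) (c j) (a i j : EllTwo H →L[ℂ] EllTwo H) := rfl

theorem cornerHom_injective : Function.Injective (cornerHom H c) :=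
  blockHom_injective _ _ _ Subtype.val_injective

theorem cornerHom_one : cornerHom H c 1 = ∑ i, layerProj (c i) := by
  rw [cornerHom_apply]
  refine Finset.sum_congr rfl fun i _ => ?_
  rw [Finset.sum_eq_single i]
  · rw [CStarMatrix.one_apply_eq]
    rfl
  · intro j _ hj
    rw [CStarMatrix.one_apply_ne hj.symm]
    ext1 ξ
    simp [matUnit]
  · simp

theorem matUnit_mem_range_cornerHom (i j : Fin k) {b : EllTwo H →L[ℂ] EllTwo H}
    (hb : b ∈ ReducedCStar H) : ∃ a, cornerHom H c a = matUnit (c i) (c j) b := by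
  refine ⟨CStarMatrix.ofMatrix (Matrix.single i j ⟨b, hb⟩), ?_⟩
  rw [cornerHom_apply, Finset.sum_eq_single i, Finset.sum_eq_single j]
  · simp
  · intro j' _ hj'
    ext1 ξ
    simp [matUnit, hj'.symm]
  · simp
  · intro i' _ hi'
    refine Finset.sum_eq_zero fun j' _ => ?_
    ext1 ξ
    simp [matUnit, hi'.symm]
  · simp

theorem cornerHom_mem_equivariant (a : CStarMatrix (Fin k) (Fin k) (ReducedCStar H)) :
    cornerHom H c a ∈ equivariant X H := by
  rw [cornerHom_apply]
  exact sum_mem fun i _ => sum_mem fun j _ => matUnit_mem_equivariant _ _ (a i j).2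

theorem isTraceClass_cornerHom (a : CStarMatrix (Fin k) (Fin k) (ReducedCStar H)) :
    IsTraceClass (cornerHom H c a) := by
  refine IsTraceClass.of_mul_sum_layerProj (F := Finset.univ.map c)
    (cornerHom_mem_equivariant c a) ?_
  rw [Finset.sum_map, ← cornerHom_one, ← map_mul, mul_one]

theorem diag_matUnit_self (x : X) (b : EllTwo H →L[ℂ] EllTwo H) :
    diag x (matUnit x x b) = inner ℂ (delta 1) (b (delta 1)) := by
  rw [diag_apply, ← layer_delta, ← adjoint_slice, ContinuousLinearMap.adjoint_inner_left]
  simp only [matUnit, adjoint_slice, layer_delta, ContinuousLinearMap.comp_apply,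
    slice_delta_self]
  have h (η) : (slice x : EllTwo (X × H) →L[ℂ] EllTwo H) (layer x η) = η :=
    DFunLike.congr_fun (slice_comp_layer_self x) η
  rw [h]

theorem diag_matUnit_of_ne {x y z : X} (h : ¬ (y = x ∧ z = x)) (b : EllTwo H →L[ℂ] EllTwo H) :
    diag x (matUnit y z b) = 0 := by
  rw [diag_apply]
  by_cases hz : z = x
  · have hy : y ≠ x := fun hy => h ⟨hy, hz⟩
    simp only [matUnit, ContinuousLinearMap.comp_apply]
    rw [← adjoint_slice, ContinuousLinearMap.adjoint_inner_right, slice_delta_of_ne hy,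
      inner_zero_left]
  · simp [matUnit, slice_delta_of_ne hz]

theorem tsum_diag_cornerHom (a : CStarMatrix (Fin k) (Fin k) (ReducedCStar H)) :
    ∑' x, diag x (cornerHom H c a) = ∑ i, canonicalTrace H (a i i) := by
  have h (x : X) (hx : x ∉ Finset.univ.map c) : diag x (cornerHom H c a) = 0 := by
    simp only [cornerHom_apply, map_sum]
    refine Finset.sum_eq_zero fun i _ => Finset.sum_eq_zero fun j _ => ?_
    refine diag_matUnit_of_ne (fun h => hx ?_) _
    simp [← h.1]
  rw [tsum_eq_sum h, Finset.sum_map]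
  refine Finset.sum_congr rfl fun i _ => ?_
  simp only [cornerHom_apply, map_sum]
  rw [Finset.sum_eq_single i, Finset.sum_eq_single i]
  · exact diag_matUnit_self _ _
  · intro j _ hj
    exact diag_matUnit_of_ne (fun h => hj (c.injective h.2)) _
  · simp
  · intro j _ hj
    exact Finset.sum_eq_zero fun l _ => diag_matUnit_of_ne (fun h => hj (c.injective h.1)) _
  · simp

end corner

theorem exists_finset_of_mem_finiteMatrices {T : EllTwo (X × H) →L[ℂ] EllTwo (X × H)}
    (hT : T ∈ finiteMatrices X H) : ∃ F : Finset X, ∀ (k : ℕ) (c : Fin k ↪ X),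
      (∀ x ∈ F, ∃ i, c i = x) → ∃ a, cornerHom H c a = T := by
  classical
  induction hT using Submodule.span_induction with
  | mem T hT =>
    obtain ⟨x, y, b, hb, rfl⟩ := hT
    refine ⟨{x, y}, fun k c hc => ?_⟩
    obtain ⟨i, rfl⟩ := hc x (by simp)
    obtain ⟨j, rfl⟩ := hc y (by simp)
    exact matUnit_mem_range_cornerHom c i j hb
  | zero => exact ⟨∅, fun k c _ => ⟨0, map_zero _⟩⟩
  | add S T _ _ hS hT =>
    obtain ⟨F, hF⟩ := hS
    obtain ⟨F', hF'⟩ := hT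
    refine ⟨F ∪ F', fun k c hc => ?_⟩
    obtain ⟨a, rfl⟩ := hF k c fun x hx => hc x (Finset.mem_union_left _ hx)
    obtain ⟨b, rfl⟩ := hF' k c fun x hx => hc x (Finset.mem_union_right _ hx)
    exact ⟨a + b, map_add _ _ _⟩
  | smul r T _ hT =>
    obtain ⟨F, hF⟩ := hT
    refine ⟨F, fun k c hc => ?_⟩
    obtain ⟨a, rfl⟩ := hF k c hc
    exact ⟨r • a, map_smul _ _ _⟩

theorem exists_traceKZeroComplex_eq_sum {H : Type v} [Group H] {k : ℕ}
    {a : CStarMatrix (Fin k) (Fin k) (ReducedCStar H)} (ha : IsStarProjection a) :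
    ∃ y, traceKZeroComplex H y = ∑ i, canonicalTrace H (a i i) :=
  ⟨OperatorKZero.mk ⟨k, CStarMatrix.ofMatrix.symm a,
    ⟨ha.isIdempotentElem, ha.isSelfAdjoint⟩⟩, OperatorKZero.traceHom_mk _ _ _⟩

/-- A projection `R` of a C*-algebra `B` that is close to `e + Φ a`, where `e` commutes with the
unit of the subalgebra `Φ A`, is close to the sum of a projection of `Φ A` and of the part of `e`
orthogonal to `Φ A`. -/
theorem exists_isStarProjection_corner {A B : Type*} [CStarAlgebra A] [CStarAlgebra B]
    (Φ : A →⋆ₙₐ[ℂ] B) (hinj : Function.Injective Φ) {a b : A} {e R : B}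
    (he : IsStarProjection e) (hR : IsStarProjection R) (hcomm : Φ 1 * e = e * Φ 1)
    (hb : Φ b = e * Φ 1) (ha : star (Φ a) = Φ a) (haR : ‖(e + Φ a) - R‖ ≤ 1 / 400) :
    IsStarProjection b ∧ ∃ s, IsStarProjection s ∧ IsStarProjection (Φ s + (e - Φ b)) ∧
      ‖Φ s + (e - Φ b) - R‖ < 1 / 2 := by
  have hee : e * e = e := he.isIdempotentElem
  have hes : star e = e := he.isSelfAdjoint
  have h11 : Φ 1 * Φ 1 = Φ 1 := by rw [← map_mul, mul_one]
  have hΦ1 (z) : Φ 1 * Φ z = Φ z := by rw [← map_mul, one_mul]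
  have hΦ1' (z) : Φ z * Φ 1 = Φ z := by rw [← map_mul, mul_one]
  have hs1 : star (Φ 1) = Φ 1 := by rw [← map_star, star_one]
  have hbproj : IsStarProjection b := by
    refine ⟨hinj ?_, hinj ?_⟩
    · rw [map_mul, hb, mul_assoc, ← mul_assoc (Φ 1), hcomm, mul_assoc e, h11, ← mul_assoc, hee]
    · rw [map_star, hb, star_mul, hes, hs1, hcomm]
  refine ⟨hbproj, ?_⟩
  -- `f` is the part of `e` orthogonal to `Φ A`; Newton iteration is applied to `e + Φ a - f`,
  -- which lies in `Φ A`
  obtain ⟨f, hf⟩ : ∃ f, f = e - Φ b := ⟨_, rfl⟩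
  rw [← hf]
  rw [hb] at hf
  have hΦf (z) : Φ z * f = 0 := by
    rw [hf, mul_sub, ← hcomm, ← mul_assoc, hΦ1', sub_self]
  have hfΦ (z) : f * Φ z = 0 := by
    rw [hf, sub_mul, mul_assoc, hΦ1, sub_self]
  have hff : f * f = f := by
    have : e * f = f := by rw [hf, mul_sub, ← mul_assoc, hee]
    conv_lhs => enter [1]; rw [hf, ← hb]
    rw [sub_mul, this, hΦf, sub_zero]
  have hfs : star f = f := by rw [hf, star_sub, star_mul, hes, hs1, hcomm]
  have hr : Φ (a + b) = e + Φ a - f := by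
    rw [map_add, hb, hf]; abel
  obtain ⟨n1, n2⟩ := norm_mul_self_sub_le hR.isIdempotentElem (IsStarProjection.norm_le R hR)
    (by norm_num) haR
  have hnorm (z) : ‖Φ z‖ = ‖z‖ := NonUnitalStarAlgHom.norm_map Φ hinj z
  have m1 : ‖a + b‖ ≤ 2 := by
    have : Φ (a + b) = (e + Φ a) * Φ 1 := by
      rw [← hΦ1', hr, sub_mul, hfΦ, sub_zero]
    rw [← hnorm, this]
    have h1 : ‖Φ 1‖ ≤ 1 := IsStarProjection.norm_le _ ⟨h11, hs1⟩
    exact (norm_mul_le_of_le n1 h1).trans (by norm_num)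
  have m2 : ‖(a + b) * (a + b) - (a + b)‖ ≤ 4 * (1 / 400) := by
    have : Φ ((a + b) * (a + b) - (a + b)) = (e + Φ a) * (e + Φ a) - (e + Φ a) := by
      have h1 : e + Φ a = Φ (a + b) + f := by rw [hr]; abel
      rw [h1, map_sub, map_mul]
      simp only [mul_add, add_mul, hΦf, hfΦ, hff]
      abel
    rw [← hnorm, this]
    exact n2
  have m3 : star (a + b) = a + b := by
    refine hinj ?_
    rw [map_star, hr, star_sub, star_add, hes, ha, hfs]
  obtain ⟨s, -, hsproj, hsnear⟩ :=
    exists_isStarProjection_near (by norm_num) (by norm_num) m1 m2 m3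
  refine ⟨s, hsproj, ⟨?_, ?_⟩, ?_⟩
  · have hss : s * s = s := hsproj.isIdempotentElem
    change (Φ s + f) * (Φ s + f) = Φ s + f
    simp only [mul_add, add_mul, hΦf, hfΦ, hff, ← map_mul, hss]
    abel
  · change star (Φ s + f) = Φ s + f
    rw [star_add, ← map_star, hfs, hsproj.isSelfAdjoint.star_eq]
  · have : Φ s + f - R = Φ (s - (a + b)) + ((e + Φ a) - R) := by
      rw [map_sub, hr]; abel
    rw [this]
    refine (norm_add_le _ _).trans_lt ?_
    rw [hnorm]
    linarith

theorem exists_mem_finiteMatrices_near {K : EllTwo (X × H) →L[ℂ] EllTwo (X × H)}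
    (hK : K ∈ compactOps X H) (hKs : star K = K) {ε : ℝ} (hε : 0 < ε) :
    ∃ T ∈ finiteMatrices X H, star T = T ∧ ‖T - K‖ ≤ ε := by
  obtain ⟨T, hT, hTK⟩ := Metric.mem_closure_iff.1 hK ε hε
  rw [dist_comm, dist_eq_norm] at hTK
  refine ⟨(1 / 2 : ℂ) • (T + star T), Submodule.smul_mem _ _
    (add_mem hT (star_mem_finiteMatrices hT)), ?_, ?_⟩
  · rw [star_smul, star_add, star_star, add_comm]
    simp
  · have hs : ‖star T - K‖ ≤ ε := by
      have : star T - K = star (T - K) := by rw [star_sub, hKs]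
      rw [this, show ‖star (T - K)‖ = ‖T - K‖ from norm_star (T - K)]
      exact hTK.le
    have e1 : (1 / 2 : ℂ) • (T + star T) - K = (1 / 2 : ℂ) • ((T - K) + (star T - K)) := by
      module
    rw [e1, norm_smul]
    have := norm_add_le_of_le hTK.le hs
    norm_num at this ⊢
    linarith

/-- Let `R` be a projection that differs from the diagonal projection `e` by a compact operator of
trace class. Then `Tr (R - e)` is the trace of a class in `K₀(C*_r H)`: up to a small perturbation,
`R` is the sum of `e` outside a finite subset of `X` and of a projection in a matrix algebra over
`C*_r H`. -/
theorem exists_traceKZeroComplex_eq_of_compact {e R : EllTwo (X × H) →L[ℂ] EllTwo (X × H)}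
    (he : IsStarProjection e) (hR : IsStarProjection R)
    (heN : e ∈ equivariant X H) (hRN : R ∈ equivariant X H)
    (hediag : ∀ x, e * layerProj x = layerProj x ∨ e * layerProj x = 0)
    (htr : IsTraceClass (R - e)) (hcpt : R - e ∈ compactOps X H) :
    ∃ y, traceKZeroComplex H y = ∑' x, diag x (R - e) := by
  let := CStarAlgebra.spectralOrder (ReducedCStar H)
  have := CStarAlgebra.spectralOrderedRing (ReducedCStar H)
  have hes : star e = e := he.isSelfAdjoint
  have hRs : star R = R := hR.isSelfAdjoint
  obtain ⟨T, hT, hTs, hTR⟩ := exists_mem_finiteMatrices_near hcpt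
    (by rw [star_sub, hRs, hes]) (ε := 1 / 400) (by norm_num)
  obtain ⟨F, hF⟩ := exists_finset_of_mem_finiteMatrices hT
  let c : Fin F.card ↪ X := F.equivFin.symm.toEmbedding.trans (Function.Embedding.subtype _)
  have hc (x : X) (hx : x ∈ F) : ∃ i, c i = x := ⟨F.equivFin ⟨x, hx⟩, by simp [c]⟩
  obtain ⟨a, ha⟩ := hF _ c hc
  set Φ := cornerHom H c with hΦ
  have hinj : Function.Injective Φ := cornerHom_injective c
  -- the restriction of `e` to the finite set
  have hcomm1 (x : X) : layerProj x * e = e * layerProj x := by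
    have h1 : star (e * layerProj x) = layerProj x * e := by
      rw [star_mul, hes, star_layerProj]
    rw [← h1]
    rcases hediag x with h | h
    · rw [h, star_layerProj]
    · rw [h, star_zero]
  have hcomm : Φ 1 * e = e * Φ 1 := by
    rw [hΦ, cornerHom_one, Finset.sum_mul, Finset.mul_sum]
    exact Finset.sum_congr rfl fun i _ => hcomm1 _
  obtain ⟨b, hb⟩ : ∃ b, Φ b = e * Φ 1 := by
    have h1 (i) : ∃ b, Φ b = e * layerProj (c i) := by
      rcases hediag (c i) with h | h
      · rw [h]
        exact matUnit_mem_range_cornerHom c i i (one_mem _)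
      · exact ⟨0, by rw [h, map_zero]⟩
    choose b hb using h1
    refine ⟨∑ i, b i, ?_⟩
    rw [map_sum, hΦ, cornerHom_one, Finset.mul_sum]
    exact Finset.sum_congr rfl fun i _ => hb i
  obtain ⟨hbproj, s, hsproj, hSproj, hnear⟩ := exists_isStarProjection_corner Φ hinj (a := a)
    he hR hcomm hb (by rw [ha, hTs]) (by
      rw [ha, show e + T - R = T - (R - e) by abel]
      exact hTR)
  have hfN : e - Φ b ∈ equivariant X H :=
    sub_mem heN (cornerHom_mem_equivariant c b)
  have hdiff : Φ s + (e - Φ b) - R = Φ s - Φ b - (R - e) := by abel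
  have htr1 : IsTraceClass (Φ s + (e - Φ b) - R) := by
    rw [hdiff]
    exact ((isTraceClass_cornerHom c s).sub (isTraceClass_cornerHom c b)).sub htr
  have hzero := tsum_diag_sub_eq_zero (add_mem (cornerHom_mem_equivariant c s) hfN) hRN hSproj hR
    htr1 hnear
  rw [hdiff, IsTraceClass.tsum_sub ((isTraceClass_cornerHom c s).sub (isTraceClass_cornerHom c b))
    htr, IsTraceClass.tsum_sub (isTraceClass_cornerHom c s) (isTraceClass_cornerHom c b),
    tsum_diag_cornerHom, tsum_diag_cornerHom, sub_eq_zero] at hzero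
  obtain ⟨y, hy⟩ := exists_traceKZeroComplex_eq_sum hsproj
  obtain ⟨y', hy'⟩ := exists_traceKZeroComplex_eq_sum hbproj
  exact ⟨y - y', by rw [map_sub, hy, hy', hzero]⟩

/-- The index of a pair of projections `P`, `P'` below a diagonal projection `e` whose complement
is isomorphic to `e` through the symmetry `σ`: if `P - P'` is compact and of trace class, then its
trace comes from `K₀(C*_r H)`. -/
theorem exists_traceKZeroComplex_eq_of_pair {e σ P P' : EllTwo (X × H) →L[ℂ] EllTwo (X × H)}
    (he : IsStarProjection e) (hP : IsStarProjection P) (hP' : IsStarProjection P')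
    (hσ : σ * σ = 1) (hσs : star σ = σ) (hσe : σ * e = σ - e * σ)
    (heP : e * P = P) (heP' : e * P' = P')
    (heN : e ∈ equivariant X H) (hσN : σ ∈ equivariant X H) (hPN : P ∈ equivariant X H)
    (hPN' : P' ∈ equivariant X H)
    (hediag : ∀ x, e * layerProj x = layerProj x ∨ e * layerProj x = 0)
    (hσM : σ ∈ multipliers X H) (hPM' : P' ∈ multipliers X H)
    (htr : IsTraceClass (P - P')) (hcpt : P - P' ∈ compactOps X H) :
    ∃ y, traceKZeroComplex H y = ∑' x, diag x (P - P') := by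
  have hee : e * e = e := he.isIdempotentElem
  have hes : star e = e := he.isSelfAdjoint
  have hPP : P * P = P := hP.isIdempotentElem
  have hPs : star P = P := hP.isSelfAdjoint
  have hPP' : P' * P' = P' := hP'.isIdempotentElem
  have hPs' : star P' = P' := hP'.isSelfAdjoint
  have hPe : P * e = P := by rw [← hPs, ← hes, ← star_mul, heP]
  have hPe' : P' * e = P' := by rw [← hPs', ← hes, ← star_mul, heP']
  obtain ⟨hww, hwe⟩ := swap_conjugation hσ hσe hPP' heP' hPe'
  -- the symmetry `w` conjugates `P' + (1 - e) - σ P' σ` to `e`; it takes the projection `Q`, in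
  -- which `P'` is replaced by `P`, to a projection that differs from `e` by `w (P - P') w`
  set p := P' + σ * P' * σ with hp
  set w := p + σ * (1 - p) with hw
  have hσp : σ * p = p * σ := by
    rw [hp, mul_add, add_mul, ← mul_assoc σ, ← mul_assoc σ, hσ, one_mul, mul_assoc (σ * P'), hσ,
      mul_one, add_comm]
  have hps : star p = p := by
    rw [hp, star_add, star_mul, star_mul, hσs, hPs', mul_assoc]
  have hws : star w = w := by
    rw [hw, star_add, star_mul, star_sub, star_one, hσs, hps, sub_mul, mul_sub, hσp, one_mul,
      mul_one]
  have hwN : w ∈ equivariant X H := by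
    have hpN : p ∈ equivariant X H := add_mem hPN' (mul_mem (mul_mem hσN hPN') hσN)
    exact add_mem hpN (mul_mem hσN (sub_mem (one_mem _) hpN))
  have hwM : w ∈ multipliers X H := by
    have hpM : p ∈ multipliers X H :=
      add_mem hPM' (mul_mem_multipliers (mul_mem_multipliers hσM hPM') hσM)
    exact add_mem hpM (mul_mem_multipliers hσM (sub_mem one_mem_multipliers hpM))
  set Q := P + (1 - e) - σ * P' * σ with hQ
  have hσ' (x : EllTwo (X × H) →L[ℂ] EllTwo (X × H)) : σ * (σ * x) = x := by
    rw [← mul_assoc, hσ, one_mul]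
  have heσ : e * (σ * P') = 0 := by
    have h1 : σ * (e * P') = σ * P' - e * (σ * P') := by
      rw [← mul_assoc, hσe, sub_mul, mul_assoc]
    rw [heP'] at h1
    exact sub_eq_self.1 h1.symm
  have hσe' : P' * (σ * e) = 0 := by
    rw [hσe, mul_sub, ← mul_assoc, hPe', sub_self]
  have hPσ : P * (σ * P') = 0 := by rw [← hPe, mul_assoc, heσ, mul_zero]
  have hσP : P' * (σ * P) = 0 := by rw [← heP, ← mul_assoc, ← mul_assoc, mul_assoc P', hσe', zero_mul]
  have hQQ : Q * Q = Q := by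
    have g1 (x : EllTwo (X × H) →L[ℂ] EllTwo (X × H)) : P' * (P' * x) = P' * x := by
      rw [← mul_assoc, hPP']
    have g2 (x : EllTwo (X × H) →L[ℂ] EllTwo (X × H)) : e * (σ * (P' * x)) = 0 := by
      rw [← mul_assoc σ, ← mul_assoc, heσ, zero_mul]
    have g3 (x : EllTwo (X × H) →L[ℂ] EllTwo (X × H)) : P * (σ * (P' * x)) = 0 := by
      rw [← mul_assoc σ, ← mul_assoc, hPσ, zero_mul]
    simp only [hQ, mul_add, add_mul, mul_sub, sub_mul, mul_one, one_mul, mul_assoc, hPP, hPe, heP,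
      hee, hσ', g1, g2, g3, hσe', hσP, mul_zero]
    abel
  have hQs : star Q = Q := by
    rw [hQ, star_sub, star_add, star_sub, star_mul, star_mul, star_one, hPs, hes, hσs, hPs',
      mul_assoc]
  set R := w * Q * w with hR
  have hRe : R - e = w * (P - P') * w := by
    rw [hR, hQ]
    nth_rewrite 2 [← hwe]
    rw [← sub_mul, ← mul_sub]
    congr 2
    abel
  have hRproj : IsStarProjection R := by
    refine ⟨?_, ?_⟩
    · change w * Q * w * (w * Q * w) = w * Q * w
      calc w * Q * w * (w * Q * w) = w * Q * (w * w) * Q * w := by simp only [mul_assoc]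
        _ = w * Q * w := by rw [hww, mul_one, mul_assoc w, hQQ]
    · change star (w * Q * w) = w * Q * w
      rw [star_mul, star_mul, hws, hQs, mul_assoc]
  have hRN : R ∈ equivariant X H := by
    have hQN : Q ∈ equivariant X H :=
      sub_mem (add_mem hPN (sub_mem (one_mem _) heN)) (mul_mem (mul_mem hσN hPN') hσN)
    exact mul_mem (mul_mem hwN hQN) hwN
  have htr' : IsTraceClass (R - e) := by
    rw [hRe]
    exact (htr.mul_left hwN).mul_right hwN
  have hcpt' : R - e ∈ compactOps X H := by
    rw [hRe]
    exact (hwM _ (hwM _ hcpt).1).2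
  obtain ⟨y, hy⟩ := exists_traceKZeroComplex_eq_of_compact he hRproj heN hRN hediag htr' hcpt'
  refine ⟨y, hy.trans ?_⟩
  rw [hRe, htr.cyclic w hwN w hwN, mul_assoc, hww, mul_one]

end EllTwo

/-! ### The vertices and the edges of a tree with a group action -/

namespace SimpleGraph.IsTree

variable {V : Type w} {T : SimpleGraph V}

/-- In a tree a vertex has at most one neighbour that is closer to the root. -/
theorem lower_neighbor_unique (hT : T.IsTree) {r v w w' : V} (h : T.Adj w v) (h' : T.Adj w' v)
    (hd : T.dist r v = T.dist r w + 1) (hd' : T.dist r v = T.dist r w' + 1) : w = w' := by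
  obtain ⟨p, hp⟩ := hT.connected.exists_walk_length_eq_dist r w
  obtain ⟨p', hp'⟩ := hT.connected.exists_walk_length_eq_dist r w'
  have h1 : (p.concat h).IsPath :=
    Walk.isPath_of_length_eq_dist _ (by rw [Walk.length_concat, hp, hd])
  have h2 : (p'.concat h').IsPath :=
    Walk.isPath_of_length_eq_dist _ (by rw [Walk.length_concat, hp', hd'])
  have h3 := (hT.isAcyclic.subsingleton_path r v).elim ⟨_, h1⟩ ⟨_, h2⟩
  have h4 := congrArg (fun q : T.Path r v => q.1.penultimate) h3
  simpa using h4

theorem exists_lower_neighbor (hT : T.IsTree) {r v : V} (h : v ≠ r) :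
    ∃ w, T.Adj w v ∧ T.dist r v = T.dist r w + 1 := by
  obtain ⟨p, hp⟩ := hT.connected.exists_walk_length_eq_dist v r
  cases p with
  | nil => exact absurd rfl h
  | @cons _ w _ hadj q =>
    refine ⟨w, hadj.symm, ?_⟩
    have h1 : T.dist w r ≤ q.length := dist_le q
    have h2 := hT.dist_eq_dist_add_one_of_adj r hadj
    rw [Walk.length_cons] at hp
    rw [dist_comm (u := r) (v := v), dist_comm (u := r) (v := w)] at h2 ⊢
    omega

theorem exists_far (hT : T.IsTree) (r : V) (e : T.edgeSet) :
    ∃ v w, T.Adj w v ∧ T.dist r v = T.dist r w + 1 ∧ (e : Sym2 V) = s(w, v) := by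
  obtain ⟨e, he⟩ := e
  induction e with
  | _ x y =>
    rw [mem_edgeSet] at he
    rcases hT.dist_eq_dist_add_one_of_adj r he with h | h
    · exact ⟨x, y, he.symm, h, Sym2.eq_swap⟩
    · exact ⟨y, x, he, h, rfl⟩

/-- The endpoint of the edge `e` that is farther from the root `r`. -/
def far (hT : T.IsTree) (r : V) (e : T.edgeSet) : V :=
  (hT.exists_far r e).choose

theorem far_spec (hT : T.IsTree) (r : V) (e : T.edgeSet) :
    ∃ w, T.Adj w (hT.far r e) ∧ T.dist r (hT.far r e) = T.dist r w + 1 ∧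
      (e : Sym2 V) = s(w, hT.far r e) :=
  (hT.exists_far r e).choose_spec

theorem far_eq (hT : T.IsTree) {r v w : V} {e : T.edgeSet} (he : (e : Sym2 V) = s(w, v))
    (h : T.dist r v = T.dist r w + 1) : hT.far r e = v := by
  obtain ⟨w', -, h1, h2⟩ := hT.far_spec r e
  rw [he, Sym2.eq_iff] at h2
  rcases h2 with ⟨-, h2⟩ | ⟨h2, h3⟩
  · exact h2.symm
  · rw [← h2, ← h3] at h1
    omega

theorem far_injective (hT : T.IsTree) (r : V) : Function.Injective (hT.far r) := by
  intro e e' h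
  obtain ⟨w, h1, h2, h3⟩ := hT.far_spec r e
  obtain ⟨w', h1', h2', h3'⟩ := hT.far_spec r e'
  rw [← h] at h1' h2' h3'
  apply Subtype.ext
  rw [h3, h3', hT.lower_neighbor_unique h1 h1' h2 h2']

theorem far_ne (hT : T.IsTree) (r : V) (e : T.edgeSet) : hT.far r e ≠ r := by
  obtain ⟨w, -, h, -⟩ := hT.far_spec r e
  intro h'
  rw [h', dist_self] at h
  omega

theorem exists_far_eq (hT : T.IsTree) {r v : V} (h : v ≠ r) : ∃ e, hT.far r e = v := by
  obtain ⟨w, h1, h2⟩ := hT.exists_lower_neighbor h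
  exact ⟨⟨s(w, v), h1⟩, hT.far_eq rfl h2⟩

/-- Moving the root across an edge changes the direction of no other edge. -/
theorem eq_of_far_ne (hT : T.IsTree) {r r' : V} (hr : T.Adj r r') {e : T.edgeSet}
    (h : hT.far r e ≠ hT.far r' e) : (e : Sym2 V) = s(r, r') := by
  obtain ⟨w, h1, h2, h3⟩ := hT.far_spec r e
  generalize hT.far r e = v at *
  have h4 : T.dist r' w = T.dist r' v + 1 := by
    rcases hT.dist_eq_dist_add_one_of_adj r' h1 with h4 | h4
    · exact h4
    · exact absurd (hT.far_eq h3 h4).symm h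
  have key (x : V) : T.dist r x ≤ T.dist r' x + 1 ∧ T.dist r' x ≤ T.dist r x + 1 := by
    have := hT.dist_eq_dist_add_one_of_adj x hr
    rw [dist_comm (u := x) (v := r), dist_comm (u := x) (v := r')] at this
    omega
  have hw := key w
  have hv := key v
  by_cases hrw : w = r
  · subst hrw
    have h5 : T.dist r' v = 0 := by
      rw [dist_self] at h2
      have := dist_eq_one_iff_adj.2 hr.symm
      omega
    rw [hT.connected.dist_eq_zero_iff] at h5
    rw [h3, h5]
  -- otherwise the parent of `w` for the root `r` would be its parent `v` for the root `r'`
  · obtain ⟨x, h5, h6⟩ := hT.exists_lower_neighbor hrw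
    have hx := key x
    have h7 : T.dist r' w = T.dist r' x + 1 := by
      rcases hT.dist_eq_dist_add_one_of_adj r' h5 with h7 | h7
      · omega
      · exact h7
    have := hT.lower_neighbor_unique h5 h1.symm h7 h4
    subst this
    omega

theorem finite_far_ne (hT : T.IsTree) (r r' : V) : {e | hT.far r e ≠ hT.far r' e}.Finite := by
  obtain ⟨p⟩ := hT.connected.preconnected r r'
  induction p with
  | nil => simp
  | @cons a b c hadj q ih =>
    refine (ih.union ((Set.finite_singleton (⟨s(a, b), hadj⟩ : T.edgeSet)))).subset ?_
    intro e he
    by_cases h : hT.far b e = hT.far c e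
    · right
      refine Subtype.ext (hT.eq_of_far_ne hadj ?_)
      rw [h]
      exact he
    · exact Or.inl h

end SimpleGraph.IsTree

namespace ActsOnTree

variable {G : Type u} [Group G] {V : Type w} [MulAction G V] {T : SimpleGraph V}

theorem dist_smul_le (h : ActsOnTree G T) (g : G) (x y : V) :
    T.dist (g • x) (g • y) ≤ T.dist x y := by
  obtain ⟨p, hp⟩ := h.isTree.connected.exists_walk_length_eq_dist x y
  let f : T →g T := ⟨fun z => g • z, fun {a b} hab => h.smul_adj g a b hab⟩
  rw [← hp, ← SimpleGraph.Walk.length_map f p]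
  exact SimpleGraph.dist_le (p.map f)

theorem dist_smul (h : ActsOnTree G T) (g : G) (x y : V) :
    T.dist (g • x) (g • y) = T.dist x y :=
  le_antisymm (h.dist_smul_le g x y) (by simpa using h.dist_smul_le g⁻¹ (g • x) (g • y))

/-- The action on the edges of the tree. -/
abbrev edgeAction (h : ActsOnTree G T) : MulAction G T.edgeSet where
  smul g e := ⟨Sym2.map (fun x => g • x) e, by
    obtain ⟨e, he⟩ := e
    induction e with
    | _ x y => exact h.smul_adj g x y he⟩
  one_smul e := by
    apply Subtype.ext
    change Sym2.map (fun x => (1 : G) • x) (e : Sym2 V) = e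
    simp
  mul_smul a b e := by
    apply Subtype.ext
    change Sym2.map (fun x => (a * b) • x) (e : Sym2 V) =
      Sym2.map (fun x => a • x) (Sym2.map (fun x => b • x) (e : Sym2 V))
    rw [Sym2.map_map]
    simp only [Function.comp_def, mul_smul]

/-- The combinatorial content of an action on a tree: once a root `r` is chosen, the edges are in
bijection with the vertices other than `r`, each element of the group respects this bijection up to
finitely many edges, and it fixes an endpoint of each edge that it fixes. -/
theorem exists_edges (h : ActsOnTree G T) :
    ∃ (r : V) (E : Type w) (_ : MulAction G E) (κ : E ↪ V), (∀ v, v ≠ r ↔ ∃ e, κ e = v) ∧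
      (∀ g : G, {e | κ (g • e) ≠ g • κ e}.Finite) ∧
      ∀ (g : G) (e : E), g • e = e → g • κ e = κ e := by
  have hT := h.isTree
  obtain ⟨r⟩ := hT.connected.nonempty
  let _ := h.edgeAction
  have hcoe (g : G) (e : T.edgeSet) :
      ((g • e : T.edgeSet) : Sym2 V) = Sym2.map (fun x => g • x) (e : Sym2 V) := rfl
  have hfar (g : G) (e : T.edgeSet) : hT.far (g • r) (g • e) = g • hT.far r e := by
    obtain ⟨w, -, h2, h3⟩ := hT.far_spec r e
    refine hT.far_eq (w := g • w) ?_ ?_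
    · rw [hcoe, h3]
      rfl
    · rw [h.dist_smul, h.dist_smul, h2]
  refine ⟨r, T.edgeSet, h.edgeAction, ⟨hT.far r, hT.far_injective r⟩, fun v => ?_, fun g => ?_,
    fun g e hge => ?_⟩
  · exact ⟨fun hv => hT.exists_far_eq hv, fun ⟨e, he⟩ => he ▸ hT.far_ne r e⟩
  · refine ((hT.finite_far_ne r (g • r)).preimage
      ((MulAction.injective (β := T.edgeSet) g).injOn)).subset ?_
    intro e he
    change hT.far r (g • e) ≠ hT.far (g • r) (g • e)
    rw [hfar]
    exact he
  · obtain ⟨w, h1, -, h3⟩ := hT.far_spec r e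
    have h4 : s(g • w, g • hT.far r e) = s(w, hT.far r e) := by
      have := hcoe g e
      rw [hge, h3] at this
      exact this.symm
    rcases Sym2.eq_iff.1 h4 with ⟨-, h5⟩ | h5
    · exact h5
    · exact absurd h5 (h.no_inversion g _ _ h1)

end ActsOnTree

/-! ### Operators that permute basis vectors -/

namespace EllTwo

section monomial

variable {X : Type u} {H : Type v}

/-- An operator that vanishes on all but finitely many layers is cut off by finitely many layer
projections. -/
theorem exists_mul_sum_layerProj {T : EllTwo (X × H) →L[ℂ] EllTwo (X × H)}
    (hT : {x | ∃ h, T (delta (x, h)) ≠ 0}.Finite) :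
    ∃ F : Finset X, T * ∑ x ∈ F, layerProj x = T := by
  classical
  refine ⟨hT.toFinset, clm_ext fun ⟨y, h⟩ => ?_⟩
  rw [mul_apply_eq_comp, sum_apply, map_sum]
  by_cases hy : y ∈ hT.toFinset
  · rw [Finset.sum_eq_single y, layerProj_delta_self]
    · intro x _ hx
      rw [layerProj_delta_of_ne hx, map_zero]
    · exact fun h => absurd hy h
  · rw [Finset.sum_eq_zero]
    · by_contra h0
      exact hy (by simpa using ⟨h, fun h1 => h0 h1.symm⟩)
    · intro x hx
      rw [layerProj_delta_of_ne (fun e : x = y => hy (e ▸ hx)), map_zero]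

variable [Group H]

/-- An operator on `ℓ²(X × H)` that on each layer `{x} × H` either vanishes or is the left
translation by an element of `H` to another layer. -/
def IsMonomial (T : EllTwo (X × H) →L[ℂ] EllTwo (X × H)) : Prop :=
  ∀ x, (∃ y k, ∀ h, T (delta (x, h)) = delta (y, k * h)) ∨ ∀ h, T (delta (x, h)) = 0

namespace IsMonomial

variable {T : EllTwo (X × H) →L[ℂ] EllTwo (X × H)}

theorem mem_equivariant (hT : IsMonomial T) : T ∈ equivariant X H := by
  refine mem_equivariant_of_delta fun x k h => ?_
  rcases hT x with ⟨y, l, hy⟩ | h0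
  · rw [hy, hy, shift_delta, mul_assoc]
  · rw [h0, h0, map_zero]

theorem mul_layerProj_mem (hT : IsMonomial T) (x : X) : T * layerProj x ∈ finiteMatrices X H := by
  rcases hT x with ⟨y, l, hy⟩ | h0
  · have : T * layerProj x = matUnit y x (leftRegular H l) := by
      refine clm_ext fun ⟨z, h⟩ => ?_
      by_cases hz : x = z
      · subst hz
        simp [layerProj_delta_self, hy, matUnit, slice_delta_self, leftRegular_delta, layer_delta]
      · simp [layerProj_delta_of_ne hz, matUnit, slice_delta_of_ne hz]
    rw [this]
    exact matUnit_mem_finiteMatrices _ _ (leftRegular_mem l)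
  · have : T * layerProj x = 0 := by
      refine clm_ext fun ⟨z, h⟩ => ?_
      by_cases hz : x = z
      · subst hz
        simp [layerProj_delta_self, h0]
      · simp [layerProj_delta_of_ne hz]
    rw [this]
    exact zero_mem _

theorem mem_multipliers (hT : IsMonomial T) (hT' : IsMonomial (star T)) : T ∈ multipliers X H :=
  EllTwo.mem_multipliers hT.mul_layerProj_mem hT'.mul_layerProj_mem

end IsMonomial

end monomial

/-! ### Corners of `ℓ²(X × H)` -/

section cornerMap

variable {V : Type w} {X : Type u} {H : Type v}

variable (H) in
/-- The embedding of `V × H` in `X × H` given by an embedding of `V` in `X`. -/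
def lift (f : V ↪ X) : V × H ↪ X × H := f.prodMap (Function.Embedding.refl H)

/-- The operator `T` on `ℓ²(V × H)`, regarded as an operator on `ℓ²(X × H)` from the image of
`g` to the image of `f`. -/
def cornerMap (f g : V ↪ X) :
    (EllTwo (V × H) →L[ℂ] EllTwo (V × H)) →L[ℂ] (EllTwo (X × H) →L[ℂ] EllTwo (X × H)) :=
  (ContinuousLinearMap.compL ℂ _ _ _ (incl (lift H f))).comp
    ((ContinuousLinearMap.compL ℂ _ _ _).flip (restrict (lift H g)))

theorem cornerMap_apply (f g : V ↪ X) (T : EllTwo (V × H) →L[ℂ] EllTwo (V × H)) :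
    cornerMap f g T = incl (lift H f) ∘L T ∘L restrict (lift H g) := rfl

theorem cornerMap_delta (f g : V ↪ X) (T : EllTwo (V × H) →L[ℂ] EllTwo (V × H)) (v : V) (h : H) :
    cornerMap f g T (delta (g v, h)) = incl (lift H f) (T (delta (v, h))) := by
  have : restrict (lift H g) (delta (g v, h)) = delta (v, h) := restrict_delta (lift H g) (v, h)
  rw [cornerMap_apply, ContinuousLinearMap.comp_apply, ContinuousLinearMap.comp_apply, this]

theorem cornerMap_delta_of_notMem (f : V ↪ X) {g : V ↪ X}
    (T : EllTwo (V × H) →L[ℂ] EllTwo (V × H)) {x : X} (hx : ∀ v, g v ≠ x) (h : H) :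
    cornerMap f g T (delta (x, h)) = 0 := by
  have : restrict (lift H g) (delta (x, h)) = 0 :=
    restrict_delta_of_notMem _ fun v hv => hx v.1 (congrArg Prod.fst hv)
  rw [cornerMap_apply, ContinuousLinearMap.comp_apply, ContinuousLinearMap.comp_apply, this,
    map_zero, map_zero]

theorem incl_lift_delta (f : V ↪ X) (v : V) (h : H) :
    incl (lift H f) (delta (v, h)) = delta (f v, h) := incl_delta _ _

theorem star_cornerMap (f g : V ↪ X) (T : EllTwo (V × H) →L[ℂ] EllTwo (V × H)) :
    star (cornerMap f g T) = cornerMap g f (star T) := by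
  simp only [cornerMap_apply, ContinuousLinearMap.star_eq_adjoint,
    ContinuousLinearMap.adjoint_comp, incl, ContinuousLinearMap.adjoint_adjoint,
    ContinuousLinearMap.comp_assoc]

variable [Group H]

theorem IsMonomial.cornerMap {T : EllTwo (V × H) →L[ℂ] EllTwo (V × H)} (hT : IsMonomial T)
    (f g : V ↪ X) : IsMonomial (cornerMap f g T) := by
  intro x
  by_cases hx : ∃ v, g v = x
  · obtain ⟨v, rfl⟩ := hx
    rcases hT v with ⟨y, k, h⟩ | h
    · exact Or.inl ⟨f y, k, fun l => by rw [cornerMap_delta, h, incl_lift_delta]⟩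
    · exact Or.inr fun l => by rw [cornerMap_delta, h, map_zero]
  · push Not at hx
    exact Or.inr fun l => cornerMap_delta_of_notMem f T hx l

theorem diag_cornerMap_self (f : V ↪ X) (T : EllTwo (V × H) →L[ℂ] EllTwo (V × H)) (v : V) :
    diag (f v) (cornerMap f f T) = diag v T := by
  have : restrict (lift H f) (delta (f v, 1)) = delta (v, 1) := restrict_delta (lift H f) (v, 1)
  rw [diag_apply, diag_apply, cornerMap_delta, incl, ContinuousLinearMap.adjoint_inner_right, this]

theorem diag_cornerMap_of_notMem {f : V ↪ X} (g : V ↪ X)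
    (T : EllTwo (V × H) →L[ℂ] EllTwo (V × H)) {x : X} (hx : ∀ v, f v ≠ x) :
    diag x (cornerMap f g T) = 0 := by
  have : restrict (lift H f) (delta (x, 1)) = 0 :=
    restrict_delta_of_notMem _ fun v hv => hx v.1 (congrArg Prod.fst hv)
  rw [diag_apply, cornerMap_apply, ContinuousLinearMap.comp_apply, incl,
    ContinuousLinearMap.adjoint_inner_right, this, inner_zero_left]

theorem diag_cornerMap_of_notMem' (f : V ↪ X) {g : V ↪ X}
    (T : EllTwo (V × H) →L[ℂ] EllTwo (V × H)) {x : X} (hx : ∀ v, g v ≠ x) :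
    diag x (cornerMap f g T) = 0 := by
  rw [diag_apply, cornerMap_delta_of_notMem f T hx, inner_zero_right]

end cornerMap

end EllTwo

/-! ### Finitely summable Fredholm modules -/

section FredholmPair

open EllTwo

variable {G : Type u} [Group G] {H : Type v} [Group H] {V : Type w}

/-- A pair of representations of the bounded operators of `ℓ²(G)` on `ℓ²(V × H)` that is a finitely
summable Fredholm module over the group ring: on a group element both are monomial and they differ
on finitely many layers only. Its character is the canonical trace of `G`, concentrated in the
layer `r`. -/
structure IsFredholmPair (ρ ρ' : (EllTwo G →L[ℂ] EllTwo G) →⋆ₙₐ[ℂ]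
    (EllTwo (V × H) →L[ℂ] EllTwo (V × H))) (r : V) : Prop where
  monomial (g : G) : IsMonomial (ρ (leftRegular G g))
  monomial' (g : G) : IsMonomial (ρ' (leftRegular G g))
  finite (g : G) :
    {v | ∃ h, (ρ (leftRegular G g) - ρ' (leftRegular G g)) (delta (v, h)) ≠ 0}.Finite
  diag_leftRegular (g : G) (v : V) :
    diag v (ρ (leftRegular G g) - ρ' (leftRegular G g)) =
      open scoped Classical in if v = r ∧ g = 1 then 1 else 0

/-- A star homomorphism of C*-algebras as a continuous linear map. -/
def NonUnitalStarAlgHom.toCLM {A B : Type*} [NonUnitalCStarAlgebra A] [NonUnitalCStarAlgebra B]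
    (ρ : A →⋆ₙₐ[ℂ] B) : A →L[ℂ] B :=
  LinearMap.mkContinuous { toFun := ρ, map_add' := map_add ρ, map_smul' := map_smul ρ } 1
    fun a => by simpa using NonUnitalStarAlgHom.norm_apply_le ρ a

namespace IsFredholmPair

variable {ρ ρ' : (EllTwo G →L[ℂ] EllTwo G) →⋆ₙₐ[ℂ] (EllTwo (V × H) →L[ℂ] EllTwo (V × H))} {r : V}
  {X : Type w} (f g : V ↪ X) {a : EllTwo G →L[ℂ] EllTwo G}

theorem cornerMap_mem_equivariant
    (hρ : ∀ g, IsMonomial (ρ (leftRegular G g))) (ha : a ∈ ReducedCStar G) :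
    cornerMap f g (ρ a) ∈ equivariant X H :=
  ReducedCStar.induction ((cornerMap f g).comp ρ.toCLM)
    (S := (equivariant X H).toSubalgebra.toSubmodule) isClosed_equivariant
    (fun k => ((hρ k).cornerMap f g).mem_equivariant) ha

theorem cornerMap_mem_multipliers
    (hρ : ∀ g, IsMonomial (ρ (leftRegular G g))) (ha : a ∈ ReducedCStar G) :
    cornerMap f g (ρ a) ∈ multipliers X H := by
  refine ReducedCStar.induction ((cornerMap f g).comp ρ.toCLM)
    (S := multipliers X H) isClosed_multipliers (fun k => ?_) ha
  refine ((hρ k).cornerMap f g).mem_multipliers ?_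
  rw [star_cornerMap, ← map_star, star_leftRegular]
  exact (hρ k⁻¹).cornerMap g f

theorem exists_mul_sum_layerProj (h : IsFredholmPair ρ ρ' r) (k : G) :
    ∃ F : Finset X, cornerMap f g (ρ (leftRegular G k) - ρ' (leftRegular G k)) *
      ∑ x ∈ F, layerProj x = cornerMap f g (ρ (leftRegular G k) - ρ' (leftRegular G k)) := by
  refine EllTwo.exists_mul_sum_layerProj (((h.finite k).image g).subset ?_)
  rintro x ⟨l, hl⟩
  by_cases hx : ∃ v, g v = x
  · obtain ⟨v, rfl⟩ := hx
    refine ⟨v, ⟨l, fun h0 => hl ?_⟩, rfl⟩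
    rw [cornerMap_delta, h0, map_zero]
  · push Not at hx
    exact absurd (cornerMap_delta_of_notMem f _ hx l) hl

theorem cornerMap_mem_compactOps (h : IsFredholmPair ρ ρ' r) (ha : a ∈ ReducedCStar G) :
    cornerMap f g (ρ a - ρ' a) ∈ compactOps X H := by
  refine ReducedCStar.induction ((cornerMap f g).comp (ρ.toCLM - ρ'.toCLM))
    (S := compactOps X H) isClosed_compactOps (fun k => finiteMatrices_le_compactOps ?_) ha
  change cornerMap f g (ρ (leftRegular G k) - ρ' (leftRegular G k)) ∈ _
  obtain ⟨F, hF⟩ := h.exists_mul_sum_layerProj f g k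
  rw [← hF, Finset.mul_sum]
  refine sum_mem fun x _ => ?_
  rw [map_sub, sub_mul]
  exact sub_mem (((h.monomial k).cornerMap f g).mul_layerProj_mem x)
    (((h.monomial' k).cornerMap f g).mul_layerProj_mem x)

theorem isTraceClass_cornerMap (h : IsFredholmPair ρ ρ' r)
    (ha : a ∈ Submodule.span ℂ (Set.range (leftRegular G))) :
    IsTraceClass (cornerMap f g (ρ a - ρ' a)) := by
  induction ha using Submodule.span_induction with
  | mem x hx =>
    obtain ⟨k, rfl⟩ := hx
    obtain ⟨F, hF⟩ := h.exists_mul_sum_layerProj f g k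
    refine IsTraceClass.of_mul_sum_layerProj ?_ hF
    rw [map_sub]
    exact sub_mem ((h.monomial k).cornerMap f g).mem_equivariant
      ((h.monomial' k).cornerMap f g).mem_equivariant
  | zero => simpa using IsTraceClass.zero
  | add x y _ _ hx hy =>
    rw [map_add, map_add, add_sub_add_comm, map_add]
    exact hx.add hy
  | smul c x _ hx =>
    rw [map_smul, map_smul, ← smul_sub, map_smul]
    exact hx.smul c

theorem diag_sub (h : IsFredholmPair ρ ρ' r) [DecidableEq V] (a : ReducedCStar G) (v : V) :
    diag v (ρ a - ρ' a) = if v = r then canonicalTrace G a else 0 := by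
  classical
  -- both sides are continuous in `a` and agree on the group elements
  let L : (EllTwo G →L[ℂ] EllTwo G) →L[ℂ] ℂ :=
    (⟨diag v, continuous_diag v⟩ : (EllTwo (V × H) →L[ℂ] EllTwo (V × H)) →L[ℂ] ℂ).comp
      (ρ.toCLM - ρ'.toCLM) - (if v = r then (1 : ℂ) else 0) •
      ((innerSL ℂ (delta (1 : G))).comp (ContinuousLinearMap.apply ℂ (EllTwo G) (delta (1 : G))))
  have hL (b) : L b = diag v (ρ b - ρ' b) -
      (if v = r then (1 : ℂ) else 0) * inner ℂ (delta (1 : G)) (b (delta 1)) := rfl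
  have := ReducedCStar.induction L (S := ⊥) isClosed_singleton (fun k => ?_) a.2
  · rw [Submodule.mem_bot, hL, sub_eq_zero] at this
    rw [this]
    change _ * canonicalTrace G a = _
    split_ifs <;> simp
  · rw [Submodule.mem_bot, hL, h.diag_leftRegular, leftRegular_delta, mul_one, inner_delta_left,
      delta_apply, sub_eq_zero]
    by_cases h1 : v = r <;> by_cases h2 : k = 1 <;> simp [h1, h2, eq_comm]

end IsFredholmPair

/-- The group ring is dense in the matrices over the reduced C*-algebra; a self-adjoint matrix has
self-adjoint approximations. -/
theorem exists_groupRing_near [PartialOrder (ReducedCStar G)] [StarOrderedRing (ReducedCStar G)]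
    {n : ℕ} {p : CStarMatrix (Fin n) (Fin n) (ReducedCStar G)} (hp : star p = p) {ε : ℝ}
    (hε : 0 < ε) :
    ∃ a : CStarMatrix (Fin n) (Fin n) (ReducedCStar G), star a = a ∧ ‖a - p‖ ≤ ε ∧
      ∀ i j, (a i j : EllTwo G →L[ℂ] EllTwo G) ∈ Submodule.span ℂ (Set.range (leftRegular G)) := by
  set S : Set (ReducedCStar G) :=
    {x | (x : EllTwo G →L[ℂ] EllTwo G) ∈ Submodule.span ℂ (Set.range (leftRegular G))} with hS
  have hdense (x : ReducedCStar G) : x ∈ closure S := by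
    rw [closure_subtype]
    refine closure_mono ?_ (ReducedCStar.mem_closure_span x.2)
    intro y hy
    exact ⟨⟨y, ReducedCStar.span_le hy⟩, hy, rfl⟩
  have hmem : p ∈ closure
      {b : CStarMatrix (Fin n) (Fin n) (ReducedCStar G) | ∀ i j, b i j ∈ S} := by
    have h1 : (Set.univ.pi fun _ : Fin n => Set.univ.pi fun _ : Fin n => S) =
        {b : Fin n → Fin n → ReducedCStar G | ∀ i j, b i j ∈ S} := by
      ext b
      simp
    have h2 : (p : Fin n → Fin n → ReducedCStar G) ∈
        closure (Set.univ.pi fun _ : Fin n => Set.univ.pi fun _ : Fin n => S) := by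
      rw [closure_pi_set]
      intro i _
      rw [closure_pi_set]
      exact fun j _ => hdense _
    rw [h1] at h2
    exact h2
  obtain ⟨b, hb, hbp⟩ := Metric.mem_closure_iff.1 hmem ε hε
  rw [dist_comm, dist_eq_norm] at hbp
  refine ⟨(2⁻¹ : ℂ) • (b + star b), ?_, ?_, fun i j => ?_⟩
  · rw [star_smul, star_add, star_star, add_comm]
    simp
  · have h1 : (2⁻¹ : ℂ) • (b + star b) - p = (2⁻¹ : ℂ) • ((b - p) + star (b - p)) := by
      rw [star_sub, hp]
      module
    rw [h1, norm_smul]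
    have h2 := norm_add_le (b - p) (star (b - p))
    have h3 : ‖star (b - p)‖ = ‖b - p‖ := norm_star (b - p)
    rw [h3] at h2
    have h4 : ‖(2⁻¹ : ℂ)‖ = 2⁻¹ := by simp
    rw [h4]
    linarith
  · have h1 : (star (b j i : EllTwo G →L[ℂ] EllTwo G)) ∈
        Submodule.span ℂ (Set.range (leftRegular G)) := by
      have hx : (b j i : EllTwo G →L[ℂ] EllTwo G) ∈
        Submodule.span ℂ (Set.range (leftRegular G)) := hb j i
      generalize (b j i : EllTwo G →L[ℂ] EllTwo G) = x at hx
      induction hx using Submodule.span_induction with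
      | mem x hx =>
        obtain ⟨g, rfl⟩ := hx
        exact Submodule.subset_span ⟨g⁻¹, (star_leftRegular g).symm⟩
      | zero => simp
      | add x y _ _ hx hy => rw [star_add]; exact add_mem hx hy
      | smul c x _ hx => rw [star_smul]; exact Submodule.smul_mem _ _ hx
    exact Submodule.smul_mem _ _ (add_mem (hb i j) h1)

end FredholmPair

/-! ### The index of a Fredholm module -/

section TreeIndex

open EllTwo

variable {G : Type u} [Group G] {H : Type v} [Group H] {V : Type w}

namespace EllTwo

section double

variable {m : Type} (V : Type w)

/-- The `i`-th copy of `V` labelled `true`, inside the copies indexed by `m × Bool`. -/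
def copy (i : m) : V ↪ (m × Bool) × V := Function.Embedding.sectR (i, true) V

variable {V}

theorem copy_disjoint {i j : m} {x y : V} (h : copy V i x = copy V j y) : i = j :=
  congrArg (fun z : (m × Bool) × V => z.1.1) h

variable (V) (H : Type v) [Group H]

/-- The projection onto the copies of `ℓ²(V × H)` labelled `true`, and the symmetry that swaps the
copies labelled `true` and `false`. -/
theorem exists_projection_swap (m : Type) [Fintype m] :
    ∃ e σ : EllTwo (((m × Bool) × V) × H) →L[ℂ] EllTwo (((m × Bool) × V) × H),
      IsStarProjection e ∧ σ * σ = 1 ∧ star σ = σ ∧ σ * e = σ - e * σ ∧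
      e ∈ equivariant ((m × Bool) × V) H ∧ σ ∈ equivariant ((m × Bool) × V) H ∧
      σ ∈ multipliers ((m × Bool) × V) H ∧
      (∀ x, e * layerProj x = layerProj x ∨ e * layerProj x = 0) ∧
      ∀ (i j : m) (T : EllTwo (V × H) →L[ℂ] EllTwo (V × H)),
        e * cornerMap (copy V i) (copy V j) T = cornerMap (copy V i) (copy V j) T := by
  classical
  -- the projection onto the copies labelled `true`
  let e : EllTwo (((m × Bool) × V) × H) →L[ℂ] EllTwo (((m × Bool) × V) × H) :=
    ∑ i, cornerMap (copy V i) (copy V i) 1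
  have he_true (i : m) (v : V) (k : H) :
      e (delta (((i, true), v), k)) = delta (((i, true), v), k) := by
    rw [sum_apply, Finset.sum_eq_single i]
    · exact (cornerMap_delta (copy V i) (copy V i) 1 v k).trans (incl_lift_delta (copy V i) v k)
    · intro j _ hj
      exact cornerMap_delta_of_notMem _ _ (fun w hw => hj (copy_disjoint hw)) k
    · exact fun hi => absurd (Finset.mem_univ i) hi
  have he_false (i : m) (v : V) (k : H) : e (delta (((i, false), v), k)) = 0 := by
    rw [sum_apply]
    refine Finset.sum_eq_zero fun j _ => cornerMap_delta_of_notMem _ _ (fun w hw => ?_) k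
    simpa [copy] using congrArg (fun z : (m × Bool) × V => z.1.2) hw
  have hemon : IsMonomial e := by
    rintro ⟨⟨i, _ | _⟩, v⟩
    · exact Or.inr fun k => he_false i v k
    · exact Or.inl ⟨((i, true), v), 1, fun k => by rw [he_true, one_mul]⟩
  have hestar : star e = e := by
    rw [star_sum]
    refine Finset.sum_congr rfl fun i _ => ?_
    rw [star_cornerMap, star_one]
  have hee : e * e = e := by
    refine clm_ext ?_
    rintro ⟨⟨⟨i, _ | _⟩, v⟩, k⟩
    · rw [mul_apply_eq_comp, he_false, map_zero]
    · rw [mul_apply_eq_comp, he_true, he_true]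
  have hecorner (i j : m) (T : EllTwo (V × H) →L[ℂ] EllTwo (V × H)) :
      e * cornerMap (copy V i) (copy V j) T = cornerMap (copy V i) (copy V j) T := by
    have h1 : e ∘L incl (lift H (copy V i)) = incl (lift H (copy V i)) :=
      clm_ext fun ⟨v, k⟩ => by
        rw [ContinuousLinearMap.comp_apply, incl_lift_delta]
        exact he_true i v k
    rw [cornerMap_apply]
    change e ∘L (incl (lift H (copy V i)) ∘L _) = _
    rw [← ContinuousLinearMap.comp_assoc, h1]
  have hediag (x : (m × Bool) × V) :
      e * layerProj x = (layerProj x : EllTwo (((m × Bool) × V) × H) →L[ℂ] _) ∨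
        e * (layerProj x : EllTwo (((m × Bool) × V) × H) →L[ℂ] _) = 0 := by
    obtain ⟨⟨i, _ | _⟩, v⟩ := x
    · right
      refine clm_ext fun ⟨y, k⟩ => ?_
      rw [mul_apply_eq_comp]
      by_cases hy : ((i, false), v) = y
      · rw [← hy, layerProj_delta_self, he_false, zero_apply]
      · rw [layerProj_delta_of_ne hy, map_zero, zero_apply]
    · left
      refine clm_ext fun ⟨y, k⟩ => ?_
      rw [mul_apply_eq_comp]
      by_cases hy : ((i, true), v) = y
      · rw [← hy, layerProj_delta_self, he_true]
      · rw [layerProj_delta_of_ne hy, map_zero]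
  -- the symmetry that swaps the two families of copies
  let s : Equiv.Perm (((m × Bool) × V) × H) :=
    (((Equiv.refl (m)).prodCongr Equiv.boolNot).prodCongr (Equiv.refl V)).prodCongr
      (Equiv.refl H)
  let σ : EllTwo (((m × Bool) × V) × H) →L[ℂ] EllTwo (((m × Bool) × V) × H) :=
    (permute s).toContinuousLinearEquiv.toContinuousLinearMap
  have hσδ (i : m) (b : Bool) (v : V) (k : H) :
      σ (delta (((i, b), v), k)) = delta (((i, !b), v), k) := permute_delta s _
  have hσσ : σ * σ = 1 := by
    refine clm_ext fun ⟨⟨⟨i, b⟩, v⟩, k⟩ => ?_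
    rw [mul_apply_eq_comp, hσδ, hσδ, Bool.not_not]
    rfl
  have hσstar : star σ = σ := by
    have hs : s⁻¹ = s := by
      rw [inv_eq_iff_mul_eq_one]
      ext ⟨⟨⟨i, b⟩, v⟩, k⟩ <;> simp [s]
    change star (permute s).toContinuousLinearEquiv.toContinuousLinearMap = _
    rw [star_permute, hs]
  have hσmon : IsMonomial σ := by
    rintro ⟨⟨i, b⟩, v⟩
    exact Or.inl ⟨((i, !b), v), 1, fun k => by rw [hσδ, one_mul]⟩
  have hσM : σ ∈ multipliers ((m × Bool) × V) H :=
    hσmon.mem_multipliers (by rw [hσstar]; exact hσmon)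
  have hσe : σ * e = σ - e * σ := by
    refine clm_ext ?_
    rintro ⟨⟨⟨i, _ | _⟩, v⟩, k⟩
    · rw [sub_apply, mul_apply_eq_comp, mul_apply_eq_comp, he_false, map_zero, hσδ]
      exact (sub_eq_zero.2 (he_true i v k).symm).symm
    · rw [sub_apply, mul_apply_eq_comp, mul_apply_eq_comp, he_true, hσδ]
      exact (sub_eq_self.2 (he_false i v k)).symm
  exact ⟨e, σ, ⟨hee, hestar⟩, hσσ, hσstar, hσe, hemon.mem_equivariant, hσmon.mem_equivariant, hσM,
    hediag, hecorner⟩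

end double

end EllTwo

/-- A matrix projection over `C*_r G` can be replaced, without changing its trace, by the limit of
the Newton iterates of an almost idempotent matrix over the group ring. -/
theorem exists_newton_limit [PartialOrder (ReducedCStar G)] [StarOrderedRing (ReducedCStar G)]
    {n : ℕ} {p : CStarMatrix (Fin n) (Fin n) (ReducedCStar G)} (hp : IsStarProjection p) :
    ∃ a p' : CStarMatrix (Fin n) (Fin n) (ReducedCStar G), ‖a‖ ≤ 3 / 2 ∧ ‖a * a - a‖ ≤ 1 / 64 ∧
      (∀ i j, (a i j : EllTwo G →L[ℂ] EllTwo G) ∈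
        Submodule.span ℂ (Set.range (leftRegular G))) ∧
      Filter.Tendsto (fun k => newtonStep^[k] a) Filter.atTop (nhds p') ∧ IsStarProjection p' ∧
      ∑ i, canonicalTrace G (p i i) = ∑ i, canonicalTrace G (p' i i) := by
  -- the error `1 / 400` makes `a` idempotent up to `1 / 100`, and then `p'` is `14 / 100` close
  -- to `a`
  obtain ⟨a, hastar, hap, haspan⟩ :=
    exists_groupRing_near hp.isSelfAdjoint.star_eq (show (0 : ℝ) < 1 / 400 by norm_num)
  have hp1 : ‖p‖ ≤ 1 := hp.norm_le
  obtain ⟨ha2, hax⟩ :=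
    norm_mul_self_sub_le hp.isIdempotentElem hp1 (by norm_num : (1 : ℝ) / 400 ≤ 1) hap
  have ha3 : ‖a‖ ≤ 3 / 2 := by
    have := norm_add_le (a - p) p
    rw [sub_add_cancel] at this
    linarith
  obtain ⟨p', hlim, hp', hp'a⟩ :=
    exists_isStarProjection_near (by norm_num) (by norm_num) ha2 hax hastar
  have hnear : ‖p - p'‖ < 1 / 2 := by
    have := norm_sub_le (a - p) (a - p')
    rw [norm_sub_rev a p'] at this
    have e : a - p - (a - p') = -(p - p') := by abel
    rw [e, norm_neg] at this
    linarith
  let τ : CStarMatrix (Fin n) (Fin n) (ReducedCStar G) →+ ℂ :=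
    { toFun := fun b => ∑ i, canonicalTrace G (b i i)
      map_zero' := by simp
      map_add' := fun b c => by simp [Finset.sum_add_distrib] }
  have hτ (b c) : τ (b * c) = τ (c * b) := by
    change ∑ i, canonicalTrace G ((b * c) i i) = ∑ i, canonicalTrace G ((c * b) i i)
    simp only [CStarMatrix.mul_apply, map_sum]
    rw [Finset.sum_comm]
    exact Finset.sum_congr rfl fun i _ => Finset.sum_congr rfl fun j _ =>
      canonicalTrace_mul_comm _ _
  exact ⟨a, p', ha3, hax.trans (by norm_num), haspan, hlim, hp',
    trace_eq_of_near τ hτ hp.isIdempotentElem hp'.isIdempotentElem hp1 hp'.norm_le hnear⟩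

namespace IsFredholmPair

variable {ρ ρ' : (EllTwo G →L[ℂ] EllTwo G) →⋆ₙₐ[ℂ] (EllTwo (V × H) →L[ℂ] EllTwo (V × H))} {r : V}

/-- The index pairing of the Fredholm module of a tree with a projection over `C*_r G` is computed
in `K₀(C*_r H)`, and its trace is the trace of the projection. -/
theorem exists_traceKZeroComplex_eq (h : IsFredholmPair ρ ρ' r)
    (q : MatrixProjection (ReducedCStar G)) :
    ∃ y, traceKZeroComplex H y = ∑ i, canonicalTrace G (q.mat i i) := by
  classical
  obtain ⟨n, q, hq⟩ := q
  change ∃ y, traceKZeroComplex H y = ∑ i, canonicalTrace G (q i i)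
  let := CStarAlgebra.spectralOrder (ReducedCStar G)
  have := CStarAlgebra.spectralOrderedRing (ReducedCStar G)
  let p : CStarMatrix (Fin n) (Fin n) (ReducedCStar G) := CStarMatrix.ofMatrix q
  have hp : IsStarProjection p := ⟨hq.isIdempotentElem, hq.isSelfAdjoint⟩
  change ∃ y, traceKZeroComplex H y = ∑ i, canonicalTrace G (p i i)
  clear_value p
  -- replace `p` by a projection `p'` that is a limit of Newton iterates from the group ring
  obtain ⟨a, p', ha3, hax, haspan, hlim, hp', hpp'⟩ := exists_newton_limit hp
  rw [hpp']
  -- `n` copies of `ℓ²(V × H)`, and `n` more to make room for a swap `σ`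
  have hF (i j : Fin n) (x y : V × H) (hxy : lift H (copy V i) x = lift H (copy V j) y) : i = j :=
    copy_disjoint (congrArg Prod.fst hxy)
  let ι := (ReducedCStar G).subtype.toNonUnitalStarAlgHom
  let Φ := blockHom (fun i => lift H (copy V i)) hF (ρ.comp ι)
  let Φ' := blockHom (fun i => lift H (copy V i)) hF (ρ'.comp ι)
  have hΦ (b) : Φ b = ∑ i, ∑ j, cornerMap (copy V i) (copy V j) (ρ (b i j)) := rfl
  have hΦ' (b) : Φ' b = ∑ i, ∑ j, cornerMap (copy V i) (copy V j) (ρ' (b i j)) := rfl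
  have hsub (b) : Φ b - Φ' b = ∑ i, ∑ j, cornerMap (copy V i) (copy V j) (ρ (b i j) - ρ' (b i j)) := by
    simp only [hΦ, hΦ', ← Finset.sum_sub_distrib, ← map_sub]
  have hΦN (b) : Φ b ∈ equivariant ((Fin n × Bool) × V) H :=
    sum_mem fun i _ => sum_mem fun j _ =>
      cornerMap_mem_equivariant (copy V i) (copy V j) h.monomial (b i j).2
  have hΦN' (b) : Φ' b ∈ equivariant ((Fin n × Bool) × V) H :=
    sum_mem fun i _ => sum_mem fun j _ =>
      cornerMap_mem_equivariant (copy V i) (copy V j) h.monomial' (b i j).2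
  have hΦM' (b) : Φ' b ∈ multipliers ((Fin n × Bool) × V) H :=
    sum_mem fun i _ => sum_mem fun j _ =>
      cornerMap_mem_multipliers (copy V i) (copy V j) h.monomial' (b i j).2
  have hcpt (b) : Φ b - Φ' b ∈ compactOps ((Fin n × Bool) × V) H := by
    rw [hsub]
    exact sum_mem fun i _ => sum_mem fun j _ =>
      h.cornerMap_mem_compactOps (copy V i) (copy V j) (b i j).2
  have htra : IsTraceClass (Φ a - Φ' a) := by
    rw [hsub]
    exact IsTraceClass.sum _ fun i _ => IsTraceClass.sum _ fun j _ =>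
      h.isTraceClass_cornerMap (copy V i) (copy V j) (haspan i j)
  have htr : IsTraceClass (Φ p' - Φ' p') :=
    isTraceClass_of_tendsto_newtonStep Φ Φ' hΦN hΦN' htra ha3
      hax hlim
  obtain ⟨e, σ, he, hσσ, hσstar, hσe, heN, hσN, hσM, hediag, hecorner⟩ :=
    exists_projection_swap V H (Fin n)
  have hesum (F : Fin n → Fin n → EllTwo (V × H) →L[ℂ] EllTwo (V × H)) :
      e * ∑ i, ∑ j, cornerMap (copy V i) (copy V j) (F i j) =
        ∑ i, ∑ j, cornerMap (copy V i) (copy V j) (F i j) := by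
    rw [Finset.mul_sum]
    refine Finset.sum_congr rfl fun i _ => ?_
    rw [Finset.mul_sum]
    exact Finset.sum_congr rfl fun j _ => hecorner i j _
  have heΦ : e * Φ p' = Φ p' := by rw [hΦ, hesum]
  have heΦ' : e * Φ' p' = Φ' p' := by rw [hΦ', hesum]
  obtain ⟨y, hy⟩ := exists_traceKZeroComplex_eq_of_pair (e := e) (σ := σ) (P := Φ p')
    (P' := Φ' p') he (hp'.map Φ) (hp'.map Φ') hσσ hσstar hσe heΦ heΦ'
    heN hσN (hΦN _) (hΦN' _) hediag hσM (hΦM' _) htr (hcpt _)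
  refine ⟨y, hy.trans ?_⟩
  -- only the root layers contribute to the trace of the difference
  have hdiag (x : (Fin n × Bool) × V) : diag x (Φ p' - Φ' p') =
      ∑ i, if x = copy V i r then canonicalTrace G (p' i i) else 0 := by
    rw [hsub, map_sum]
    refine Finset.sum_congr rfl fun i _ => ?_
    rw [map_sum, Finset.sum_eq_single i]
    · by_cases hx : ∃ v, copy V i v = x
      · obtain ⟨v, rfl⟩ := hx
        rw [diag_cornerMap_self, h.diag_sub]
        simp only [(copy V i).injective.eq_iff]
      · push Not at hx
        rw [diag_cornerMap_of_notMem _ _ hx, if_neg fun h0 => hx r h0.symm]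
    · intro j _ hj
      by_cases hx : ∃ v, copy V i v = x
      · obtain ⟨v, rfl⟩ := hx
        exact diag_cornerMap_of_notMem' _ _ fun w hw => hj (copy_disjoint hw)
      · push Not at hx
        exact diag_cornerMap_of_notMem _ _ hx
    · exact fun hi => absurd (Finset.mem_univ i) hi
  simp only [hdiag]
  exact (hasSum_sum fun i _ => hasSum_ite_eq (copy V i r) (canonicalTrace G (p' i i))).tsum_eq

end IsFredholmPair

/-! ### The Fredholm module of a tree -/

/-- A group that is subdued by `H` has a finitely summable Fredholm module over `H`: the first
representation comes from the vertices of the tree and the second one from its edges, which are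
matched with the vertices other than the root. -/
theorem IsSubduedOn.exists_isFredholmPair [MulAction G V] {T : SimpleGraph V}
    (h : IsSubduedOn G H T) :
    ∃ (ρ ρ' : (EllTwo G →L[ℂ] EllTwo G) →⋆ₙₐ[ℂ] (EllTwo (V × H) →L[ℂ] EllTwo (V × H))) (r : V),
      IsFredholmPair ρ ρ' r := by
  classical
  obtain ⟨htree, α, hα⟩ := h
  obtain ⟨r, E, _, κ, hκ, hfin, hfix⟩ := htree.exists_edges
  have hker (g : G) (v : V) (hg : g • v = v) (hαg : α g = 1) : g = 1 :=
    hα v hg (one_mem (MulAction.stabilizer G v)) (by rw [hαg, map_one])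
  let act (Y : Type w) [MulAction G Y] : G →* Equiv.Perm (Y × H) :=
    { toFun := fun g => (MulAction.toPerm g).prodCongr (Equiv.mulLeft (α g))
      map_one' := by ext ⟨y, k⟩ <;> simp
      map_mul' := fun g g' => by ext ⟨y, k⟩ <;> simp [mul_smul, mul_assoc] }
  have hact (Y : Type w) [MulAction G Y] (g : G) (y : Y) (k : H) :
    act Y g (y, k) = (g • y, α g * k) := rfl
  obtain ⟨ρ, hρ⟩ := exists_rep_of_free (act V) (by
    rintro g ⟨v, k⟩ hg
    rw [hact, Prod.mk.injEq] at hg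
    exact hker g v hg.1 (by simpa using hg.2))
  obtain ⟨ρE, hρE⟩ := exists_rep_of_free (act E) (by
    rintro g ⟨e, k⟩ hg
    rw [hact, Prod.mk.injEq] at hg
    exact hker g _ (hfix g e hg.1) (by simpa using hg.2))
  have h1 (g : G) (v : V) (k : H) :
      ρ (leftRegular G g) (delta (v, k)) = delta (g • v, α g * k) := hρ g (v, k)
  have h2 (g : G) (e : E) (k : H) : inclHom (lift H κ) (ρE (leftRegular G g)) (delta (κ e, k)) =
      delta (κ (g • e), α g * k) := by
    refine (inclHom_delta (lift H κ) (ρE (leftRegular G g)) (e, k)).trans ?_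
    rw [hρE, hact, incl_lift_delta]
  have h3 (g : G) (k : H) : inclHom (lift H κ) (ρE (leftRegular G g)) (delta (r, k)) = 0 :=
    inclHom_delta_of_notMem _ _ fun e he => (hκ r).2 ⟨e.1, congrArg Prod.fst he⟩ rfl
  refine ⟨ρ, (inclHom (lift H κ)).comp ρE, r, fun g v => ?_, fun g v => ?_, fun g => ?_,
    fun g v => ?_⟩
  · exact Or.inl ⟨g • v, α g, h1 g v⟩
  · by_cases hv : v = r
    · subst hv
      exact Or.inr (h3 g)
    · obtain ⟨e, rfl⟩ := (hκ v).1 hv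
      exact Or.inl ⟨κ (g • e), α g, h2 g e⟩
  · refine (((hfin g).image κ).union (Set.finite_singleton r)).subset ?_
    rintro v ⟨k, hk⟩
    by_cases hv : v = r
    · exact Or.inr hv
    · obtain ⟨e, rfl⟩ := (hκ v).1 hv
      refine Or.inl ⟨e, fun h0 => hk ?_, rfl⟩
      rw [sub_apply, h1, NonUnitalStarAlgHom.comp_apply, h2, h0, sub_self]
  · rw [map_sub, diag_apply, diag_apply, h1, NonUnitalStarAlgHom.comp_apply, inner_delta_left,
      inner_delta_left, delta_apply]
    have h4 : ((v, (1 : H)) = (g • v, α g * 1)) ↔ g = 1 := by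
      rw [Prod.mk.injEq, mul_one]
      exact ⟨fun h0 => hker g v h0.1.symm h0.2.symm, fun h0 => by simp [h0]⟩
    by_cases hv : v = r
    · subst hv
      rw [h3]
      simp only [h4, true_and]
      by_cases hg : g = 1 <;> simp [hg]
    · obtain ⟨e, rfl⟩ := (hκ v).1 hv
      have h5 : ((κ e, (1 : H)) = (κ (g • e), α g * 1)) ↔ g = 1 := by
        rw [Prod.mk.injEq, mul_one, κ.injective.eq_iff]
        exact ⟨fun h0 => hker g _ (hfix g e h0.1.symm) h0.2.symm, fun h0 => by simp [h0]⟩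
      rw [h2, delta_apply]
      simp only [h4, h5, hv, false_and, sub_self, if_false]

theorem OperatorKZero.hom_ext {A : Type*} [Ring A] [StarRing A] {B : Type*} [AddCommGroup B]
    {f g : OperatorKZero A →+ B}
    (h : ∀ q : MatrixProjection A, f (OperatorKZero.mk q) = g (OperatorKZero.mk q)) : f = g := by
  apply Algebra.GrothendieckAddGroup.lift.symm.injective
  refine AddMonoidHom.ext ?_
  rintro ⟨q⟩
  exact h q

theorem traceKZeroComplex_mk (q : MatrixProjection (ReducedCStar G)) :
    traceKZeroComplex G (OperatorKZero.mk q) = ∑ i, canonicalTrace G (q.mat i i) :=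
  OperatorKZero.traceHom_mk _ _ q

theorem range_traceKZero_le (h : ∀ q : MatrixProjection (ReducedCStar G),
    ∃ y, traceKZeroComplex H y = ∑ i, canonicalTrace G (q.mat i i)) :
    (traceKZero G).range ≤ (traceKZero H).range := by
  have hq (q : MatrixProjection (ReducedCStar G)) :
      traceKZero G (OperatorKZero.mk q) ∈ (traceKZero H).range := by
    obtain ⟨y, hy⟩ := h q
    refine ⟨y, Complex.ofReal_injective ?_⟩
    rw [traceKZero_coe, traceKZero_coe, hy, _root_.traceKZeroComplex_mk]
  have key : (QuotientAddGroup.mk' (traceKZero H).range).comp (traceKZero G) = 0 :=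
    OperatorKZero.hom_ext fun q => (QuotientAddGroup.eq_zero_iff _).2 (hq q)
  rintro _ ⟨x, rfl⟩
  exact (QuotientAddGroup.eq_zero_iff _).1 (DFunLike.congr_fun key x)

theorem IsSubdued.range_traceKZero_le (h : IsSubdued.{u, v, w} G H) :
    (traceKZero G).range ≤ (traceKZero H).range := by
  obtain ⟨V, _, T, hT⟩ := h
  obtain ⟨ρ, ρ', r, hρ⟩ := hT.exists_isFredholmPair
  exact _root_.range_traceKZero_le hρ.exists_traceKZeroComplex_eq

end TreeIndex

/-! ### The Bass-Serre tree of an HNN extension -/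

/-- A graph is acyclic if its vertices can be labelled injectively by lists so that of the labels
of two neighbours one extends the other by one entry at the front. -/
theorem SimpleGraph.isAcyclic_of_label {V : Type*} {T : SimpleGraph V} {L : Type*} {l : V → List L}
    (hl : Function.Injective l)
    (hadj : ∀ x y, T.Adj x y → ∃ a, l y = a :: l x ∨ l x = a :: l y) : T.IsAcyclic := by
  have key {x y : V} {a : L} (hxy : l y = a :: l x) : T.IsBridge s(x, y) := by
    rw [isBridge_iff]
    -- without the edge from `x` to `y`, all vertices reachable from `y` extend the label of `y`
    have hsuff {z z' : V} (p : (T.deleteEdges {s(x, y)}).Walk z z') :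
        l y <:+ l z → l y <:+ l z' := by
      induction p with
      | nil => exact id
      | @cons b c d hbc q ih =>
        intro hb
        rw [deleteEdges_adj, Set.mem_singleton_iff] at hbc
        refine ih ?_
        obtain ⟨e, he | he⟩ := hadj _ _ hbc.1
        · rw [he]
          exact hb.trans (List.suffix_cons _ _)
        · rw [he, List.suffix_cons_iff] at hb
          rcases hb with hb | hb
          · have h1 : y = b := hl (hb.trans he.symm)
            have h2 : x = c := hl (List.cons.inj (hxy.symm.trans hb)).2
            exact absurd (by rw [h1, h2, Sym2.eq_swap]) hbc.2
          · exact hb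
    rintro ⟨p⟩
    have := (hsuff p.reverse (List.suffix_refl _)).length_le
    rw [hxy, List.length_cons] at this
    omega
  rw [isAcyclic_iff_forall_adj_isBridge]
  intro x y hxy
  obtain ⟨a, h | h⟩ := hadj x y hxy
  · exact key h
  · rw [Sym2.eq_swap]
    exact key h

namespace HNNExtension

variable {H : Type v} [Group H] {A B : Subgroup H} {φ : A ≃* B}

variable (φ) in
/-- The vertices of the Bass-Serre tree: the left cosets of the base group. -/
abbrev TreeVertex : Type v := HNNExtension H A B φ ⧸ (of : H →* HNNExtension H A B φ).range

variable (φ) in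
/-- The degree homomorphism, which counts the stable letter. -/
def degree : HNNExtension H A B φ →* Multiplicative ℤ :=
  lift 1 (Multiplicative.ofAdd 1) (by simp)

theorem degree_of (h : H) : degree φ (of h) = 1 := by simp [degree]

theorem degree_t : degree φ t = Multiplicative.ofAdd 1 := by simp [degree]

variable (φ) in
/-- The degree of a vertex of the Bass-Serre tree. -/
def vertexDegree : TreeVertex φ → Multiplicative ℤ :=
  Quotient.lift (degree φ) fun a b hab => by
    obtain ⟨h, hh⟩ := QuotientGroup.leftRel_apply.1 hab
    have := congrArg (degree φ) hh
    rw [degree_of, map_mul, map_inv] at this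
    exact (inv_mul_eq_one.1 this.symm)

theorem vertexDegree_smul (g : HNNExtension H A B φ) (x : TreeVertex φ) :
    vertexDegree φ (g • x) = degree φ g * vertexDegree φ x := by
  obtain ⟨x, rfl⟩ := QuotientGroup.mk_surjective x
  exact map_mul (degree φ) g x

variable (φ) in
/-- The oriented edges of the Bass-Serre tree: the edge `γ` goes from `γ H` to `γ t H`. -/
def IsArrow (x y : TreeVertex φ) : Prop :=
  ∃ γ : HNNExtension H A B φ, x = (γ : TreeVertex φ) ∧ y = ((γ * t : HNNExtension H A B φ) :
    TreeVertex φ)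

theorem IsArrow.vertexDegree_eq {x y : TreeVertex φ} (h : IsArrow φ x y) :
    vertexDegree φ y = vertexDegree φ x * Multiplicative.ofAdd 1 := by
  obtain ⟨γ, rfl, rfl⟩ := h
  rw [← degree_t (φ := φ)]
  exact map_mul (degree φ) γ t

variable (φ) in
/-- The Bass-Serre tree of an HNN extension. -/
def tree : SimpleGraph (TreeVertex φ) where
  Adj x y := IsArrow φ x y ∨ IsArrow φ y x
  symm := ⟨fun _ _ => Or.symm⟩
  loopless := ⟨fun x h => by
    have := (or_self_iff.1 h).vertexDegree_eq
    rw [left_eq_mul] at this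
    exact absurd (congrArg Multiplicative.toAdd this) one_ne_zero⟩

theorem tree_adj_smul (g : HNNExtension H A B φ) {x y : TreeVertex φ} (h : (tree φ).Adj x y) :
    (tree φ).Adj (g • x) (g • y) := by
  have key {x y : TreeVertex φ} (h : IsArrow φ x y) : IsArrow φ (g • x) (g • y) := by
    obtain ⟨γ, rfl, rfl⟩ := h
    refine ⟨g * γ, rfl, ?_⟩
    rw [mul_assoc]
    rfl
  exact h.imp key key

theorem tree_reachable_smul (g : HNNExtension H A B φ) {x y : TreeVertex φ}
    (h : (tree φ).Reachable x y) : (tree φ).Reachable (g • x) (g • y) :=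
  h.map ⟨fun z => g • z, fun hab => tree_adj_smul g hab⟩

theorem tree_reachable (γ : HNNExtension H A B φ) :
    (tree φ).Reachable ((1 : HNNExtension H A B φ) : TreeVertex φ) (γ : TreeVertex φ) := by
  induction γ using induction_on with
  | of h =>
    have : ((1 : HNNExtension H A B φ) : TreeVertex φ) = (of h : HNNExtension H A B φ) :=
      QuotientGroup.eq.2 ⟨h, by simp⟩
    rw [this]
  | t => exact SimpleGraph.Adj.reachable (Or.inl ⟨1, rfl, by rw [one_mul]⟩)
  | mul x y hx hy =>
    have := tree_reachable_smul x hy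
    rw [MulAction.Quotient.smul_coe, MulAction.Quotient.smul_coe, smul_eq_mul, smul_eq_mul,
      mul_one] at this
    exact hx.trans this
  | inv x hx =>
    have := tree_reachable_smul x⁻¹ hx
    rw [MulAction.Quotient.smul_coe, MulAction.Quotient.smul_coe, smul_eq_mul, smul_eq_mul,
      mul_one, inv_mul_cancel] at this
    exact this.symm

open NormalWord in
/-- The label of the vertex `γ H`: the list of the normal form of `γ⁻¹`, which does not change when
`γ⁻¹` is multiplied from the left by an element of the base group. -/
def label (d : TransversalPair H A B) : TreeVertex φ → List (ℤˣ × H) :=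
  Quotient.lift (fun γ => (γ⁻¹ • (empty : NormalWord d)).toList) fun a b hab => by
    obtain ⟨h, hh⟩ := QuotientGroup.leftRel_apply.1 hab
    have : a⁻¹ = of h * b⁻¹ := by rw [hh, mul_assoc, mul_inv_cancel, mul_one]
    change (a⁻¹ • (empty : NormalWord d)).toList = (b⁻¹ • (empty : NormalWord d)).toList
    rw [this, mul_smul, of_smul_eq_smul, group_smul_toList]

theorem label_mk (d : NormalWord.TransversalPair H A B) (γ : HNNExtension H A B φ) :
    label d (γ : TreeVertex φ) = (γ⁻¹ • (NormalWord.empty : NormalWord d)).toList := rfl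

open NormalWord in
theorem label_injective (d : TransversalPair H A B) :
    Function.Injective (label d : TreeVertex φ → List (ℤˣ × H)) := by
  intro x y hxy
  obtain ⟨x, rfl⟩ := QuotientGroup.mk_surjective x
  obtain ⟨y, rfl⟩ := QuotientGroup.mk_surjective y
  rw [label_mk, label_mk] at hxy
  set w := x⁻¹ • (empty : NormalWord d) with hw
  set w' := y⁻¹ • (empty : NormalWord d) with hw'
  have h1 : w = (w.head * w'.head⁻¹) • w' := by
    refine NormalWord.ext ?_ hxy
    rw [group_smul_head, inv_mul_cancel_right]
  have h2 := congrArg (fun z : NormalWord d => z.prod φ) h1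
  simp only [prod_group_smul, hw, hw', prod_smul, prod_empty, mul_one] at h2
  refine QuotientGroup.eq.2 ⟨w.head * w'.head⁻¹, ?_⟩
  rw [hw, hw', eq_mul_of_mul_inv_eq h2.symm]

open NormalWord in
theorem toList_unitsSMul {d : TransversalPair H A B} (u : ℤˣ) (w : NormalWord d) :
    ∃ a, (unitsSMul φ u w).toList = a :: w.toList ∨ w.toList = a :: (unitsSMul φ u w).toList := by
  rw [unitsSMul]
  split_ifs with h
  · cases w using consRecOn with
    | ofGroup g => simp [Cancels] at h
    | cons g u' w h1 h2 => exact ⟨(u', w.head), Or.inr rfl⟩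
  · exact ⟨_, Or.inl rfl⟩

open NormalWord in
variable (φ) in
theorem isAcyclic_tree : (tree φ).IsAcyclic := by
  obtain ⟨d⟩ := TransversalPair.nonempty H A B
  refine SimpleGraph.isAcyclic_of_label (label_injective d) ?_
  have key {x y : TreeVertex φ} (h : IsArrow φ x y) :
      ∃ a, label d y = a :: label d x ∨ label d x = a :: label d y := by
    obtain ⟨γ, rfl, rfl⟩ := h
    have h1 : (γ * t)⁻¹ • (empty : NormalWord d) =
        unitsSMul φ (-1) (γ⁻¹ • (empty : NormalWord d)) := by
      rw [← t_pow_smul_eq_unitsSMul, ← mul_smul, mul_inv_rev]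
      simp
    rw [label_mk, label_mk, h1]
    exact toList_unitsSMul _ _
  rintro x y (h | h)
  · exact key h
  · obtain ⟨a, ha⟩ := key h
    exact ⟨a, ha.symm⟩

variable (φ) in
theorem actsOnTree : ActsOnTree (HNNExtension H A B φ) (tree φ) where
  isTree :=
    { connected :=
        { preconnected := by
            intro x y
            obtain ⟨x, rfl⟩ := QuotientGroup.mk_surjective x
            obtain ⟨y, rfl⟩ := QuotientGroup.mk_surjective y
            exact (tree_reachable x).symm.trans (tree_reachable y)
          nonempty := ⟨((1 : HNNExtension H A B φ) : TreeVertex φ)⟩ }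
      isAcyclic := isAcyclic_tree φ }
  smul_adj g x y h := tree_adj_smul g h
  no_inversion := by
    -- an inversion would have degree `d` with `2 d = 0`, so the endpoints would have equal degrees
    rintro g x y h ⟨h1, h2⟩
    have e1 := vertexDegree_smul g x
    have e2 := vertexDegree_smul g y
    rw [h1] at e1
    rw [h2] at e2
    rcases h with h | h <;>
    · have e3 := h.vertexDegree_eq
      have e4 := congrArg Multiplicative.toAdd e1
      have e5 := congrArg Multiplicative.toAdd e2
      have e6 := congrArg Multiplicative.toAdd e3
      rw [toAdd_mul] at e4 e5 e6
      rw [toAdd_ofAdd] at e6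
      omega

/-- An HNN extension along a conjugation is subdued by the base group: the stable letter is mapped
to the conjugating element. -/
theorem isSubdued (g : H) (hg : ∀ a : A, (φ a : H) = g * a * g⁻¹) :
    IsSubdued.{v, v, v} (HNNExtension H A B φ) H := by
  let α : HNNExtension H A B φ →* H := lift (MonoidHom.id H) g fun a => by simp [hg]
  refine ⟨TreeVertex φ, inferInstance, tree φ, actsOnTree φ, α, ?_⟩
  intro x
  obtain ⟨γ, rfl⟩ := QuotientGroup.mk_surjective x
  intro a ha b hb hab
  -- the stabilizer of `γ H` is conjugate to `H`, and the homomorphism is the identity on `H`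
  have hmem : a⁻¹ * b ∈ MulAction.stabilizer (HNNExtension H A B φ) (γ : TreeVertex φ) :=
    mul_mem (inv_mem ha) hb
  rw [MulAction.mem_stabilizer_iff, MulAction.Quotient.smul_coe, eq_comm, QuotientGroup.eq,
    smul_eq_mul] at hmem
  obtain ⟨h, hh⟩ := hmem
  have h1 : h = 1 := by
    have := congrArg α hh
    rw [map_mul, map_mul, map_mul, map_inv, map_inv, hab, inv_mul_cancel, one_mul,
      inv_mul_cancel] at this
    simpa [α] using this
  rw [h1, map_one, eq_comm, inv_mul_eq_one] at hh
  exact inv_mul_eq_one.1 (right_eq_mul.1 hh)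

end HNNExtension

/-! ### Double amalgams -/

theorem IsSubdued.of_injective {G : Type u} [Group G] {K : Type*} [Group K] {H : Type v} [Group H]
    (h : IsSubdued.{_, v, w} K H) (f : G →* K) (hf : Function.Injective f) :
    IsSubdued.{u, v, w} G H := by
  obtain ⟨V, _, T, hT, α, hα⟩ := h
  let _ := MulAction.compHom V f
  refine ⟨V, MulAction.compHom V f, T, ⟨hT.isTree, fun g => hT.smul_adj (f g),
    fun g => hT.no_inversion (f g)⟩, α.comp f, fun x a ha b hb hab => hf (hα x ha hb hab)⟩

namespace DoubleAmalgam

variable {H : Type v} [Group H] (U : Subgroup H)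

open Monoid

/-- The two embeddings of `H` in `H *_U H`. -/
def factor (b : Bool) : H →* DoubleAmalgam U :=
  PushoutI.of (φ := fun _ : Bool => U.subtype) b

/-- The endomorphism of `H *_U H` that swaps the two factors. -/
def swapHom : DoubleAmalgam U →* DoubleAmalgam U :=
  PushoutI.lift (fun b => factor U (!b)) (PushoutI.base _)
    fun b => PushoutI.of_comp_eq_base (φ := fun _ : Bool => U.subtype) (!b)

theorem swapHom_of (b : Bool) (h : H) :
    swapHom U (factor U b h) =
      factor U (!b) h :=
  PushoutI.lift_of _ _ _ _

theorem swapHom_comp_swapHom : (swapHom U).comp (swapHom U) = MonoidHom.id _ := by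
  refine PushoutI.hom_ext_nonempty fun b => ?_
  ext1 h
  change swapHom U (swapHom U (factor U b h)) = factor U b h
  rw [swapHom_of, swapHom_of, Bool.not_not]

/-- The automorphism of `H *_U H` that swaps the two factors. -/
def swap : MulAut (DoubleAmalgam U) :=
  (swapHom U).toMulEquiv (swapHom U) (swapHom_comp_swapHom U) (swapHom_comp_swapHom U)

theorem swap_of (b : Bool) (h : H) :
    swap U (factor U b h) =
      factor U (!b) h :=
  swapHom_of U b h

/-- The homomorphism from `H *_U H` to the HNN extension of `H` along the identity of `U` that is
the inclusion of `H` on the first factor and its conjugate by the stable letter on the second. -/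
def toHNNExtension : DoubleAmalgam U →* HNNExtension H U U (MulEquiv.refl U) :=
  PushoutI.lift
    (fun b => bif b then (MulAut.conj HNNExtension.t).toMonoidHom.comp HNNExtension.of
      else HNNExtension.of)
    (HNNExtension.of.comp U.subtype) (by
      rintro (_ | _)
      · rfl
      · ext x
        exact (HNNExtension.equiv_eq_conj (φ := MulEquiv.refl U) x).symm)

/-- Inside the semidirect product of `H *_U H` with its automorphisms, conjugation by the swap
takes the place of conjugation by the stable letter. -/
def ofHNNExtension : HNNExtension H U U (MulEquiv.refl U) →*
    DoubleAmalgam U ⋊[MonoidHom.id (MulAut (DoubleAmalgam U))] MulAut (DoubleAmalgam U) :=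
  HNNExtension.lift (SemidirectProduct.inl.comp (factor U false)) (SemidirectProduct.inr (swap U))
    fun a => by
      have h1 := SemidirectProduct.inl_aut (φ := MonoidHom.id (MulAut (DoubleAmalgam U))) (swap U)
        (factor U false (a : H))
      have h2 : swap U (factor U false (a : H)) =
          factor U false (a : H) := by
        rw [swap_of]
        exact (PushoutI.of_apply_eq_base (fun _ : Bool => U.subtype) true a).trans
          (PushoutI.of_apply_eq_base (fun _ : Bool => U.subtype) false a).symm
      rw [MonoidHom.id_apply, h2, map_inv, eq_mul_inv_iff_mul_eq] at h1
      exact h1.symm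

theorem ofHNNExtension_of (h : H) :
    ofHNNExtension U (HNNExtension.of h) = SemidirectProduct.inl (factor U false h) :=
  HNNExtension.lift_of _ _ _ _

theorem ofHNNExtension_t : ofHNNExtension U HNNExtension.t = SemidirectProduct.inr (swap U) :=
  HNNExtension.lift_t _ _ _

theorem toHNNExtension_injective : Function.Injective (toHNNExtension U) := by
  have h : (ofHNNExtension U).comp (toHNNExtension U) = SemidirectProduct.inl := by
    refine PushoutI.hom_ext_nonempty fun b => ?_
    ext1 h
    change ofHNNExtension U (toHNNExtension U (factor U b h)) = _
    rw [toHNNExtension, factor, PushoutI.lift_of]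
    cases b
    · exact ofHNNExtension_of U h
    · change ofHNNExtension U (HNNExtension.t * HNNExtension.of h * HNNExtension.t⁻¹) = _
      rw [map_mul, map_mul, map_inv, ofHNNExtension_of, ofHNNExtension_t, ← map_inv]
      refine (SemidirectProduct.inl_aut (φ := MonoidHom.id (MulAut (DoubleAmalgam U))) (swap U)
        (factor U false h)).symm.trans ?_
      rw [MonoidHom.id_apply, swap_of]
      rfl
  refine Function.Injective.of_comp (f := ofHNNExtension U) ?_
  have h1 : ⇑(ofHNNExtension U) ∘ ⇑(toHNNExtension U) = SemidirectProduct.inl := by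
    rw [← h]
    rfl
  rw [h1]
  exact SemidirectProduct.inl_injective

theorem isSubdued : IsSubdued.{v, v, v} (DoubleAmalgam U) H :=
  (HNNExtension.isSubdued (φ := MulEquiv.refl U) 1 (by simp)).of_injective (toHNNExtension U)
    (toHNNExtension_injective U)

end DoubleAmalgam

end

theorem theorem2 {H : Type v} [Group H] [Countable H] :
    (∀ (G : Type u) [Group G] [Countable G], IsSubdued.{u, v, w} G H →
      (traceKZero G).range ≤ (traceKZero H).range) ∧
    (∀ U : Subgroup H, IsSubdued.{v, v, v} (DoubleAmalgam U) H ∧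
      (traceKZero (DoubleAmalgam U)).range ≤ (traceKZero H).range) ∧
    (∀ (A B : Subgroup H) (φ : A ≃* B) (g : H), (∀ a : A, (φ a : H) = g * a * g⁻¹) →
      IsSubdued.{v, v, v} (HNNExtension H A B φ) H ∧
      (traceKZero (HNNExtension H A B φ)).range ≤ (traceKZero H).range) :=
  ⟨fun _ _ _ h => h.range_traceKZero_le,
    fun U => ⟨DoubleAmalgam.isSubdued U, (DoubleAmalgam.isSubdued U).range_traceKZero_le⟩,
    fun _ _ _ g hg => ⟨HNNExtension.isSubdued g hg,
      (HNNExtension.isSubdued g hg).range_traceKZero_le⟩⟩
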